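/- Let $n\ge 0$, let $0<\zeta_1<\dots<\zeta_n$ and $b_1(0),\dots,b_n(0)>0$ be real numbers, and put $b_j(t)=b_j(0)e^{t/\zeta_j}$ for $t\in\mathbb R$. For $I\subseteq\{1,\dots,n\}$ write $b_I=\prod_{j\in I}b_j$, $\zeta_I=\prod_{j\in I}\zeta_j$, $\Delta_I=\prod_{i<j\in I}(\zeta_j-\zeta_i)$, $\Gamma_I=\prod_{i<j\in I}(\zeta_j+\zeta_i)$, and for $k\in\mathbb Z$ $$T_k=\sum_{|I|=k}\frac{\Delta_I^2}{\zeta_I\Gamma_I}b_I,\quad U_k=\sum_{|I|=k}\frac{\Delta_I^2}{\Gamma_I}b_I,\quad V_k=\sum_{|I|=k}\frac{\Delta_I^2}{\Gamma_I}\zeta_Ib_I,$$ $$W_k=V_kU_k-V_{k-1}U_{k+1},\qquad Z_k=T_kU_k-T_{k+1}U_{k-1}$$ (so $T_0=U_0=V_0=1$ and $T_k=U_k=V_k=0$ for $k<0$ and for $k>n$). For $1\le k\le n$ and $k'=n+1-k$ put $$x_{k'}=\tfrac12\log\frac{Z_k}{W_{k-1}},\qquad m_{k'}=\frac{\sqrt{Z_kW_{k-1}}}{U_kU_{k-1}},\qquad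 u(t,x)=\sum_{k=1}^n m_k(t)e^{-|x-x_k(t)|}.$$ Then the following hold. 1. For all $t\in\mathbb R$: $U_k>0$ for $0\le k\le n$, $Z_k>0$ and $W_{k-1}>0$ for $1\le k\le n$ (so the formulas make sense), $x_1(t)<\dots<x_n(t)$, and $m_k(t)>0$. 2. For all $t\in\mathbb R$ the Novikov $n$-peakon equations hold: $\dot x_k=u(x_k)^2$, $\dot m_k=-m_k\,u(x_k)\,\langle u_x\rangle(x_k)$, $1\le k\le n$, where $\langle f\rangle(a)$ is the average of the left and right limits of $f$ at $a$. Moreover $u$ is a weak solution of the Novikov equation $m_t+m_xu^2+3muu_x=0$, $m=u-u_{xx}$, in the sense that $u(t,\cdot)$ is locally Lipschitz and $$(1-\partial_x^2)u_t+(4-\partial_x^2)\partial_x\big(\tfrac13u^3\big)+\partial_x\big(\tfrac32uu_x^2\big)+\tfrac12u_x^3=0$$ as distributions in $x$ for every $t$ (with $u_t$ the $t$-derivative in the space of distributions). 3. The flow is isospectral: with $E=(e^{-|x_i-x_j|})_{i,j}$, $P=\mathrm{diag}(m_1,\dots,m_n)$ and $S$ the lower triangular matrix with $1$ on and $2$ below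 the diagonal (so that $\varphi=-\lambda^2EPSP\varphi$ is the discrete form of the $x$-part of the Lax pair with decaying boundary conditions), the characteristic polynomial of $EPSP$ is $\prod_{j=1}^n(X-\zeta_j^{-1})$ for every $t$. 4. Let $f_k(t)=\sum_j\zeta_j^kb_j(t)$, $k\in\mathbb Z$, and consider Pfaffians with antisymmetric entries $$(d_0,i)=f_i(t),\quad(d_{-1},i)=f_{i-1}(t),\quad(d_0,d_{-1})=0,$$ $$(i,j)=\iint_{-\infty<t_1<t_2<t}\big[f_{i-1}(t_2)f_{j-1}(t_1)-f_{i-1}(t_1)f_{j-1}(t_2)\big]dt_1dt_2\qquad(i,j\in\mathbb Z);$$ the double integrals converge absolutely. For $l\in\mathbb Z$ let $\tau^{(l)}_k=(l,l+1,\dots,l+k-1)$ for even $k\ge0$ (equal to $1$ for $k=0$), $\tau^{(l)}_k=(d_0,l,l+1,\dots,l+k-1)$ for odd $k>0$, and $\tau^{(l)}_k=0$ for $k<0$. Then $T_k=\tau^{(-1)}_k$, $U_k=\tau^{(0)}_k$, $V_k=\tau^{(1)}_k$ for all $k\in\mathbb Z$ and $t$. 5. For all $l\in\mathbb Z$ and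 $k\ge1$ the derivative formulas of Wronski type and of Gram type hold: $$\dot\tau^{(l)}_k=(l-1,l+1,\dots,l+k-1)=(d_0,d_{-1},l,\dots,l+k-1)\quad(k\text{ even}),$$ $$\dot\tau^{(l)}_k=(d_0,l-1,l+1,\dots,l+k-1)=(d_{-1},l,\dots,l+k-1)\quad(k\text{ odd}).$$ (For $k\le 0$ the function $\tau^{(l)}_k$ is constant and its derivative is $0$.) 6. With $T_k,U_k,V_k$ and their derivatives expressed by the Pfaffians of 4 and 5, the following bilinear Pfaffian identities hold for $0\le k\le n$ and all $t$: $$\dot U_{k+1}U_k-U_{k+1}\dot U_k=T_{k+1}V_k-V_{k-1}T_{k+2},$$ $$\dot U_kV_k-U_k\dot V_k=\dot U_{k+1}V_{k-1}-U_{k+1}\dot V_{k-1},\qquad\dot T_kU_k-T_k\dot U_k=\dot T_{k+1}U_{k-1}-T_{k+1}\dot U_{k-1}.$$ 7. The peakon equations reduce to these identities: if $T_k,U_k,V_k$ ($k\in\mathbb Z$) are arbitrary differentiable real functions of $t\in\mathbb R$ with $T_{n+1}=V_{-1}=0$ such that, for all $t$, the three identities of 6 hold for $0\le k\le n$, the quantities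 $U_k$ $(0\le k\le n)$, $Z_k$ and $W_{k-1}$ $(1\le k\le n)$ are positive and $x_1<\dots<x_n$ (all defined by the same formulas), then $x_k,m_k$ satisfy the peakon equations of 2 for all $t$. -/

import Mathlib

open scoped ContDiff

noncomputable section

namespace NovikovPeakon

/-! ### Multipeakons and the Novikov equation -/

/-- The multipeakon profile `u(x) = ∑ₖ mₖ exp(-|x - xₖ|)`. -/
def profile {n : ℕ} (x m : Fin n → ℝ) (y : ℝ) : ℝ :=
  ∑ k, m k * Real.exp (-|y - x k|)

/-- `v = ⟨f⟩(a)`: both one-sided limits of `f` at `a` exist and `v` is their average. -/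
def IsAverageAt (f : ℝ → ℝ) (a v : ℝ) : Prop :=
  ∃ l r : ℝ, Filter.Tendsto f (nhdsWithin a (Set.Iio a)) (nhds l) ∧
    Filter.Tendsto f (nhdsWithin a (Set.Ioi a)) (nhds r) ∧ v = (l + r) / 2

/-- The Novikov `n`-peakon system `ẋₖ = u(xₖ)²`, `ṁₖ = -mₖ u(xₖ) ⟨uₓ⟩(xₖ)`, for all times.
Here `x t k` and `m t k` are position and momentum of the `k`-th peakon at time `t`. -/
def SolvesPeakonODE {n : ℕ} (x m : ℝ → Fin n → ℝ) : Prop :=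
  ∀ (t : ℝ) (k : Fin n),
    HasDerivAt (fun s => x s k) (profile (x t) (m t) (x t k) ^ 2) t ∧
    ∃ v : ℝ, IsAverageAt (deriv (profile (x t) (m t))) (x t k) v ∧
      HasDerivAt (fun s => m s k) (-(m t k) * profile (x t) (m t) (x t k) * v) t

/-- Weak solutions of the Novikov equation `mₜ + mₓ u² + 3 m u uₓ = 0`, `m = u - uₓₓ`, written as
`(1 - ∂ₓ²) uₜ + (4 - ∂ₓ²) ∂ₓ(u³/3) + ∂ₓ((3/2) u uₓ²) + (1/2) uₓ³ = 0`,
as an identity of distributions in `x` at every time `t`; the time derivative is taken in the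
space of distributions, and `u(t, ·)` is locally Lipschitz, so that `uₓ` is an ordinary
derivative almost everywhere. The arguments of `u` are time and position, in this order. -/
def IsWeakNovikovSolution (u : ℝ → ℝ → ℝ) : Prop :=
  (∀ t, LocallyLipschitz (u t)) ∧
  ∀ ψ : ℝ → ℝ, ContDiff ℝ ∞ ψ → HasCompactSupport ψ → ∀ t : ℝ,
    HasDerivAt (fun s => ∫ y, u s y * (ψ y - iteratedDeriv 2 ψ y))
      (∫ y, (u t y ^ 3 / 3 * (4 * deriv ψ y - iteratedDeriv 3 ψ y)
        + 3 / 2 * u t y * deriv (u t) y ^ 2 * deriv ψ y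
        - 1 / 2 * deriv (u t) y ^ 3 * ψ y)) t

/-- The matrix `E P S P` with `E = (exp(-|xᵢ - xⱼ|))`, `P = diag(m)`, and `S` lower triangular with
`1` on and `2` below the diagonal. For `x₀ < x₁ < ⋯` it is the discrete form of the spectral problem
`Φ₁' = λ μ Φ₂ + Φ₃`, `Φ₂' = λ μ Φ₃`, `Φ₃' = Φ₁`, `μ = 2 ∑ mₖ δ(· - xₖ)` (the `x`-part of the Lax
pair): the solutions with `Φ₃(±∞) = 0`, `Φ₂(-∞) = 0` are given by
`φ = -λ² (E P S P) φ`, where `φₖ = Φ₃(xₖ)`. -/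
def spectralMatrix {n : ℕ} (x m : Fin n → ℝ) : Matrix (Fin n) (Fin n) ℝ :=
  (Matrix.of fun i j => Real.exp (-|x i - x j|)) * Matrix.diagonal m *
    (Matrix.of fun i j => if j < i then (2 : ℝ) else if i = j then 1 else 0) * Matrix.diagonal m

/-! ### The explicit formulas -/

/-- `Δ_I = ∏_{i < j in I} (ζⱼ - ζᵢ)`. -/
def Delta {n : ℕ} (ζ : Fin n → ℝ) (I : Finset (Fin n)) : ℝ :=
  ∏ i ∈ I, ∏ j ∈ I with i < j, (ζ j - ζ i)

/-- `Γ_I = ∏_{i < j in I} (ζⱼ + ζᵢ)`. -/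
def Gam {n : ℕ} (ζ : Fin n → ℝ) (I : Finset (Fin n)) : ℝ :=
  ∏ i ∈ I, ∏ j ∈ I with i < j, (ζ j + ζ i)

/-- `T_k`, for `k : ℤ`: the sum over the `k`-element index sets (`T_0 = 1`; `T_k = 0` for `k < 0`
and for `k > n`). The same conventions hold for `tauU`, `tauV`. -/
def tauT {n : ℕ} (ζ b : Fin n → ℝ) (k : ℤ) : ℝ :=
  ∑ I : Finset (Fin n) with (I.card : ℤ) = k,
    Delta ζ I ^ 2 / ((∏ j ∈ I, ζ j) * Gam ζ I) * ∏ j ∈ I, b j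

/-- `U_k`. -/
def tauU {n : ℕ} (ζ b : Fin n → ℝ) (k : ℤ) : ℝ :=
  ∑ I : Finset (Fin n) with (I.card : ℤ) = k, Delta ζ I ^ 2 / Gam ζ I * ∏ j ∈ I, b j

/-- `V_k`. -/
def tauV {n : ℕ} (ζ b : Fin n → ℝ) (k : ℤ) : ℝ :=
  ∑ I : Finset (Fin n) with (I.card : ℤ) = k,
    Delta ζ I ^ 2 / Gam ζ I * (∏ j ∈ I, ζ j) * ∏ j ∈ I, b j

/-- `W_k = V_k U_k - V_{k-1} U_{k+1}`. -/
def wOf (U V : ℤ → ℝ) (k : ℤ) : ℝ := V k * U k - V (k - 1) * U (k + 1)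

/-- `Z_k = T_k U_k - T_{k+1} U_{k-1}`. -/
def zOf (T U : ℤ → ℝ) (k : ℤ) : ℝ := T k * U k - T (k + 1) * U (k - 1)

/-- `x_{k'} = (1/2) log (Z_k / W_{k-1})`, `k' = n + 1 - k`. The peakon number `k' ∈ {1, …, n}` is
`i + 1` with `i : Fin n`, so that `k = n - i`. -/
def position (n : ℕ) (T U V : ℤ → ℝ) (i : Fin n) : ℝ :=
  1 / 2 * Real.log (zOf T U ((n : ℤ) - (i : ℕ)) / wOf U V ((n : ℤ) - (i : ℕ) - 1))

/-- `m_{k'} = √(Z_k W_{k-1}) / (U_k U_{k-1})`, `k' = n + 1 - k`. -/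
def momentum (n : ℕ) (T U V : ℤ → ℝ) (i : Fin n) : ℝ :=
  √(zOf T U ((n : ℤ) - (i : ℕ)) * wOf U V ((n : ℤ) - (i : ℕ) - 1)) /
    (U ((n : ℤ) - (i : ℕ)) * U ((n : ℤ) - (i : ℕ) - 1))

/-- The flow `b_j(t) = b_j(0) exp(t / ζ_j)` (with `ζ` fixed). -/
def flow {n : ℕ} (ζ b₀ : Fin n → ℝ) (t : ℝ) (j : Fin n) : ℝ := b₀ j * Real.exp (t / ζ j)

/-- The formulas for positions and momenta make sense and give ordered positions:
`T_{n+1} = 0 = V_{-1}`, all the quantities in denominators and under logarithms and roots are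
positive, and `x_1 < ⋯ < x_n`. -/
structure Admissible (n : ℕ) (T U V : ℤ → ℝ) : Prop where
  T_end : T ((n : ℤ) + 1) = 0
  V_end : V (-1) = 0
  U_pos : ∀ k : ℤ, 0 ≤ k → k ≤ n → 0 < U k
  Z_pos : ∀ k : ℤ, 1 ≤ k → k ≤ n → 0 < zOf T U k
  W_pos : ∀ k : ℤ, 0 ≤ k → k < n → 0 < wOf U V k
  ordered : StrictMono (position n T U V)

/-- The bilinear identities, with `T'`, `U'`, `V'` in the role of the time derivatives. -/
structure BilinearIdentities (n : ℕ) (T U V T' U' V' : ℤ → ℝ) : Prop where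
  first : ∀ k : ℤ, 0 ≤ k → k ≤ n →
    U' (k + 1) * U k - U (k + 1) * U' k = T (k + 1) * V k - V (k - 1) * T (k + 2)
  second : ∀ k : ℤ, 0 ≤ k → k ≤ n →
    U' k * V k - U k * V' k = U' (k + 1) * V (k - 1) - U (k + 1) * V' (k - 1)
  third : ∀ k : ℤ, 0 ≤ k → k ≤ n →
    T' k * U k - T k * U' k = T' (k + 1) * U (k - 1) - T (k + 1) * U' (k - 1)

/-! ### Pfaffians -/

/-- `σ`, read as the sequence `i₁, i₂, …` of its values, lists a perfect matching of `Fin M`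
(`M` even) in standard form: `i_{2l-1} < i_{2l}` and `i_{2l-1} < i_{2l+1}`. -/
def IsMatching {M : ℕ} (σ : Equiv.Perm (Fin M)) : Prop :=
  (∀ l : Fin (M / 2), σ ⟨2 * l, by omega⟩ < σ ⟨2 * l + 1, by omega⟩) ∧
  ∀ l l' : Fin (M / 2), l < l' → σ ⟨2 * l, by omega⟩ < σ ⟨2 * l', by omega⟩

open Classical in
/-- The Pfaffian of an antisymmetric `M × M` matrix: the signed sum over perfect matchings
(`0` for odd `M`, `1` for `M = 0`). -/
def pfaffian {M : ℕ} (A : Matrix (Fin M) (Fin M) ℝ) : ℝ :=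
  if Even M then
    ∑ σ : Equiv.Perm (Fin M) with IsMatching σ, ((Equiv.Perm.sign σ : ℤ) : ℝ) *
      ∏ l : Fin (M / 2), A (σ ⟨2 * l, by omega⟩) (σ ⟨2 * l + 1, by omega⟩)
  else 0

/-- The labels of rows and columns: the characters `d₀`, `d₋₁` and the integers. -/
inductive Label : Type
  | d0 : Label
  | dm1 : Label
  | num (i : ℤ) : Label

/-- `f_k(t) = ∑ⱼ ζⱼᵏ bⱼ(t)`. -/
def moment {n : ℕ} (ζ b₀ : Fin n → ℝ) (k : ℤ) (t : ℝ) : ℝ := ∑ j, ζ j ^ k * flow ζ b₀ t j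

/-- The integrand of the Pfaffian entry `(i, j)`; the argument is `(t₁, t₂)`. -/
def entryIntegrand {n : ℕ} (ζ b₀ : Fin n → ℝ) (i j : ℤ) (p : ℝ × ℝ) : ℝ :=
  moment ζ b₀ (i - 1) p.2 * moment ζ b₀ (j - 1) p.1 -
    moment ζ b₀ (i - 1) p.1 * moment ζ b₀ (j - 1) p.2

/-- The domain `-∞ < t₁ < t₂ < t`. -/
def entryDomain (t : ℝ) : Set (ℝ × ℝ) := {p | p.1 < p.2 ∧ p.2 < t}

/-- The antisymmetric Pfaffian entries at time `t`: `(d₀, i) = f_i`, `(d₋₁, i) = f_{i-1}`,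
`(d₀, d₋₁) = 0`, and `(i, j)` is the double integral. -/
def entry {n : ℕ} (ζ b₀ : Fin n → ℝ) (t : ℝ) : Label → Label → ℝ
  | .num i, .num j => ∫ p in entryDomain t, entryIntegrand ζ b₀ i j p
  | .d0, .num i => moment ζ b₀ i t
  | .num i, .d0 => -moment ζ b₀ i t
  | .dm1, .num i => moment ζ b₀ (i - 1) t
  | .num i, .dm1 => -moment ζ b₀ (i - 1) t
  | _, _ => 0

/-- The Pfaffian `(a₁, a₂, …, a_{2N})` of a list of labels, at time `t`. -/
def pf {n : ℕ} (ζ b₀ : Fin n → ℝ) (t : ℝ) (L : List Label) : ℝ :=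
  pfaffian (Matrix.of fun i j : Fin L.length => entry ζ b₀ t (L.get i) (L.get j))

/-- The list `l, l + 1, …, l + K - 1` of `K` consecutive integers. -/
def consec (l : ℤ) (K : ℕ) : List Label := (List.range K).map fun i => Label.num (l + (i : ℤ))

/-- `(l, …, l + K - 1)` for even `K ≥ 0`, `(d₀, l, …, l + K - 1)` for odd `K > 0`, and `0`
for `K < 0`. -/
def pfTau {n : ℕ} (ζ b₀ : Fin n → ℝ) (l : ℤ) (t : ℝ) : ℤ → ℝ
  | Int.ofNat K => pf ζ b₀ t (if Even K then consec l K else .d0 :: consec l K)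
  | Int.negSucc _ => 0

/-- The Wronski-type derivative of `pfTau`: `(l - 1, l + 1, …, l + K - 1)` for even `K > 0`,
`(d₀, l - 1, l + 1, …, l + K - 1)` for odd `K > 0`, and `0` for `K ≤ 0`. -/
def pfTauWronski {n : ℕ} (ζ b₀ : Fin n → ℝ) (l : ℤ) (t : ℝ) : ℤ → ℝ
  | Int.ofNat 0 => 0
  | Int.ofNat (K + 1) => pf ζ b₀ t
      (if Even (K + 1) then .num (l - 1) :: consec (l + 1) K
        else .d0 :: .num (l - 1) :: consec (l + 1) K)
  | Int.negSucc _ => 0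

/-- The Gram-type derivative of `pfTau`: `(d₀, d₋₁, l, …, l + K - 1)` for even `K ≥ 0`,
`(d₋₁, l, …, l + K - 1)` for odd `K > 0`, and `0` for `K < 0`. -/
def pfTauGram {n : ℕ} (ζ b₀ : Fin n → ℝ) (l : ℤ) (t : ℝ) : ℤ → ℝ
  | Int.ofNat K => pf ζ b₀ t
      (if Even K then .d0 :: .dm1 :: consec l K else .dm1 :: consec l K)
  | Int.negSucc _ => 0

end NovikovPeakon

end

open NovikovPeakon

/-!
The proof rests on the fact that `T_k`, `U_k`, `V_k` are Pfaffians, so that everything follows from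
the bilinear identities which Pfaffians satisfy.

*Pfaffians.* A Pfaffian is treated as a function `wordPf` of words, defined by expansion along the
first letter. Since contractions of words anticommute (`contract_contract`), it is alternating, and
expanding both factors of a product of two Pfaffians in the two possible ways (`contract_wordPf`)
gives the quadratic identities with four free letters (`wordPf_bilinear_even`,
`wordPf_bilinear_odd`). The double integrals equal
`∑ ζₐⁱ bₐ ζ_cʲ b_c (ζ_c - ζₐ) / (ζ_c + ζₐ)` (`entry_num_num`), hence multilinearity reduces the
Pfaffians to Schur's Pfaffian `∏ (xⱼ - xᵢ) / (xⱼ + xᵢ)` (`wordPf_schurEntry`), and symmetrization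
produces a Vandermonde determinant; this gives the sums over index sets (`pfTau_eq_tauSum`).
Differentiation lowers the indices of the entries, but also turns an entry into an antisymmetric
product of border entries; the first fact gives the derivative formula of Wronski type, the second
that of Gram type.

*Reduction.* By definition `m_{k'} exp(±x_{k'})` are differences of consecutive quotients
`T_{k+1} / U_k` and `V_{k-1} / U_k`, so that the sums `u(x_{k'})` and `⟨u_x⟩(x_{k'})` telescope.
Two of the bilinear identities simplify the derivatives of `Z_k` and `W_k`, and the
remaining one matches them with the telescoped sums (`hasDerivAt_position_momentum`).

*Positivity and ordering.* The bilinear identities imply that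
`(Z_k W_k - Z_{k+1} W_{k-1}) / U_k⁴` is constant in time, and the asymptotics for `t → ∞` show that
the constant is `1` (`zOf_mul_wOf_sub`). The set of times where all `Z_k` and `W_k` are positive is
nonempty and open, and by this identity it is closed; so it is the whole line
(`zOf_pos_and_wOf_pos`). The same identity then says that `Z_{k+1} / W_k < Z_k / W_{k-1}`, which is
the ordering of the positions.

*Weak form.* Between the peaks `u_xx = u`, and all terms of the equation integrated against a test
function have explicit antiderivatives. Only their jumps at the peaks contribute, and these cancel
by the peakon equations (`isWeakNovikovSolution_profile`).

*Isospectrality.* Along the flow `M = E P S P` satisfies a Lax equation `Ṁ = BM - MB` with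
`B = diag(u u_x) + diag(u) S P` (`hasDerivAt_spectralMatrix`), so its characteristic polynomial is
constant. As `t → ∞` the distances of the peaks tend to infinity and `m_{k'}²` tends to `1 / ζ_k`,
with `k' = n + 1 - k`; the limit of `M` is triangular with diagonal entries `1 / ζ_k`
(`charpoly_spectralMatrix`).
-/

namespace NovikovPeakon

/-! ### Pfaffians of words -/

/-- The signed contraction `∑ⱼ (-1)ʲ g(Lⱼ) F(L without its j-th letter)` of a function `F` of words
with a function `g` of letters, evaluated at the word `L`. -/
noncomputable def contract {α : Type*} (g : α → ℝ) : List α → (List α → ℝ) → ℝ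
  | [], _ => 0
  | x :: L, F => g x * F L - contract g L fun L' => F (x :: L')

/-- The Pfaffian `(a₁, …, a_{2k})` of the word `a₁ … a_{2k}`, with entries `A`, defined by expansion
along the first letter. It is `0` on words whose length is not `2k`. -/
noncomputable def wordPf {α : Type*} (A : α → α → ℝ) : ℕ → List α → ℝ
  | 0, [] => 1
  | 0, _ :: _ => 0
  | _ + 1, [] => 0
  | k + 1, a :: L => contract (A a) L (wordPf A k)

/-- A function of words is alternating if it changes sign when two adjacent letters are swapped. -/
def IsAlternating {α : Type*} (F : List α → ℝ) : Prop :=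
  ∀ (L₁ : List α) (a b : α) (L₂ : List α), F (L₁ ++ a :: b :: L₂) = -F (L₁ ++ b :: a :: L₂)

section Words

variable {α β : Type*}

theorem contract_nil (g : α → ℝ) (F : List α → ℝ) : contract g [] F = 0 := rfl

theorem contract_cons (g : α → ℝ) (x : α) (L : List α) (F : List α → ℝ) :
    contract g (x :: L) F = g x * F L - contract g L fun L' => F (x :: L') := rfl

theorem wordPf_succ_cons (A : α → α → ℝ) (k : ℕ) (a : α) (L : List α) :
    wordPf A (k + 1) (a :: L) = contract (A a) L (wordPf A k) := rfl

theorem contract_congr {g h : α → ℝ} {F G : List α → ℝ} {L : List α}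
    (hg : ∀ x ∈ L, g x = h x) (hF : ∀ L', L' ⊆ L → L'.length + 1 = L.length → F L' = G L') :
    contract g L F = contract h L G := by
  induction L generalizing F G with
  | nil => rfl
  | cons x L ih =>
    rw [contract_cons, contract_cons, hg x (by simp), hF L (by simp) (by simp)]
    congr 1
    refine ih (fun y hy => hg y (by simp [hy])) fun L' hL' hlen => hF _ ?_ (by simp [hlen])
    exact List.cons_subset_cons x hL'

theorem contract_add (g : α → ℝ) (L : List α) (F G : List α → ℝ) :
    contract g L (fun L' => F L' + G L') = contract g L F + contract g L G := by
  induction L generalizing F G with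
  | nil => simp [contract_nil]
  | cons x L ih => simp only [contract_cons, ih]; ring

theorem contract_smul (g : α → ℝ) (L : List α) (c : ℝ) (F : List α → ℝ) :
    contract g L (fun L' => c * F L') = c * contract g L F := by
  induction L generalizing F with
  | nil => simp [contract_nil]
  | cons x L ih => simp only [contract_cons, ih]; ring

theorem contract_zero (g : α → ℝ) (L : List α) : contract g L (fun _ => 0) = 0 := by
  simpa using contract_smul g L 0 fun _ => 0

theorem contract_sub (g : α → ℝ) (L : List α) (F G : List α → ℝ) :
    contract g L (fun L' => F L' - G L') = contract g L F - contract g L G := by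
  have h := contract_add g L F fun L' => -1 * G L'
  rw [contract_smul] at h
  rw [sub_eq_add_neg, ← neg_one_mul, ← h]
  congr 1
  funext L'
  ring

theorem contract_sum {ι : Type*} (s : Finset ι) (g : α → ℝ) (L : List α) (F : ι → List α → ℝ) :
    contract g L (fun L' => ∑ i ∈ s, F i L') = ∑ i ∈ s, contract g L (F i) := by
  classical
  induction s using Finset.induction_on with
  | empty => simpa using contract_zero g L
  | insert i s hi ih => simp only [Finset.sum_insert hi, contract_add, ih]

theorem contract_add_left (g h : α → ℝ) (L : List α) (F : List α → ℝ) :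
    contract (fun x => g x + h x) L F = contract g L F + contract h L F := by
  induction L generalizing F with
  | nil => simp [contract_nil]
  | cons x L ih => simp only [contract_cons, ih]; ring

theorem contract_smul_left (c : ℝ) (g : α → ℝ) (L : List α) (F : List α → ℝ) :
    contract (fun x => c * g x) L F = c * contract g L F := by
  induction L generalizing F with
  | nil => simp [contract_nil]
  | cons x L ih => simp only [contract_cons, ih]; ring

theorem contract_sub_left (g h : α → ℝ) (L : List α) (F : List α → ℝ) :
    contract (fun x => g x - h x) L F = contract g L F - contract h L F := by
  induction L generalizing F with
  | nil => simp [contract_nil]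
  | cons x L ih => simp only [contract_cons, ih]; ring

theorem contract_neg_left (g : α → ℝ) (L : List α) (F : List α → ℝ) :
    contract (fun x => -g x) L F = -contract g L F := by
  induction L generalizing F with
  | nil => simp [contract_nil]
  | cons x L ih => simp only [contract_cons, ih]; ring

theorem contract_eq_zero {g : α → ℝ} {L : List α} (F : List α → ℝ) (hg : ∀ x ∈ L, g x = 0) :
    contract g L F = 0 := by
  rw [contract_congr (h := fun x => 0 * g x) (G := F) (by simpa using hg) fun _ _ _ => rfl,
    contract_smul_left, zero_mul]

/-- Contractions anticommute. This is what makes word Pfaffians alternating. -/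
theorem contract_contract (g h : α → ℝ) (L : List α) (F : List α → ℝ) :
    contract g L (fun L' => contract h L' F) = -contract h L (fun L' => contract g L' F) := by
  induction L generalizing F with
  | nil => simp [contract_nil]
  | cons x L ih =>
    simp only [contract_cons, contract_sub, contract_smul, ih]
    ring

/-- The two contractions of a double sum over the letters of two words may be interchanged. -/
theorem contract_exchange (A : α → β → ℝ) (w : List α) (v : List β) (F : List α → ℝ)
    (G : List β → ℝ) :
    contract (fun x => contract (fun y => A x y) v G) w F =
      contract (fun y => contract (fun x => A x y) w F) v G := by
  induction v generalizing G with
  | nil => simpa [contract_nil] using contract_eq_zero (g := fun _ => 0) F (by simp)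
  | cons y v ih =>
    simp only [contract_cons, contract_sub_left, ih]
    congr 1
    simp only [mul_comm _ (G v)]
    exact contract_smul_left _ _ _ _

theorem IsAlternating.cons {F : List α → ℝ} (hF : IsAlternating F) (x : α) :
    IsAlternating fun L => F (x :: L) := fun L₁ a b L₂ => hF (x :: L₁) a b L₂

theorem IsAlternating.contract {F : List α → ℝ} (hF : IsAlternating F) (g : α → ℝ) :
    IsAlternating fun L => contract g L F := by
  intro L₁ a b L₂
  induction L₁ generalizing F with
  | nil =>
    simp only [List.nil_append, contract_cons]
    have h : (fun L' => F (a :: b :: L')) = fun L' => -1 * F (b :: a :: L') := by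
      funext L'
      rw [neg_one_mul]
      exact hF [] a b L'
    rw [h, contract_smul]
    ring
  | cons x L₁ ih =>
    simp only [List.cons_append, contract_cons]
    have h1 := ih (hF.cons x)
    beta_reduce at h1
    rw [hF L₁ a b L₂, h1]
    ring

theorem IsAlternating.wordPf {A : α → α → ℝ} (hA : ∀ x y, A x y = -A y x) (k : ℕ) :
    IsAlternating (wordPf A k) := by
  induction k with
  | zero =>
    intro L₁ a b L₂
    cases L₁ <;> simp [NovikovPeakon.wordPf]
  | succ k ih =>
    intro L₁ a b L₂
    cases L₁ with
    | cons x L₁ =>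
      simp only [List.cons_append, wordPf_succ_cons]
      exact ih.contract (A x) L₁ a b L₂
    | nil =>
      simp only [List.nil_append, wordPf_succ_cons, contract_cons]
      cases k with
      | zero =>
        simp only [NovikovPeakon.wordPf, contract_zero, hA a b]
        ring
      | succ k =>
        simp only [wordPf_succ_cons]
        rw [contract_contract, hA a b]
        ring

/-- A letter may be moved to the front, at the cost of a sign. -/
theorem IsAlternating.move {F : List α → ℝ} (hF : IsAlternating F) (L₁ : List α) (a : α)
    (L₂ : List α) : F (L₁ ++ a :: L₂) = (-1) ^ L₁.length * F (a :: (L₁ ++ L₂)) := by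
  induction L₁ generalizing F with
  | nil => simp
  | cons x L₁ ih =>
    have h1 := ih (hF.cons x)
    rw [List.cons_append, h1, show F (x :: a :: (L₁ ++ L₂)) = -F (a :: x :: (L₁ ++ L₂)) from
      hF [] x a _, List.length_cons, pow_succ, List.cons_append]
    ring

theorem IsAlternating.eq_zero_of_mem {F : List α → ℝ} (hF : IsAlternating F) {a : α} {L : List α}
    (ha : a ∈ L) : F (a :: L) = 0 := by
  obtain ⟨s, t, rfl⟩ := List.append_of_mem ha
  have h1 := (hF.cons a).move s a t
  have h2 : F (a :: a :: (s ++ t)) = 0 := by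
    have := hF [] a a (s ++ t)
    simp only [List.nil_append] at this
    linarith
  rw [h1, h2, mul_zero]

theorem contract_map (f : α → β) (g : β → ℝ) (L : List α) (F : List β → ℝ) :
    contract g (L.map f) F = contract (fun x => g (f x)) L fun L' => F (L'.map f) := by
  induction L generalizing F with
  | nil => rfl
  | cons x L ih => simp only [List.map_cons, contract_cons, ih]

theorem wordPf_map (A : β → β → ℝ) (f : α → β) (k : ℕ) (L : List α) :
    wordPf A k (L.map f) = wordPf (fun x y => A (f x) (f y)) k L := by
  induction k generalizing L with
  | zero => cases L <;> rfl
  | succ k ih =>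
    cases L with
    | nil => rfl
    | cons x L => simp only [List.map_cons, wordPf_succ_cons, contract_map, ih]

theorem wordPf_congr {A B : α → α → ℝ} (k : ℕ) {L : List α}
    (h : ∀ x ∈ L, ∀ y ∈ L, A x y = B x y) : wordPf A k L = wordPf B k L := by
  induction k generalizing L with
  | zero => cases L <;> rfl
  | succ k ih =>
    cases L with
    | nil => rfl
    | cons x L =>
      simp only [wordPf_succ_cons]
      refine contract_congr (fun y hy => h x (by simp) y (by simp [hy])) fun L' hL' _ => ih ?_
      exact fun y hy z hz => h y (by simp [hL' hy]) z (by simp [hL' hz])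

theorem wordPf_swap {A : α → α → ℝ} (hA : ∀ x y, A x y = -A y x) (k : ℕ) (a b : α) (L : List α) :
    wordPf A k (a :: b :: L) = -wordPf A k (b :: a :: L) :=
  IsAlternating.wordPf hA k [] a b L

theorem wordPf_eq_zero_of_mem {A : α → α → ℝ} (hA : ∀ x y, A x y = -A y x) (k : ℕ) {a : α}
    {L : List α} (ha : a ∈ L) :
    wordPf A k (a :: L) = 0 :=
  (IsAlternating.wordPf hA k).eq_zero_of_mem ha

/-- Expansion of both factors of a product of Pfaffians: the source of all bilinear identities. -/
theorem contract_wordPf {A : α → α → ℝ} (hA : ∀ x y, A x y = -A y x) (j k : ℕ)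
    (w v : List α) :
    contract (fun x => wordPf A (k + 1) (x :: v)) w (wordPf A j) =
      -contract (fun y => wordPf A (j + 1) (y :: w)) v (wordPf A k) := by
  simp only [wordPf_succ_cons]
  rw [contract_exchange (fun x y => A x y), ← contract_neg_left]
  refine contract_congr (fun y _ => ?_) fun _ _ _ => rfl
  rw [← contract_neg_left]
  exact contract_congr (fun x _ => hA x y) fun _ _ _ => rfl

end Words

/-! ### Bilinear identities and derivatives of word Pfaffians -/

section WordIdentities

variable {α β : Type*}

/-- The bilinear Pfaffian identity with four free letters and a common part `C`, of interest when
`C` has the even length `2 * k` and `j = k + 1`. -/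
theorem wordPf_bilinear_even {A : α → α → ℝ} (hA : ∀ x y, A x y = -A y x) (j k : ℕ)
    (a b c d : α) (C : List α) :
    wordPf A (j + 1) (a :: b :: c :: d :: C) * wordPf A k C =
      wordPf A (k + 1) (a :: b :: C) * wordPf A j (c :: d :: C) -
      wordPf A (k + 1) (a :: c :: C) * wordPf A j (b :: d :: C) +
      wordPf A (k + 1) (a :: d :: C) * wordPf A j (b :: c :: C) := by
  -- the terms in which a letter of `C` is paired contain this letter twice
  have h := contract_wordPf hA j k (b :: c :: d :: C) (a :: C)
  simp only [contract_cons] at h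
  rw [contract_eq_zero (g := fun x => wordPf A (k + 1) (x :: a :: C)) (L := C),
    contract_eq_zero (g := fun y => wordPf A (j + 1) (y :: b :: c :: d :: C)) (L := C)] at h
  · rw [wordPf_swap hA _ b a, wordPf_swap hA _ c a, wordPf_swap hA _ d a] at h
    linarith
  · intro x hx
    exact wordPf_eq_zero_of_mem hA _ (by simp [hx])
  · intro x hx
    exact wordPf_eq_zero_of_mem hA _ (by simp [hx])

/-- The bilinear Pfaffian identity with four free letters and a common part `C`, of interest when
`C` has the odd length `2 * k + 1` and `j = k + 2`. -/
theorem wordPf_bilinear_odd {A : α → α → ℝ} (hA : ∀ x y, A x y = -A y x) (j k : ℕ)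
    (a b c d : α) (C : List α) :
    wordPf A (k + 1) (a :: C) * wordPf A j (b :: c :: d :: C) -
      wordPf A (k + 1) (b :: C) * wordPf A j (a :: c :: d :: C) +
      wordPf A (k + 1) (c :: C) * wordPf A j (a :: b :: d :: C) -
      wordPf A (k + 1) (d :: C) * wordPf A j (a :: b :: c :: C) = 0 := by
  have h := contract_wordPf hA j k (a :: b :: c :: d :: C) C
  simp only [contract_cons] at h
  rw [contract_eq_zero (g := fun x => wordPf A (k + 1) (x :: C)) (L := C),
    contract_eq_zero (g := fun y => wordPf A (j + 1) (y :: a :: b :: c :: d :: C)) (L := C)] at h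
  · linarith
  · intro x hx
    exact wordPf_eq_zero_of_mem hA _ (by simp [hx])
  · intro x hx
    exact wordPf_eq_zero_of_mem hA _ hx

/-- Expansion along the third letter. -/
theorem wordPf_expand_third {A : α → α → ℝ} (hA : ∀ x y, A x y = -A y x) (k : ℕ) (a b x : α)
    (L : List α) :
    wordPf A (k + 1) (a :: b :: x :: L) =
      A x a * wordPf A k (b :: L) - A x b * wordPf A k (a :: L) +
        contract (A x) L fun L' => wordPf A k (a :: b :: L') := by
  have h1 : wordPf A (k + 1) (a :: b :: x :: L) = -wordPf A (k + 1) (a :: x :: b :: L) :=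
    IsAlternating.wordPf hA (k + 1) [a] b x L
  rw [h1, wordPf_swap hA _ a x]
  simp only [wordPf_succ_cons, contract_cons]
  ring

/-- The terms of the expansion of `(a, a, b, L) = 0` that pair the first letter with `L`. -/
theorem contract_wordPf_cons_cons {A : α → α → ℝ} (hA : ∀ x y, A x y = -A y x) (k : ℕ) (a b : α)
    (L : List α) :
    (contract (A a) L fun L' => wordPf A k (a :: b :: L')) = A a b * wordPf A k (a :: L) := by
  have haa : A a a = 0 := by linarith [hA a a]
  have h := wordPf_eq_zero_of_mem hA (k + 1) (a := a) (L := a :: b :: L) (by simp)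
  simp only [wordPf_succ_cons, contract_cons, haa] at h
  linarith

theorem contract_wordPf_cons_cons' {A : α → α → ℝ} (hA : ∀ x y, A x y = -A y x) (k : ℕ) (a b : α)
    (L : List α) :
    (contract (A b) L fun L' => wordPf A k (a :: b :: L')) = A a b * wordPf A k (b :: L) := by
  have h := contract_wordPf_cons_cons hA k b a L
  rw [hA a b, neg_mul, ← h, ← neg_one_mul, ← contract_smul]
  refine contract_congr (fun _ _ => rfl) fun L' _ _ => ?_
  rw [wordPf_swap hA]
  ring

theorem hasDerivAt_contract {g : ℝ → α → ℝ} {g' : α → ℝ} {F : ℝ → List α → ℝ} {F' : List α → ℝ}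
    {t : ℝ} {L : List α} (hg : ∀ x ∈ L, HasDerivAt (fun s => g s x) (g' x) t)
    (hF : ∀ L', L' ⊆ L → HasDerivAt (fun s => F s L') (F' L') t) :
    HasDerivAt (fun s => contract (g s) L (F s)) (contract g' L (F t) + contract (g t) L F') t := by
  induction L generalizing F F' with
  | nil => simpa [contract_nil] using hasDerivAt_const t (0 : ℝ)
  | cons x L ih =>
    simp only [contract_cons]
    have h1 := (hg x (by simp)).mul (hF L (by simp))
    have h2 := ih (F := fun s L' => F s (x :: L')) (F' := fun L' => F' (x :: L'))
      (fun y hy => hg y (by simp [hy])) fun L' hL' => hF _ (List.cons_subset_cons x hL')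
    refine (h1.sub h2).congr_deriv ?_
    ring

/-- The derivative of a Pfaffian whose entries have derivatives
`(e, x)(d, y) - (d, x)(e, y)` is the Pfaffian bordered by `d` and `e` (even words). -/
theorem hasDerivAt_wordPf_gram {A : ℝ → α → α → ℝ} {t : ℝ} (hA : ∀ x y, A t x y = -A t y x)
    {d e : α} (hde : A t d e = 0) (k : ℕ) {L : List α}
    (hL : ∀ x ∈ L, ∀ y ∈ L, HasDerivAt (fun s => A s x y)
      (A t e x * A t d y - A t d x * A t e y) t) :
    HasDerivAt (fun s => wordPf (A s) k L) (wordPf (A t) (k + 1) (d :: e :: L)) t := by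
  induction k generalizing L with
  | zero =>
    have h0 : wordPf (A t) (0 + 1) (d :: e :: L) = 0 := by
      cases L with
      | nil => simp [wordPf, contract, hde]
      | cons x L =>
        cases L <;> simp [wordPf, contract, contract_zero]
    rw [h0]
    have : (fun s => wordPf (A s) 0 L) = fun _ => wordPf (A t) 0 L := by
      cases L <;> rfl
    rw [this]
    exact hasDerivAt_const _ _
  | succ k ih =>
    cases L with
    | nil =>
      have h0 : wordPf (A t) (k + 1 + 1) [d, e] = 0 := by
        simp [wordPf_succ_cons, contract_cons, contract_nil, hde]
      rw [h0]
      exact hasDerivAt_const _ _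
    | cons x L =>
      have h := hasDerivAt_contract (g := fun s => A s x) (F := fun s => wordPf (A s) k)
        (F' := fun L' => wordPf (A t) (k + 1) (d :: e :: L')) (L := L)
        (g' := fun y => A t e x * A t d y - A t d x * A t e y) (t := t)
        (fun y hy => hL x (by simp) y (by simp [hy]))
        (fun L' hL' => ih fun y hy z hz => hL y (by simp [hL' hy]) z (by simp [hL' hz]))
      simp only [wordPf_succ_cons (A _) k x L]
      refine h.congr_deriv ?_
      rw [contract_sub_left, contract_smul_left, contract_smul_left, wordPf_expand_third hA,
        hA x d, hA x e, wordPf_succ_cons, wordPf_succ_cons]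
      ring

/-- The derivative of a Pfaffian of the form `(d, L)`, with entries as in
`hasDerivAt_wordPf_gram` and `(d, x)' = (e, x)`. -/
theorem hasDerivAt_wordPf_gram_cons {A : ℝ → α → α → ℝ} {t : ℝ} (hA : ∀ x y, A t x y = -A t y x)
    {d e : α} (hde : A t d e = 0) (k : ℕ) {L : List α}
    (hL : ∀ x ∈ L, ∀ y ∈ L, HasDerivAt (fun s => A s x y)
      (A t e x * A t d y - A t d x * A t e y) t)
    (hd : ∀ x ∈ L, HasDerivAt (fun s => A s d x) (A t e x) t) :
    HasDerivAt (fun s => wordPf (A s) (k + 1) (d :: L)) (wordPf (A t) (k + 1) (e :: L)) t := by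
  have h := hasDerivAt_contract (g := fun s => A s d) (F := fun s => wordPf (A s) k)
    (F' := fun L' => wordPf (A t) (k + 1) (d :: e :: L')) (L := L) (g' := A t e) (t := t) hd
    fun L' hL' => hasDerivAt_wordPf_gram hA hde k fun x hx y hy => hL x (hL' hx) y (hL' hy)
  simp only [wordPf_succ_cons _ k d L]
  refine h.congr_deriv ?_
  rw [contract_wordPf_cons_cons hA, hde, wordPf_succ_cons (A t) k e]
  ring

/-- The action of a derivation `x ↦ c(x) s(x)` of letters on functions of words:
`∑ᵢ c(xᵢ) F(…, s(xᵢ), …)`. -/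
noncomputable def derivWord (c : α → ℝ) (s : α → α) : List α → (List α → ℝ) → ℝ
  | [], _ => 0
  | x :: L, F => c x * F (s x :: L) + derivWord c s L fun L' => F (x :: L')

theorem derivWord_smul (c : α → ℝ) (s : α → α) (L : List α) (r : ℝ) (F : List α → ℝ) :
    derivWord c s L (fun L' => r * F L') = r * derivWord c s L F := by
  induction L generalizing F with
  | nil => simp [derivWord]
  | cons x L ih => simp only [derivWord, ih]; ring

theorem derivWord_sub (c : α → ℝ) (s : α → α) (L : List α) (F G : List α → ℝ) :
    derivWord c s L (fun L' => F L' - G L') = derivWord c s L F - derivWord c s L G := by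
  induction L generalizing F G with
  | nil => simp [derivWord]
  | cons x L ih => simp only [derivWord, ih]; ring

/-- Leibniz rule for the action of a derivation on a contraction. -/
theorem derivWord_contract (c : α → ℝ) (s : α → α) (g : α → ℝ) (L : List α) (F : List α → ℝ) :
    derivWord c s L (fun L' => contract g L' F) =
      contract (fun x => c x * g (s x)) L F + contract g L fun L' => derivWord c s L' F := by
  induction L generalizing F with
  | nil => simp [derivWord, contract_nil]
  | cons x L ih =>
    simp only [derivWord, contract_cons, derivWord_sub, derivWord_smul, ih, contract_add,
      contract_smul]
    ring

/-- If differentiation acts on the entries as a derivation of the letters, it does so on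
Pfaffians. -/
theorem hasDerivAt_wordPf_derivWord {A : ℝ → α → α → ℝ} {t : ℝ} {c : α → ℝ} {σ : α → α}
    (k : ℕ) {L : List α}
    (hL : ∀ x ∈ L, ∀ y ∈ L, HasDerivAt (fun s => A s x y)
      (c x * A t (σ x) y + c y * A t x (σ y)) t) :
    HasDerivAt (fun s => wordPf (A s) k L) (derivWord c σ L (wordPf (A t) k)) t := by
  induction k generalizing L with
  | zero =>
    have h0 (L : List α) (F : List α → ℝ) (hF : ∀ x L', F (x :: L') = 0) :
        derivWord c σ L F = 0 := by
      induction L generalizing F with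
      | nil => rfl
      | cons x L ih => rw [derivWord, hF, ih (fun L' => F (x :: L')) fun y L' => hF _ _]; ring
    rw [h0 _ _ fun _ _ => rfl]
    have : (fun s => wordPf (A s) 0 L) = fun _ => wordPf (A t) 0 L := by
      cases L <;> rfl
    rw [this]
    exact hasDerivAt_const _ _
  | succ k ih =>
    cases L with
    | nil => exact hasDerivAt_const _ _
    | cons x L =>
      have h := hasDerivAt_contract (g := fun s => A s x) (F := fun s => wordPf (A s) k)
        (F' := fun L' => derivWord c σ L' (wordPf (A t) k)) (L := L)
        (g' := fun y => c x * A t (σ x) y + c y * A t x (σ y)) (t := t)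
        (fun y hy => hL x (by simp) y (by simp [hy]))
        (fun L' hL' => ih fun y hy z hz => hL y (by simp [hL' hy]) z (by simp [hL' hz]))
      simp only [wordPf_succ_cons (A _) k x L, derivWord]
      refine h.congr_deriv ?_
      rw [contract_add_left, contract_smul_left]
      simp only [wordPf_succ_cons, derivWord_contract]
      ring

/-! ### Schur's Pfaffian -/

/-- Elimination of two letters: the Pfaffian analogue of the Schur complement. -/
theorem wordPf_eliminate {A : α → α → ℝ} (hA : ∀ x y, A x y = -A y x) {a b : α}
    (hab : A a b ≠ 0) (k : ℕ) (L : List α) :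
    wordPf A (k + 1) (a :: b :: L) = A a b * wordPf (fun x y =>
      A x y - A a x * A b y / A a b + A b x * A a y / A a b) k L := by
  induction k generalizing L with
  | zero =>
    cases L with
    | nil => simp [wordPf, contract]
    | cons x L =>
      cases L <;> simp [wordPf, contract, contract_zero]
  | succ k ih =>
    cases L with
    | nil => simp [wordPf, contract_cons, contract_nil]
    | cons x L =>
      have h (g : α → ℝ) : contract g L (wordPf (fun x y =>
          A x y - A a x * A b y / A a b + A b x * A a y / A a b) k) =
          (contract g L fun L' => wordPf A (k + 1) (a :: b :: L')) / A a b := by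
        rw [div_eq_inv_mul, ← contract_smul]
        refine contract_congr (fun _ _ => rfl) fun L' _ _ => ?_
        rw [ih, inv_mul_cancel_left₀ hab]
      rw [wordPf_succ_cons _ k x L, h,
        contract_congr (h := fun y => (A x y - A a x / A a b * A b y) + A b x / A a b * A a y)
          (G := fun L' => wordPf A (k + 1) (a :: b :: L')) (fun y _ => by ring) fun _ _ _ => rfl,
        contract_add_left, contract_sub_left, contract_smul_left, contract_smul_left,
        contract_wordPf_cons_cons hA, contract_wordPf_cons_cons' hA, wordPf_expand_third hA,
        hA x a, hA x b]
      field_simp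
      ring

theorem wordPf_scale (A : α → α → ℝ) (r : α → ℝ) (k : ℕ) (L : List α) :
    wordPf (fun x y => r x * r y * A x y) k L = (L.map r).prod * wordPf A k L := by
  have aux (g : α → ℝ) (L : List α) (F : List α → ℝ) :
      (contract (fun y => r y * g y) L fun L' => (L'.map r).prod * F L') =
        (L.map r).prod * contract g L F := by
    induction L generalizing F with
    | nil => simp [contract_nil]
    | cons x L ih =>
      have h : (fun L' => ((x :: L').map r).prod * F (x :: L')) =
          fun L' => (L'.map r).prod * (r x * F (x :: L')) := by
        funext L'
        simp only [List.map_cons, List.prod_cons]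
        ring
      rw [contract_cons, contract_cons, h, ih (fun L' => r x * F (x :: L')), contract_smul]
      simp only [List.map_cons, List.prod_cons]
      ring
  induction k generalizing L with
  | zero => cases L <;> simp [wordPf]
  | succ k ih =>
    cases L with
    | nil => simp [wordPf]
    | cons x L =>
      rw [wordPf_succ_cons, wordPf_succ_cons,
        contract_congr (h := fun y => r x * (r y * A x y))
          (G := fun L' => (L'.map r).prod * wordPf A k L') (fun y _ => by ring)
          fun L' _ _ => ih L', contract_smul_left, aux]
      simp only [List.map_cons, List.prod_cons]
      ring

/-- The entry `(y - x) / (y + x)` of Schur's Pfaffian. -/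
noncomputable def schurEntry (x y : ℝ) : ℝ := (y - x) / (y + x)

theorem schurEntry_antisymm (x y : ℝ) : schurEntry x y = -schurEntry y x := by
  rw [schurEntry, schurEntry, ← neg_div, neg_sub, add_comm]

theorem schurEntry_zero_left {y : ℝ} (hy : y ≠ 0) : schurEntry 0 y = 1 := by
  simp [schurEntry, hy]

/-- The product `∏_{i < j} (xⱼ - xᵢ) / (xⱼ + xᵢ)` over the letters of a word. -/
noncomputable def schurProd : List ℝ → ℝ
  | [] => 1
  | x :: L => (L.map (schurEntry x)).prod * schurProd L

/-- Schur's Pfaffian, by elimination of two letters at a time: the Schur complement of the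
entries `(y - x) / (y + x)` is again of this form, up to scaling. -/
theorem wordPf_schurEntry (k : ℕ) {L : List ℝ} (hlen : L.length = 2 * k)
    (hL : L.Pairwise fun x y => 0 ≤ x ∧ 0 < y) :
    wordPf schurEntry k L = schurProd L := by
  induction k generalizing L with
  | zero =>
    obtain rfl := List.length_eq_zero_iff.mp hlen
    rfl
  | succ k ih =>
    match L, hlen, hL with
    | a :: b :: L, hlen, hL =>
      rw [List.pairwise_cons, List.pairwise_cons] at hL
      obtain ⟨ha, hb, hL⟩ := hL
      have hb0 := (ha b (by simp)).2
      have ha0 := (ha b (by simp)).1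
      have hpos : ∀ x ∈ L, 0 < x := fun x hx => (hb x hx).2
      rcases eq_or_ne (schurEntry a b) 0 with hab | hab
      · have : a = b := by
          rw [schurEntry, div_eq_zero_iff] at hab
          rcases hab with h | h <;> linarith
        rw [schurProd, this, wordPf_eq_zero_of_mem schurEntry_antisymm _ (by simp)]
        simp [schurEntry]
      -- the Schur complement of `(a, b)` is `(y - x) / (y + x)` up to the scaling of letters by
      -- `schurEntry a x * schurEntry b x`
      · have h1 : wordPf (fun x y => schurEntry x y -
              schurEntry a x * schurEntry b y / schurEntry a b +
              schurEntry b x * schurEntry a y / schurEntry a b) k L =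
            wordPf (fun x y => (schurEntry a x * schurEntry b x) *
              (schurEntry a y * schurEntry b y) * schurEntry x y) k L := by
          refine wordPf_congr k fun x hx y hy => ?_
          have hx := hpos x hx
          have hy := hpos y hy
          have h2 : b - a ≠ 0 := by
            intro h
            simp [schurEntry, h] at hab
          have h3 : b + a ≠ 0 := by positivity
          have h4 : x + a ≠ 0 := by positivity
          have h5 : y + a ≠ 0 := by positivity
          have h6 : x + b ≠ 0 := by positivity
          have h7 : y + b ≠ 0 := by positivity
          have h8 : y + x ≠ 0 := by positivity
          simp only [schurEntry]
          field_simp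
          ring
        rw [wordPf_eliminate schurEntry_antisymm hab, h1,
          wordPf_scale schurEntry (fun x => schurEntry a x * schurEntry b x),
          ih (by simp at hlen; omega) hL]
        simp only [schurProd, List.map_cons, List.prod_cons, List.prod_map_mul]
        ring

/-! ### Multilinear expansion -/

/-- The sum of `F(a₁ … aₖ) c₁(a₁) ⋯ cₖ(aₖ)` over all words `a₁ … aₖ`: the multilinear extension of
`F`, evaluated at the vectors `c₁, …, cₖ`. -/
noncomputable def wordSum [Fintype β] : List (β → ℝ) → (List β → ℝ) → ℝ
  | [], F => F []
  | c :: cs, F => ∑ a, c a * wordSum cs fun w => F (a :: w)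

theorem wordSum_smul [Fintype β] (cs : List (β → ℝ)) (r : ℝ) (F : List β → ℝ) :
    wordSum cs (fun w => r * F w) = r * wordSum cs F := by
  induction cs generalizing F with
  | nil => rfl
  | cons c cs ih =>
    simp only [wordSum, ih, Finset.mul_sum]
    exact Finset.sum_congr rfl fun a _ => by ring

theorem wordSum_sub [Fintype β] (cs : List (β → ℝ)) (F G : List β → ℝ) :
    wordSum cs (fun w => F w - G w) = wordSum cs F - wordSum cs G := by
  induction cs generalizing F G with
  | nil => rfl
  | cons c cs ih => simp only [wordSum, ih, mul_sub, Finset.sum_sub_distrib]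

theorem contract_wordSum [Fintype β] (g : β → ℝ) (cs : List (β → ℝ)) (F : List β → ℝ) :
    contract (fun c => ∑ a, c a * g a) cs (fun cs' => wordSum cs' F) =
      wordSum cs fun w => contract g w F := by
  induction cs generalizing F with
  | nil => simp [contract_nil, wordSum]
  | cons c cs ih =>
    simp only [contract_cons, wordSum, contract_sum, contract_smul, wordSum_sub, wordSum_smul, ih,
      mul_sub, Finset.sum_sub_distrib, Finset.sum_mul]
    congr 1
    exact Finset.sum_congr rfl fun a _ => by ring

/-- Pfaffians are multilinear in their letters. -/
theorem wordPf_wordSum [Fintype β] (A : β → β → ℝ) (k : ℕ) (cs : List (β → ℝ)) :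
    wordPf (fun c d => ∑ a, ∑ b, c a * d b * A a b) k cs = wordSum cs (wordPf A k) := by
  induction k generalizing cs with
  | zero =>
    have h0 (cs : List (β → ℝ)) : wordSum cs (fun _ => 0) = 0 := by
      simpa using wordSum_smul cs 0 fun _ => 0
    cases cs <;> simp [wordPf, wordSum, h0]
  | succ k ih =>
    cases cs with
    | nil => simp [wordPf, wordSum]
    | cons c cs =>
      simp only [wordPf_succ_cons, wordSum]
      simp only [← contract_wordSum]
      rw [contract_congr (h := fun d => ∑ a, c a * ∑ b, d b * A a b)
        (G := fun cs' => wordSum cs' (wordPf A k)) (fun d _ => ?_) fun L' _ _ => ih L']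
      · have (s : Finset β) (G : List (β → ℝ) → ℝ) :
            contract (fun d => ∑ a ∈ s, c a * ∑ b, d b * A a b) cs G =
              ∑ a ∈ s, c a * contract (fun d => ∑ b, d b * A a b) cs G := by
          classical
          induction s using Finset.induction_on with
          | empty => simpa using contract_eq_zero (g := fun _ => 0) G (by simp)
          | insert i s hi ih => simp only [Finset.sum_insert hi, contract_add_left,
              contract_smul_left, ih]
        exact this _ _
      · simp only [Finset.mul_sum]
        exact Finset.sum_congr rfl fun a _ => Finset.sum_congr rfl fun b _ => by ring

theorem wordSum_ofFn [Fintype β] {k : ℕ} (c : Fin k → β → ℝ) (F : List β → ℝ) :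
    wordSum (List.ofFn c) F = ∑ s : Fin k → β, (∏ i, c i (s i)) * F (List.ofFn s) := by
  induction k generalizing F with
  | zero => simp [wordSum]
  | succ k ih =>
    rw [List.ofFn_succ, wordSum, ← (Fin.consEquiv fun _ => β).sum_comp, Fintype.sum_prod_type]
    refine Finset.sum_congr rfl fun a _ => ?_
    rw [ih, Finset.mul_sum]
    refine Finset.sum_congr rfl fun s _ => ?_
    simp only [Fin.consEquiv_apply, Fin.prod_univ_succ, Fin.cons_zero, Fin.cons_succ,
      List.ofFn_succ]
    ring

end WordIdentities

/-! ### Pfaffians of matrices as word Pfaffians -/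

/-- The permutation of `Fin (K + 2)` listing the matching that pairs `0` with `j + 1` and then the
remaining elements as prescribed by `τ`. -/
def extendMatching {K : ℕ} (j : Fin (K + 1)) (τ : Equiv.Perm (Fin K)) :
    Equiv.Perm (Fin (K + 2)) :=
  Equiv.Perm.decomposeFin.symm (0, j.cycleRange.symm * Equiv.Perm.decomposeFin.symm (0, τ))

theorem extendMatching_zero {K : ℕ} (j : Fin (K + 1)) (τ : Equiv.Perm (Fin K)) :
    extendMatching j τ 0 = 0 := by
  simp [extendMatching]

theorem extendMatching_one {K : ℕ} (j : Fin (K + 1)) (τ : Equiv.Perm (Fin K)) :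
    extendMatching j τ (Fin.succ 0) = j.succ := by
  rw [extendMatching, Equiv.Perm.decomposeFin_symm_apply_succ]
  simp

theorem extendMatching_succ_succ {K : ℕ} (j : Fin (K + 1)) (τ : Equiv.Perm (Fin K)) (i : Fin K) :
    extendMatching j τ i.succ.succ = (j.succAbove (τ i)).succ := by
  rw [extendMatching, Equiv.Perm.decomposeFin_symm_apply_succ]
  simp [Equiv.Perm.decomposeFin_symm_apply_succ, Fin.cycleRange_symm_succ]

theorem sign_extendMatching {K : ℕ} (j : Fin (K + 1)) (τ : Equiv.Perm (Fin K)) :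
    Equiv.Perm.sign (extendMatching j τ) = (-1) ^ (j : ℕ) * Equiv.Perm.sign τ := by
  simp [extendMatching, Equiv.Perm.decomposeFin.symm_sign, Fin.sign_cycleRange]

theorem exists_extendMatching {K : ℕ} (σ : Equiv.Perm (Fin (K + 2))) (h0 : σ 0 = 0) :
    ∃ j τ, σ = extendMatching j τ := by
  have aux {N : ℕ} (σ : Equiv.Perm (Fin (N + 1))) (h0 : σ 0 = 0) :
      ∃ e, σ = Equiv.Perm.decomposeFin.symm (0, e) := by
    obtain ⟨⟨p, e⟩, rfl⟩ := Equiv.Perm.decomposeFin.symm.surjective σ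
    rw [Equiv.Perm.decomposeFin_symm_apply_zero] at h0
    exact ⟨e, by rw [h0]⟩
  obtain ⟨e, rfl⟩ := aux σ h0
  obtain ⟨τ, hτ⟩ := aux ((e 0).cycleRange * e) (by simp)
  refine ⟨e 0, τ, ?_⟩
  rw [extendMatching, ← hτ]
  congr 2
  ext i
  simp

theorem isMatching_extendMatching_iff {K : ℕ} (hK : Even K) (j : Fin (K + 1))
    (τ : Equiv.Perm (Fin K)) : IsMatching (extendMatching j τ) ↔ IsMatching τ := by
  obtain ⟨N, rfl⟩ := even_iff_exists_two_mul.mp hK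
  have e0 (l : ℕ) (h : 2 * (l + 1) < 2 * N + 2) :
      extendMatching j τ ⟨2 * (l + 1), h⟩ = (j.succAbove (τ ⟨2 * l, by omega⟩)).succ :=
    extendMatching_succ_succ j τ ⟨2 * l, by omega⟩
  have e1 (l : ℕ) (h : 2 * (l + 1) + 1 < 2 * N + 2) :
      extendMatching j τ ⟨2 * (l + 1) + 1, h⟩ = (j.succAbove (τ ⟨2 * l + 1, by omega⟩)).succ :=
    extendMatching_succ_succ j τ ⟨2 * l + 1, by omega⟩
  have z0 (h : 2 * 0 < 2 * N + 2) : extendMatching j τ ⟨2 * 0, h⟩ = 0 := extendMatching_zero j τ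
  have z1 (h : 2 * 0 + 1 < 2 * N + 2) : extendMatching j τ ⟨2 * 0 + 1, h⟩ = j.succ :=
    extendMatching_one j τ
  constructor
  · rintro ⟨h1, h2⟩
    refine ⟨fun l => ?_, fun l l' hl => ?_⟩
    · have := h1 ⟨l + 1, by omega⟩
      simpa only [e0, e1, Fin.succ_lt_succ_iff, Fin.succAbove_lt_succAbove_iff] using this
    · have := h2 ⟨l + 1, by omega⟩ ⟨l' + 1, by omega⟩
        (Fin.mk_lt_mk.mpr (Nat.succ_lt_succ hl))
      simpa only [e0, e1, Fin.succ_lt_succ_iff, Fin.succAbove_lt_succAbove_iff] using this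
  · rintro ⟨h1, h2⟩
    refine ⟨fun ⟨l, hl⟩ => ?_, fun ⟨l, hl⟩ ⟨l', hl'⟩ hll => ?_⟩
    · cases l with
      | zero => simp only [z0, z1, Fin.succ_pos]
      | succ l =>
        simp only [e0, e1, Fin.succ_lt_succ_iff, Fin.succAbove_lt_succAbove_iff]
        exact h1 ⟨l, by omega⟩
    · rw [Fin.mk_lt_mk] at hll
      cases l' with
      | zero => omega
      | succ l' =>
        cases l with
        | zero => simp only [z0, e0, Fin.succ_pos]
        | succ l =>
          simp only [e0, Fin.succ_lt_succ_iff, Fin.succAbove_lt_succAbove_iff]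
          exact h2 ⟨l, by omega⟩ ⟨l', by omega⟩ (Fin.mk_lt_mk.mpr (Nat.lt_of_succ_lt_succ hll))

theorem IsMatching.apply_zero {K : ℕ} (hK : Even K) {σ : Equiv.Perm (Fin (K + 2))}
    (hσ : IsMatching σ) : σ 0 = 0 := by
  obtain ⟨N, rfl⟩ := even_iff_exists_two_mul.mp hK
  have h2 (l : ℕ) (hl : l < N + 1) : σ 0 ≤ σ ⟨2 * l, by omega⟩ := by
    rcases Nat.eq_zero_or_pos l with rfl | h
    · exact le_rfl
    · exact (hσ.2 ⟨0, by omega⟩ ⟨l, by omega⟩ h).le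
  obtain ⟨p, hp⟩ := σ.surjective 0
  rcases Nat.even_or_odd' (p : ℕ) with ⟨l, hl | hl⟩
  · have : p = ⟨2 * l, by omega⟩ := Fin.ext hl
    have h := h2 l (by omega)
    rw [← this, hp] at h
    exact Fin.le_zero_iff.mp h
  · have : p = ⟨2 * l + 1, by omega⟩ := Fin.ext hl
    have h := hσ.1 ⟨l, by omega⟩
    simp only [← this, hp] at h
    exact absurd h (Fin.not_lt_zero _)

/-- Expansion of a Pfaffian along the first row. -/
theorem pfaffian_succ_succ {K : ℕ} (A : Matrix (Fin (K + 2)) (Fin (K + 2)) ℝ) :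
    pfaffian A = ∑ j : Fin (K + 1), (-1) ^ (j : ℕ) * A 0 j.succ *
      pfaffian (Matrix.of fun i i' => A (j.succAbove i).succ (j.succAbove i').succ) := by
  classical
  by_cases hK : Even K
  · have hK2 : Even (K + 2) := by simpa [Nat.even_add] using hK
    simp only [pfaffian, hK, hK2, if_true, Finset.mul_sum]
    rw [Finset.sum_sigma']
    symm
    refine Finset.sum_bij (fun p _ => extendMatching p.1 p.2) ?_ ?_ ?_ ?_
    · rintro ⟨j, τ⟩ h
      simp only [Finset.mem_sigma, Finset.mem_univ, Finset.mem_filter, true_and] at h ⊢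
      exact (isMatching_extendMatching_iff hK j τ).mpr h
    · rintro ⟨j, τ⟩ - ⟨j', τ'⟩ - h
      have hj : j = j' := by
        have := congrArg (fun σ => σ (Fin.succ 0)) h
        simpa only [extendMatching_one, Fin.succ_inj] using this
      subst hj
      congr 1
      ext i
      have := congrArg (fun σ => σ i.succ.succ) h
      simp only [extendMatching_succ_succ, Fin.succ_inj] at this
      rw [Fin.succAbove_right_injective this]
    · intro σ h
      simp only [Finset.mem_filter, Finset.mem_univ, true_and] at h
      obtain ⟨j, τ, rfl⟩ := exists_extendMatching σ (h.apply_zero hK)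
      exact ⟨⟨j, τ⟩, by simpa using (isMatching_extendMatching_iff hK j τ).mp h, rfl⟩
    · rintro ⟨j, τ⟩ -
      have e : (K + 2) / 2 = K / 2 + 1 := by omega
      have e0 (l : ℕ) (h : 2 * (l + 1) < K + 2) :
          extendMatching j τ ⟨2 * (l + 1), h⟩ = (j.succAbove (τ ⟨2 * l, by omega⟩)).succ :=
        extendMatching_succ_succ j τ ⟨2 * l, by omega⟩
      have e1 (l : ℕ) (h : 2 * (l + 1) + 1 < K + 2) :
          extendMatching j τ ⟨2 * (l + 1) + 1, h⟩ =
            (j.succAbove (τ ⟨2 * l + 1, by omega⟩)).succ :=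
        extendMatching_succ_succ j τ ⟨2 * l + 1, by omega⟩
      have z0 (h : 2 * 0 < K + 2) : extendMatching j τ ⟨2 * 0, h⟩ = 0 := extendMatching_zero j τ
      have z1 (h : 2 * 0 + 1 < K + 2) : extendMatching j τ ⟨2 * 0 + 1, h⟩ = j.succ :=
        extendMatching_one j τ
      rw [← (finCongr e.symm).prod_comp, Fin.prod_univ_succ, sign_extendMatching]
      simp only [finCongr_apply, Fin.val_cast, Fin.val_succ, Fin.val_zero, z0, z1, e0, e1,
        Matrix.of_apply]
      push_cast
      ring
  · have hK2 : ¬Even (K + 2) := by simpa [Nat.even_add] using hK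
    simp [pfaffian, hK, hK2]

theorem contract_ofFn {α : Type*} (g : α → ℝ) {K : ℕ} (v : Fin (K + 1) → α) (F : List α → ℝ) :
    contract g (List.ofFn v) F =
      ∑ j : Fin (K + 1), (-1) ^ (j : ℕ) * g (v j) * F (List.ofFn fun i => v (j.succAbove i)) := by
  induction K generalizing F with
  | zero => simp [contract_cons, contract_nil]
  | succ K ih =>
    rw [List.ofFn_succ, contract_cons, ih, Fin.sum_univ_succ (n := K + 1), sub_eq_add_neg,
      ← Finset.sum_neg_distrib]
    congr 1
    · simp
    · refine Finset.sum_congr rfl fun j _ => ?_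
      rw [List.ofFn_succ (f := fun i => v (j.succ.succAbove i))]
      simp only [Fin.succ_succAbove_zero, Fin.succ_succAbove_succ, Fin.val_succ, pow_succ]
      ring

theorem pfaffian_eq_wordPf {α : Type*} (A : α → α → ℝ) (k : ℕ) {M : ℕ} (hM : M = 2 * k)
    (v : Fin M → α) :
    pfaffian (Matrix.of fun i j => A (v i) (v j)) = wordPf A k (List.ofFn v) := by
  induction k generalizing M with
  | zero =>
    obtain rfl : M = 0 := hM
    have h : ∀ σ : Equiv.Perm (Fin 0), IsMatching σ := fun σ =>
      ⟨fun l => l.elim0, fun l => l.elim0⟩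
    simp [pfaffian, wordPf, h, Finset.filter_true_of_mem]
  | succ k ih =>
    obtain ⟨K, rfl⟩ : ∃ K, M = K + 2 := ⟨2 * k, by omega⟩
    rw [pfaffian_succ_succ, List.ofFn_succ, wordPf_succ_cons, contract_ofFn]
    refine Finset.sum_congr rfl fun j _ => ?_
    rw [← ih (by omega) fun i => v (j.succAbove i).succ]
    rfl

/-- The Pfaffian symbol `(a₁, …, a_{2k})` as a word Pfaffian. -/
theorem pf_eq_wordPf {n : ℕ} (ζ b₀ : Fin n → ℝ) (t : ℝ) (k : ℕ) {L : List Label}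
    (hL : L.length = 2 * k) : pf ζ b₀ t L = wordPf (entry ζ b₀ t) k L := by
  rw [pf, pfaffian_eq_wordPf (entry ζ b₀ t) k hL (fun i => L.get i), List.ofFn_get]

/-! ### The Pfaffian entries -/

section Entries

open MeasureTheory Set

theorem measurableSet_entryDomain (t : ℝ) : MeasurableSet (entryDomain t) :=
  (measurableSet_lt measurable_fst measurable_snd).inter
    (measurableSet_lt measurable_snd measurable_const)

theorem integrableOn_exp_mul_exp {α β : ℝ} (hα : 0 < α) (hβ : 0 < β) (t : ℝ) :
    IntegrableOn (fun p : ℝ × ℝ => Real.exp (α * p.1) * Real.exp (β * p.2)) (entryDomain t) := by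
  have h : IntegrableOn (fun p : ℝ × ℝ => Real.exp (α * p.1) * Real.exp (β * p.2))
      (Iic t ×ˢ Iic t) := by
    rw [IntegrableOn, Measure.volume_eq_prod, ← Measure.prod_restrict]
    exact (integrableOn_exp_mul_Iic hα t).mul_prod (integrableOn_exp_mul_Iic hβ t)
  exact h.mono_set fun p hp => ⟨(hp.1.trans hp.2).le, hp.2.le⟩

theorem integral_exp_mul_exp {α β : ℝ} (hα : 0 < α) (hβ : 0 < β) (t : ℝ) :
    ∫ p in entryDomain t, Real.exp (α * p.1) * Real.exp (β * p.2) =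
      Real.exp ((α + β) * t) / (α * (α + β)) := by
  have hi := integrableOn_exp_mul_exp hα hβ t
  rw [← integral_indicator (measurableSet_entryDomain t), Measure.volume_eq_prod,
    integral_prod_symm _ ((integrable_indicator_iff (measurableSet_entryDomain t)).mpr hi)]
  have h1 (y : ℝ) : (∫ x, (entryDomain t).indicator
      (fun p : ℝ × ℝ => Real.exp (α * p.1) * Real.exp (β * p.2)) (x, y)) =
      (Iio t).indicator (fun y => α⁻¹ * Real.exp ((α + β) * y)) y := by
    by_cases hy : y < t
    · have h2 : (fun x => (entryDomain t).indicator
          (fun p : ℝ × ℝ => Real.exp (α * p.1) * Real.exp (β * p.2)) (x, y)) =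
          (Iio y).indicator fun x => Real.exp (α * x) * Real.exp (β * y) := by
        funext x
        by_cases hx : x < y <;> simp [indicator, entryDomain, hx, hy]
      rw [h2, integral_indicator measurableSet_Iio, integral_mul_const,
        ← integral_Iic_eq_integral_Iio, integral_exp_mul_Iic hα, indicator_of_mem (mem_Iio.mpr hy),
        add_mul, Real.exp_add]
      ring
    · have h2 : (fun x => (entryDomain t).indicator
          (fun p : ℝ × ℝ => Real.exp (α * p.1) * Real.exp (β * p.2)) (x, y)) = fun _ => 0 := by
        funext x
        simp [indicator, entryDomain, hy]
      rw [h2, indicator_of_notMem (by simpa using hy)]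
      simp
  simp only [h1]
  rw [integral_indicator measurableSet_Iio, integral_const_mul, ← integral_Iic_eq_integral_Iio,
    integral_exp_mul_Iic (by positivity)]
  field_simp

variable {n : ℕ} {ζ : Fin n → ℝ} (b₀ : Fin n → ℝ)

theorem entryIntegrand_eq (i j : ℤ) (p : ℝ × ℝ) :
    entryIntegrand ζ b₀ i j p = ∑ a, ∑ c, ζ a ^ (i - 1) * ζ c ^ (j - 1) * b₀ a * b₀ c *
      (Real.exp ((ζ c)⁻¹ * p.1) * Real.exp ((ζ a)⁻¹ * p.2) -
        Real.exp ((ζ a)⁻¹ * p.1) * Real.exp ((ζ c)⁻¹ * p.2)) := by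
  simp only [entryIntegrand, moment, flow, Finset.sum_mul_sum, ← Finset.sum_sub_distrib,
    div_eq_inv_mul]
  exact Finset.sum_congr rfl fun a _ => Finset.sum_congr rfl fun c _ => by ring

theorem integrableOn_entryIntegrand (hζ : ∀ j, 0 < ζ j) (t : ℝ) (i j : ℤ) :
    IntegrableOn (entryIntegrand ζ b₀ i j) (entryDomain t) := by
  have h : entryIntegrand ζ b₀ i j = fun p => _ := funext fun p => entryIntegrand_eq b₀ i j p
  rw [h]
  refine integrable_finsetSum _ fun a _ => integrable_finsetSum _ fun c _ =>
    Integrable.const_mul (Integrable.sub ?_ ?_) _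
  · exact integrableOn_exp_mul_exp (inv_pos.mpr (hζ c)) (inv_pos.mpr (hζ a)) t
  · exact integrableOn_exp_mul_exp (inv_pos.mpr (hζ a)) (inv_pos.mpr (hζ c)) t

/-- The double integrals in closed form:
`(i, j) = ∑ ζₐⁱ bₐ ζ_cʲ b_c (ζ_c - ζₐ) / (ζ_c + ζₐ)`. -/
theorem entry_num_num (hζ : ∀ j, 0 < ζ j) (t : ℝ) (i j : ℤ) :
    entry ζ b₀ t (.num i) (.num j) = ∑ a, ∑ c, (ζ a ^ i * flow ζ b₀ t a) *
      (ζ c ^ j * flow ζ b₀ t c) * schurEntry (ζ a) (ζ c) := by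
  have hi (a c : Fin n) := integrableOn_exp_mul_exp (inv_pos.mpr (hζ a)) (inv_pos.mpr (hζ c)) t
  have hs (a c : Fin n) (r : ℝ) : IntegrableOn (fun p : ℝ × ℝ => r *
      (Real.exp ((ζ c)⁻¹ * p.1) * Real.exp ((ζ a)⁻¹ * p.2) -
        Real.exp ((ζ a)⁻¹ * p.1) * Real.exp ((ζ c)⁻¹ * p.2))) (entryDomain t) :=
    ((hi c a).sub (hi a c)).const_mul r
  simp only [entry, entryIntegrand_eq]
  rw [integral_finsetSum _ fun a _ => integrable_finsetSum _ fun c _ => hs a c _]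
  refine Finset.sum_congr rfl fun a _ => ?_
  rw [integral_finsetSum _ fun c _ => hs a c _]
  refine Finset.sum_congr rfl fun c _ => ?_
  rw [integral_const_mul, integral_sub (hi c a) (hi a c),
    integral_exp_mul_exp (inv_pos.mpr (hζ c)) (inv_pos.mpr (hζ a)),
    integral_exp_mul_exp (inv_pos.mpr (hζ a)) (inv_pos.mpr (hζ c)),
    add_comm (ζ c)⁻¹ (ζ a)⁻¹, add_mul, Real.exp_add, flow, flow, schurEntry,
    zpow_sub_one₀ (hζ a).ne', zpow_sub_one₀ (hζ c).ne', div_eq_inv_mul t, div_eq_inv_mul t]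
  have ha := hζ a
  have hc := hζ c
  field_simp

theorem entry_antisymm (hζ : ∀ j, 0 < ζ j) (t : ℝ) (x y : Label) :
    entry ζ b₀ t x y = -entry ζ b₀ t y x := by
  match x, y with
  | .num i, .num j =>
    rw [entry_num_num b₀ hζ, entry_num_num b₀ hζ, Finset.sum_comm, ← Finset.sum_neg_distrib]
    refine Finset.sum_congr rfl fun a _ => ?_
    rw [← Finset.sum_neg_distrib]
    refine Finset.sum_congr rfl fun c _ => ?_
    rw [schurEntry_antisymm (ζ c) (ζ a)]
    ring
  | .d0, .d0 => simp [entry]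
  | .d0, .dm1 => simp [entry]
  | .d0, .num _ => simp [entry]
  | .dm1, .d0 => simp [entry]
  | .dm1, .dm1 => simp [entry]
  | .dm1, .num _ => simp [entry]
  | .num _, .d0 => simp [entry]
  | .num _, .dm1 => simp [entry]

theorem hasDerivAt_flow (t : ℝ) (j : Fin n) :
    HasDerivAt (fun s => flow ζ b₀ s j) (flow ζ b₀ t j * (ζ j)⁻¹) t := by
  have h := (((hasDerivAt_id t).div_const (ζ j)).exp).const_mul (b₀ j)
  refine h.congr_deriv ?_
  simp only [flow, id]
  ring

theorem hasDerivAt_moment (hζ : ∀ j, 0 < ζ j) (t : ℝ) (i : ℤ) :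
    HasDerivAt (moment ζ b₀ i) (moment ζ b₀ (i - 1) t) t := by
  have h := HasDerivAt.fun_sum (u := Finset.univ) fun j _ =>
    (hasDerivAt_flow (ζ := ζ) b₀ t j).const_mul (ζ j ^ i)
  refine h.congr_deriv ?_
  refine Finset.sum_congr rfl fun j _ => ?_
  rw [zpow_sub_one₀ (hζ j).ne']
  ring

theorem hasDerivAt_entry_num_num_aux (hζ : ∀ j, 0 < ζ j) (t : ℝ) (i j : ℤ) :
    HasDerivAt (fun s => entry ζ b₀ s (.num i) (.num j)) (∑ a, ∑ c, (ζ a ^ i * flow ζ b₀ t a) *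
      (ζ c ^ j * flow ζ b₀ t c) * schurEntry (ζ a) (ζ c) * ((ζ a)⁻¹ + (ζ c)⁻¹)) t := by
  simp only [entry_num_num b₀ hζ]
  refine HasDerivAt.fun_sum fun a _ => HasDerivAt.fun_sum fun c _ => ?_
  have h := (((hasDerivAt_flow (ζ := ζ) b₀ t a).const_mul (ζ a ^ i)).mul
    ((hasDerivAt_flow (ζ := ζ) b₀ t c).const_mul (ζ c ^ j))).mul_const (schurEntry (ζ a) (ζ c))
  refine h.congr_deriv ?_
  ring

/-- Differentiation acts on the entries by lowering indices. -/
theorem hasDerivAt_entry_shift (hζ : ∀ j, 0 < ζ j) (t : ℝ) (i j : ℤ) :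
    HasDerivAt (fun s => entry ζ b₀ s (.num i) (.num j))
      (entry ζ b₀ t (.num (i - 1)) (.num j) + entry ζ b₀ t (.num i) (.num (j - 1))) t := by
  refine (hasDerivAt_entry_num_num_aux b₀ hζ t i j).congr_deriv ?_
  simp only [entry_num_num b₀ hζ, ← Finset.sum_add_distrib]
  refine Finset.sum_congr rfl fun a _ => Finset.sum_congr rfl fun c _ => ?_
  rw [zpow_sub_one₀ (hζ a).ne', zpow_sub_one₀ (hζ c).ne']
  ring

/-- The derivative of an entry is an antisymmetric product of the border entries. -/
theorem hasDerivAt_entry_gram (hζ : ∀ j, 0 < ζ j) (t : ℝ) (i j : ℤ) :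
    HasDerivAt (fun s => entry ζ b₀ s (.num i) (.num j))
      (entry ζ b₀ t .dm1 (.num i) * entry ζ b₀ t .d0 (.num j) -
        entry ζ b₀ t .d0 (.num i) * entry ζ b₀ t .dm1 (.num j)) t := by
  refine (hasDerivAt_entry_num_num_aux b₀ hζ t i j).congr_deriv ?_
  simp only [entry, moment, Finset.sum_mul_sum, ← Finset.sum_sub_distrib]
  refine Finset.sum_congr rfl fun a _ => Finset.sum_congr rfl fun c _ => ?_
  rw [zpow_sub_one₀ (hζ a).ne', zpow_sub_one₀ (hζ c).ne', schurEntry]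
  have ha := hζ a
  have hc := hζ c
  field_simp

end Entries

/-! ### Derivatives and bilinear identities of the Pfaffians -/

theorem consec_eq (l : ℤ) (K : ℕ) :
    consec l K = (List.range K).map fun i : ℕ => Label.num (l + (i : ℤ)) := by
  simp [consec, List.map_eq_flatMap, List.flatMap_assoc]

theorem length_consec (l : ℤ) (K : ℕ) : (consec l K).length = K := by simp [consec_eq]

theorem consec_succ (l : ℤ) (K : ℕ) : consec l (K + 1) = .num l :: consec (l + 1) K := by
  simp only [consec_eq, List.range_succ_eq_map, List.map_cons, List.map_map, Nat.cast_zero,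
    add_zero]
  congr 2
  funext i
  simp only [Function.comp_apply, Nat.cast_succ]
  congr 1
  ring

theorem consec_succ' (l : ℤ) (K : ℕ) : consec l (K + 1) = consec l K ++ [.num (l + K)] := by
  simp [consec_eq, List.range_succ]

theorem mem_consec {l : ℤ} {K : ℕ} {x : Label} (hx : x ∈ consec l K) : ∃ i, x = .num i := by
  simp only [consec_eq, List.mem_map] at hx
  obtain ⟨i, -, rfl⟩ := hx
  exact ⟨_, rfl⟩

theorem IsAlternating.move_last {α : Type*} {F : List α → ℝ} (hF : IsAlternating F)
    (P C : List α) (z : α) : F (P ++ (C ++ [z])) = (-1) ^ C.length * F (P ++ z :: C) := by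
  induction P generalizing F with
  | nil => simpa using hF.move C z []
  | cons x P ih => exact ih (hF.cons x)

section Tau

variable {n : ℕ} (ζ b₀ : Fin n → ℝ) (l : ℤ) (t : ℝ) (k : ℕ)

theorem pfTau_even : pfTau ζ b₀ l t ((2 * k : ℕ) : ℤ) =
    wordPf (entry ζ b₀ t) k (consec l (2 * k)) := by
  change pf ζ b₀ t _ = _
  rw [if_pos (even_two_mul k), pf_eq_wordPf ζ b₀ t k (length_consec _ _)]

theorem pfTau_odd : pfTau ζ b₀ l t ((2 * k + 1 : ℕ) : ℤ) =
    wordPf (entry ζ b₀ t) (k + 1) (.d0 :: consec l (2 * k + 1)) := by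
  change pf ζ b₀ t _ = _
  rw [if_neg (by simp), pf_eq_wordPf ζ b₀ t (k + 1)
    (by simp only [List.length_cons, length_consec]; ring)]

theorem pfTauWronski_even : pfTauWronski ζ b₀ l t ((2 * k + 2 : ℕ) : ℤ) =
    wordPf (entry ζ b₀ t) (k + 1) (.num (l - 1) :: consec (l + 1) (2 * k + 1)) := by
  change pf ζ b₀ t _ = _
  rw [if_pos (by simp [Nat.even_add_one]), pf_eq_wordPf ζ b₀ t (k + 1)
    (by simp only [List.length_cons, length_consec]; ring)]

theorem pfTauWronski_odd : pfTauWronski ζ b₀ l t ((2 * k + 1 : ℕ) : ℤ) =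
    wordPf (entry ζ b₀ t) (k + 1) (.d0 :: .num (l - 1) :: consec (l + 1) (2 * k)) := by
  change pf ζ b₀ t _ = _
  rw [if_neg (by simp), pf_eq_wordPf ζ b₀ t (k + 1)
    (by simp only [List.length_cons, length_consec]; ring)]

theorem pfTauGram_even : pfTauGram ζ b₀ l t ((2 * k : ℕ) : ℤ) =
    wordPf (entry ζ b₀ t) (k + 1) (.d0 :: .dm1 :: consec l (2 * k)) := by
  change pf ζ b₀ t _ = _
  rw [if_pos (even_two_mul k), pf_eq_wordPf ζ b₀ t (k + 1)
    (by simp only [List.length_cons, length_consec]; ring)]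

theorem pfTauGram_odd : pfTauGram ζ b₀ l t ((2 * k + 1 : ℕ) : ℤ) =
    wordPf (entry ζ b₀ t) (k + 1) (.dm1 :: consec l (2 * k + 1)) := by
  change pf ζ b₀ t _ = _
  rw [if_neg (by simp), pf_eq_wordPf ζ b₀ t (k + 1)
    (by simp only [List.length_cons, length_consec]; ring)]

/-- The coefficient of a label in the derivation of labels that lowers the indices. -/
def Label.derivCoeff : Label → ℝ
  | .num _ => 1
  | _ => 0

/-- Lowering of the index of a label. -/
def Label.lower : Label → Label
  | .num i => .num (i - 1)
  | x => x

/-- All terms but the first vanish when a derivation acts on consecutive integers, because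
they contain a repeated letter. -/
theorem derivWord_consec {F : List Label → ℝ} (hF : IsAlternating F) (l : ℤ) (K : ℕ) :
    derivWord Label.derivCoeff Label.lower (consec l (K + 1)) F =
      F (.num (l - 1) :: consec (l + 1) K) := by
  have aux (K : ℕ) : ∀ (l : ℤ) {F : List Label → ℝ}, IsAlternating F →
      (derivWord Label.derivCoeff Label.lower (consec (l + 1) K) fun L => F (.num l :: L)) = 0 := by
    induction K with
    | zero => intro l F _; rfl
    | succ K ih =>
      intro l F hF
      rw [consec_succ, derivWord, ih (l + 1) (hF.cons _)]
      simp only [Label.derivCoeff, Label.lower, add_sub_cancel_right]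
      rw [hF.eq_zero_of_mem (by simp)]
      ring
  rw [consec_succ, derivWord, aux K l hF]
  simp [Label.derivCoeff, Label.lower]

variable {ζ} {l} {t}

theorem hasDerivAt_pfTau_wronski (hζ : ∀ j, 0 < ζ j) (k : ℤ) :
    HasDerivAt (fun s => pfTau ζ b₀ l s k) (pfTauWronski ζ b₀ l t k) t := by
  have hA := entry_antisymm b₀ hζ t
  have hentry (L : List Label) (hL : ∀ x ∈ L, x = .d0 ∨ ∃ i, x = .num i) :
      ∀ x ∈ L, ∀ y ∈ L, HasDerivAt (fun s => entry ζ b₀ s x y)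
        (x.derivCoeff * entry ζ b₀ t x.lower y + y.derivCoeff * entry ζ b₀ t x y.lower) t := by
    intro x hx y hy
    rcases hL x hx with rfl | ⟨i, rfl⟩ <;> rcases hL y hy with rfl | ⟨j, rfl⟩
    · simpa [entry, Label.derivCoeff] using hasDerivAt_const t (0 : ℝ)
    · simpa [entry, Label.derivCoeff, Label.lower] using hasDerivAt_moment b₀ hζ t j
    · simpa [entry, Label.derivCoeff, Label.lower] using (hasDerivAt_moment b₀ hζ t i).fun_neg
    · simpa [Label.derivCoeff, Label.lower] using hasDerivAt_entry_shift b₀ hζ t i j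
  match k with
  | Int.negSucc _ => exact hasDerivAt_const _ _
  | Int.ofNat 0 =>
    have h : (fun s => pfTau ζ b₀ l s (Int.ofNat 0)) = fun _ => 1 :=
      funext fun s => pfTau_even ζ b₀ l s 0
    rw [h]
    exact hasDerivAt_const _ _
  | Int.ofNat (K + 1) =>
    rw [Int.ofNat_eq_natCast]
    rcases Nat.even_or_odd' K with ⟨k, rfl | rfl⟩
    · simp only [pfTau_odd, pfTauWronski_odd]
      refine (hasDerivAt_wordPf_derivWord (k + 1) (hentry _ ?_)).congr_deriv ?_
      · intro x hx
        rcases List.mem_cons.mp hx with h | h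
        · exact Or.inl h
        · exact Or.inr (mem_consec h)
      · rw [derivWord, derivWord_consec ((IsAlternating.wordPf hA _).cons _)]
        simp [Label.derivCoeff]
    · simp only [show 2 * k + 1 + 1 = 2 * (k + 1) by ring, pfTau_even]
      rw [show 2 * (k + 1) = 2 * k + 2 by ring, pfTauWronski_even]
      refine (hasDerivAt_wordPf_derivWord (k + 1) (hentry _ ?_)).congr_deriv ?_
      · exact fun x hx => Or.inr (mem_consec hx)
      · rw [derivWord_consec (IsAlternating.wordPf hA _)]

theorem hasDerivAt_pfTau_gram (hζ : ∀ j, 0 < ζ j) (k : ℤ) :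
    HasDerivAt (fun s => pfTau ζ b₀ l s k) (pfTauGram ζ b₀ l t k) t := by
  have hA := entry_antisymm b₀ hζ t
  have hentry (l : ℤ) (K : ℕ) : ∀ x ∈ consec l K, ∀ y ∈ consec l K,
      HasDerivAt (fun s => entry ζ b₀ s x y) (entry ζ b₀ t .dm1 x * entry ζ b₀ t .d0 y -
        entry ζ b₀ t .d0 x * entry ζ b₀ t .dm1 y) t := by
    intro x hx y hy
    obtain ⟨i, rfl⟩ := mem_consec hx
    obtain ⟨j, rfl⟩ := mem_consec hy
    exact hasDerivAt_entry_gram b₀ hζ t i j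
  match k with
  | Int.negSucc _ => exact hasDerivAt_const _ _
  | Int.ofNat K =>
    rw [Int.ofNat_eq_natCast]
    rcases Nat.even_or_odd' K with ⟨k, rfl | rfl⟩
    · simp only [pfTau_even, pfTauGram_even]
      exact hasDerivAt_wordPf_gram hA rfl k (hentry _ _)
    · simp only [pfTau_odd, pfTauGram_odd]
      refine hasDerivAt_wordPf_gram_cons hA rfl k (hentry _ _) fun x hx => ?_
      obtain ⟨i, rfl⟩ := mem_consec hx
      exact hasDerivAt_moment b₀ hζ t i

theorem pfTauWronski_eq_pfTauGram (hζ : ∀ j, 0 < ζ j) (k : ℤ) :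
    pfTauWronski ζ b₀ l t k = pfTauGram ζ b₀ l t k :=
  (hasDerivAt_pfTau_wronski b₀ hζ k).unique (hasDerivAt_pfTau_gram b₀ hζ k)

/-- The four-letter identity for the letters `d₀, -1, 0, k` and the common part `1, …, k - 1`
(Wronski-type derivatives), up to moving the last letter of each word forward. -/
theorem pfTau_bilinear_first (hζ : ∀ j, 0 < ζ j) {k : ℤ} (hk : 0 ≤ k) :
    pfTauWronski ζ b₀ 0 t (k + 1) * pfTau ζ b₀ 0 t k -
      pfTau ζ b₀ 0 t (k + 1) * pfTauWronski ζ b₀ 0 t k =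
    pfTau ζ b₀ (-1) t (k + 1) * pfTau ζ b₀ 1 t k -
      pfTau ζ b₀ 1 t (k - 1) * pfTau ζ b₀ (-1) t (k + 2) := by
  have hA := entry_antisymm b₀ hζ t
  obtain ⟨K, rfl⟩ := Int.eq_ofNat_of_zero_le hk
  rcases K with _ | K
  · have h1 : pfTau ζ b₀ 0 t 0 = 1 := pfTau_even ζ b₀ 0 t 0
    have h2 : pfTau ζ b₀ 1 t 0 = 1 := pfTau_even ζ b₀ 1 t 0
    have h3 : pfTauWronski ζ b₀ 0 t 1 = pfTau ζ b₀ (-1) t 1 := by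
      have h6 := pfTauWronski_odd ζ b₀ 0 t 0
      have h7 := pfTau_odd ζ b₀ (-1) t 0
      simp only [mul_zero, zero_add, Nat.cast_one, consec_succ, zero_sub, neg_add_cancel] at h6 h7
      rw [h6, h7]
      rfl
    have h4 : pfTau ζ b₀ 1 t (-1) = 0 := rfl
    have h5 : pfTauWronski ζ b₀ 0 t 0 = 0 := rfl
    simp [h1, h2, h3, h4, h5]
  · have e1 : ((K + 1 : ℕ) : ℤ) + 1 = ((K + 2 : ℕ) : ℤ) := by push_cast; ring
    have e2 : ((K + 1 : ℕ) : ℤ) + 2 = ((K + 3 : ℕ) : ℤ) := by push_cast; ring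
    have e3 : ((K + 1 : ℕ) : ℤ) - 1 = (K : ℤ) := by push_cast; ring
    rw [e1, e2, e3]
    rcases Nat.even_or_odd' K with ⟨k, rfl | rfl⟩
    · have m (m : ℕ) (P : List Label) (z : Label) := (IsAlternating.wordPf hA m).move_last P
        (consec 1 (2 * k)) z
      simp only [length_consec, even_two_mul, Even.neg_pow, one_pow, one_mul] at m
      have h := wordPf_bilinear_even hA (k + 1) k .d0 (.num (-1)) (.num 0)
        (.num (1 + (2 * k : ℕ))) (consec 1 (2 * k))
      rw [pfTauWronski_even, pfTau_odd, show 2 * k + 2 = 2 * (k + 1) by ring, pfTau_even,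
        pfTauWronski_odd, pfTau_even, pfTau_odd, pfTau_even,
        show 2 * k + 3 = 2 * (k + 1) + 1 by ring, pfTau_odd]
      simp only [show 2 * (k + 1) = 2 * k + 1 + 1 by ring, consec_succ 0, consec_succ (-1),
        consec_succ' 1, zero_add, neg_add_cancel, zero_sub]
      have m1 := m (k + 1) [.num (-1)] (.num (1 + (2 * k : ℕ)))
      have m2 := m (k + 1) [.num 0] (.num (1 + (2 * k : ℕ)))
      have m3 := m (k + 1) [.d0] (.num (1 + (2 * k : ℕ)))
      have m4 := m (k + 1 + 1) [.d0, .num (-1), .num 0] (.num (1 + (2 * k : ℕ)))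
      simp only [List.cons_append, List.nil_append] at m1 m2 m3 m4
      rw [m1, m2, m3, m4]
      linarith
    · have m (m : ℕ) (P : List Label) (z : Label) := (IsAlternating.wordPf hA m).move_last P
        (consec 1 (2 * k + 1)) z
      simp only [length_consec, pow_succ, even_two_mul, Even.neg_pow, one_pow, one_mul] at m
      have h := wordPf_bilinear_odd hA (k + 2) k .d0 (.num (-1)) (.num 0)
        (.num (1 + (2 * k + 1 : ℕ))) (consec 1 (2 * k + 1))
      rw [show 2 * k + 1 + 2 = 2 * (k + 1) + 1 by ring, pfTauWronski_odd, pfTau_odd, pfTau_odd,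
        show 2 * k + 1 + 1 = 2 * k + 2 by ring, pfTauWronski_even,
        show 2 * k + 2 = 2 * (k + 1) by ring, pfTau_even, pfTau_even, pfTau_odd,
        show 2 * k + 1 + 3 = 2 * (k + 2) by ring, pfTau_even]
      simp only [show 2 * (k + 2) = 2 * k + 1 + 1 + 1 + 1 by ring,
        show 2 * (k + 1) = 2 * k + 1 + 1 by ring, consec_succ 0, consec_succ (-1), zero_add,
        neg_add_cancel, zero_sub]
      simp only [consec_succ' 1 (2 * k + 1)]
      have m1 := m (k + 1 + 1) [.d0, .num (-1)] (.num (1 + (2 * k + 1 : ℕ)))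
      have m2 := m (k + 1 + 1) [.d0, .num 0] (.num (1 + (2 * k + 1 : ℕ)))
      have m3 := m (k + 1) [] (.num (1 + (2 * k + 1 : ℕ)))
      have m4 := m (k + 2) [.num (-1), .num 0] (.num (1 + (2 * k + 1 : ℕ)))
      simp only [List.cons_append, List.nil_append] at m1 m2 m3 m4
      rw [m1, m2, m3, m4]
      linarith

/-- The four-letter identity for the letters `d₀, d₋₁, l, l + k` and the common part
`l + 1, …, l + k - 1` (Gram-type derivatives). -/
theorem pfTau_bilinear_second (hζ : ∀ j, 0 < ζ j) (l : ℤ) {k : ℤ} (hk : 0 ≤ k) :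
    pfTauWronski ζ b₀ l t k * pfTau ζ b₀ (l + 1) t k -
      pfTau ζ b₀ l t k * pfTauWronski ζ b₀ (l + 1) t k =
    pfTauWronski ζ b₀ l t (k + 1) * pfTau ζ b₀ (l + 1) t (k - 1) -
      pfTau ζ b₀ l t (k + 1) * pfTauWronski ζ b₀ (l + 1) t (k - 1) := by
  have hA := entry_antisymm b₀ hζ t
  obtain ⟨K, rfl⟩ := Int.eq_ofNat_of_zero_le hk
  rcases K with _ | K
  · have h1 (l) : pfTauWronski ζ b₀ l t 0 = 0 := rfl
    have h2 (l) : pfTauWronski ζ b₀ l t (-1) = 0 := rfl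
    have h3 (l) : pfTau ζ b₀ l t (-1) = 0 := rfl
    simp [h1, h2, h3]
  · have e1 : ((K + 1 : ℕ) : ℤ) + 1 = ((K + 2 : ℕ) : ℤ) := by push_cast; ring
    have e3 : ((K + 1 : ℕ) : ℤ) - 1 = (K : ℤ) := by push_cast; ring
    rw [e1, e3]
    simp only [pfTauWronski_eq_pfTauGram b₀ hζ]
    rcases Nat.even_or_odd' K with ⟨k, rfl | rfl⟩
    · have m (m : ℕ) (P : List Label) (z : Label) := (IsAlternating.wordPf hA m).move_last P
        (consec (l + 1) (2 * k)) z
      simp only [length_consec, even_two_mul, Even.neg_pow, one_pow, one_mul] at m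
      have h := wordPf_bilinear_even hA (k + 1) k .d0 .dm1 (.num l)
        (.num (l + 1 + (2 * k : ℕ))) (consec (l + 1) (2 * k))
      simp only [show 2 * k + 2 = 2 * (k + 1) by ring, pfTau_odd, pfTau_even, pfTauGram_odd,
        pfTauGram_even]
      simp only [show 2 * (k + 1) = 2 * k + 1 + 1 by ring, consec_succ l,
        consec_succ' (l + 1)]
      have m1 := m (k + 1) [.dm1] (.num (l + 1 + (2 * k : ℕ)))
      have m2 := m (k + 1) [.num l] (.num (l + 1 + (2 * k : ℕ)))
      have m3 := m (k + 1) [.d0] (.num (l + 1 + (2 * k : ℕ)))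
      have m4 := m (k + 1 + 1) [.d0, .dm1, .num l] (.num (l + 1 + (2 * k : ℕ)))
      simp only [List.cons_append, List.nil_append] at m1 m2 m3 m4
      rw [m1, m2, m3, m4]
      linarith
    · have m (m : ℕ) (P : List Label) (z : Label) := (IsAlternating.wordPf hA m).move_last P
        (consec (l + 1) (2 * k + 1)) z
      simp only [length_consec, pow_succ, even_two_mul, Even.neg_pow, one_pow, one_mul] at m
      have h := wordPf_bilinear_odd hA (k + 2) k .d0 .dm1 (.num l)
        (.num (l + 1 + (2 * k + 1 : ℕ))) (consec (l + 1) (2 * k + 1))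
      rw [show 2 * k + 1 + 2 = 2 * (k + 1) + 1 by ring]
      simp only [show 2 * k + 1 + 1 = 2 * (k + 1) by ring, pfTau_odd, pfTau_even, pfTauGram_odd,
        pfTauGram_even]
      simp only [show 2 * (k + 1) = 2 * k + 1 + 1 by ring, consec_succ l]
      simp only [consec_succ' (l + 1) (2 * k + 1)]
      have m1 := m (k + 1 + 1) [.dm1, .num l] (.num (l + 1 + (2 * k + 1 : ℕ)))
      have m2 := m (k + 1 + 1) [.d0, .num l] (.num (l + 1 + (2 * k + 1 : ℕ)))
      have m3 := m (k + 1) [] (.num (l + 1 + (2 * k + 1 : ℕ)))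
      have m4 := m (k + 1 + 1) [.d0, .dm1] (.num (l + 1 + (2 * k + 1 : ℕ)))
      simp only [List.cons_append, List.nil_append] at m1 m2 m3 m4
      rw [m1, m2, m3, m4]
      linarith

theorem bilinearIdentities_pfTau (hζ : ∀ j, 0 < ζ j) (t : ℝ) (n' : ℕ) :
    BilinearIdentities n'
      (pfTau ζ b₀ (-1) t) (pfTau ζ b₀ 0 t) (pfTau ζ b₀ 1 t)
      (pfTauWronski ζ b₀ (-1) t) (pfTauWronski ζ b₀ 0 t) (pfTauWronski ζ b₀ 1 t) where
  first _ hk _ := pfTau_bilinear_first b₀ hζ hk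
  second _ hk _ := pfTau_bilinear_second b₀ hζ 0 hk
  third _ hk _ := pfTau_bilinear_second b₀ hζ (-1) hk

end Tau

/-! ### The Pfaffians as sums over index sets -/

/-- `∑_{|I| = k} Δ_I² / Γ_I ζ_Iˡ b_I`, which is `T_k`, `U_k`, `V_k` for `l = -1, 0, 1`. -/
noncomputable def tauSum {n : ℕ} (ζ b : Fin n → ℝ) (l k : ℤ) : ℝ :=
  ∑ I : Finset (Fin n) with (I.card : ℤ) = k,
    Delta ζ I ^ 2 / Gam ζ I * (∏ j ∈ I, ζ j) ^ l * ∏ j ∈ I, b j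

theorem tauT_eq_tauSum {n : ℕ} (ζ b : Fin n → ℝ) (k : ℤ) : tauT ζ b k = tauSum ζ b (-1) k := by
  refine Finset.sum_congr rfl fun I _ => ?_
  rw [zpow_neg_one, mul_comm (∏ j ∈ I, ζ j) (Gam ζ I), ← div_div]
  rfl

theorem tauU_eq_tauSum {n : ℕ} (ζ b : Fin n → ℝ) (k : ℤ) : tauU ζ b k = tauSum ζ b 0 k := by
  simp [tauU, tauSum]

theorem tauV_eq_tauSum {n : ℕ} (ζ b : Fin n → ℝ) (k : ℤ) : tauV ζ b k = tauSum ζ b 1 k := by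
  simp [tauV, tauSum]

theorem schurProd_ofFn {K : ℕ} (x : Fin K → ℝ) :
    schurProd (List.ofFn x) = ∏ i, ∏ j ∈ Finset.Ioi i, schurEntry (x i) (x j) := by
  induction K with
  | zero => simp [schurProd]
  | succ K ih =>
    rw [List.ofFn_succ, schurProd, ih, Fin.prod_univ_succ, Fin.prod_Ioi_zero, List.map_ofFn,
      List.prod_ofFn]
    simp only [Fin.prod_Ioi_succ, Function.comp_apply]

section

variable {n : ℕ} {ζ : Fin n → ℝ} (b₀ : Fin n → ℝ)

/-- The vector of coefficients of a numerical label with respect to the letters `ζₐ`. -/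
noncomputable def Label.vec (ζ b : Fin n → ℝ) : Label → Fin n → ℝ
  | .num i, a => ζ a ^ i * b a
  | _, _ => 0

theorem wordPf_entry_eq_wordSum (hζ : ∀ j, 0 < ζ j) (t : ℝ) (k : ℕ) {L : List Label}
    (hL : ∀ x ∈ L, ∃ i, x = .num i) :
    wordPf (entry ζ b₀ t) k L = wordSum (L.map (Label.vec ζ (flow ζ b₀ t)))
      (wordPf (fun a c => schurEntry (ζ a) (ζ c)) k) := by
  rw [← wordPf_wordSum, wordPf_map]
  refine wordPf_congr k fun x hx y hy => ?_
  obtain ⟨i, rfl⟩ := hL x hx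
  obtain ⟨j, rfl⟩ := hL y hy
  exact entry_num_num b₀ hζ t i j

theorem wordPf_entry_d0_eq_wordSum (hζ : ∀ j, 0 < ζ j) (t : ℝ) (k : ℕ) {L : List Label}
    (hL : ∀ x ∈ L, ∃ i, x = .num i) :
    wordPf (entry ζ b₀ t) (k + 1) (.d0 :: L) = wordSum (L.map (Label.vec ζ (flow ζ b₀ t)))
      fun w => contract (fun _ => 1) w (wordPf (fun a c => schurEntry (ζ a) (ζ c)) k) := by
  rw [← contract_wordSum, contract_map, wordPf_succ_cons]
  refine contract_congr (fun x hx => ?_) fun L' hL' _ =>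
    wordPf_entry_eq_wordSum b₀ hζ t k fun x hx => hL x (hL' hx)
  obtain ⟨i, rfl⟩ := hL x hx
  simp [entry, moment, Label.vec]

theorem wordPf_schurEntry_ofFn (hζ : ∀ j, 0 < ζ j) {k K : ℕ} (hK : K = 2 * k)
    (s : Fin K → Fin n) :
    wordPf (fun a c => schurEntry (ζ a) (ζ c)) k (List.ofFn s) =
      ∏ i, ∏ j ∈ Finset.Ioi i, schurEntry (ζ (s i)) (ζ (s j)) := by
  rw [← wordPf_map schurEntry ζ, List.map_ofFn, wordPf_schurEntry k (by simp [hK]),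
    schurProd_ofFn]
  · rfl
  · rw [List.pairwise_ofFn]
    exact fun i j _ => ⟨(hζ _).le, hζ _⟩

/-- Schur's Pfaffian for an odd number of letters: the border of ones is the additional letter
`0`. -/
theorem contract_one_schurEntry_ofFn (hζ : ∀ j, 0 < ζ j) {k K : ℕ} (hK : K = 2 * k + 1)
    (s : Fin K → Fin n) :
    contract (fun _ => 1) (List.ofFn s) (wordPf (fun a c => schurEntry (ζ a) (ζ c)) k) =
      ∏ i, ∏ j ∈ Finset.Ioi i, schurEntry (ζ (s i)) (ζ (s j)) := by
  have h : wordPf schurEntry (k + 1) (0 :: List.ofFn fun i => ζ (s i)) =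
      contract (fun _ => 1) (List.ofFn s) (wordPf (fun a c => schurEntry (ζ a) (ζ c)) k) := by
    rw [wordPf_succ_cons, show (List.ofFn fun i => ζ (s i)) = (List.ofFn s).map ζ by
      rw [List.map_ofFn]; rfl, contract_map]
    exact contract_congr (fun a _ => schurEntry_zero_left (hζ a).ne')
      fun L' _ _ => wordPf_map schurEntry ζ k L'
  have h1 : (List.map (schurEntry 0) (List.ofFn fun i => ζ (s i))).prod = 1 := by
    rw [List.map_ofFn, List.prod_ofFn]
    exact Finset.prod_eq_one fun i _ => schurEntry_zero_left (hζ _).ne'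
  rw [← h, wordPf_schurEntry (k + 1), schurProd, schurProd_ofFn, h1, one_mul]
  · simp [hK]; ring
  · rw [List.pairwise_cons, List.pairwise_ofFn]
    refine ⟨fun x hx => ?_, fun i j _ => ⟨(hζ _).le, hζ _⟩⟩
    obtain ⟨i, rfl⟩ := (List.mem_ofFn' _ _).mp hx
    exact ⟨le_rfl, hζ _⟩

theorem pfTau_eq_sum_words (hζ : ∀ j, 0 < ζ j) (l : ℤ) (t : ℝ) (K : ℕ) :
    pfTau ζ b₀ l t K = ∑ s : Fin K → Fin n, (∏ i, ζ (s i) ^ (l + (i : ℕ)) * flow ζ b₀ t (s i)) *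
      ∏ i, ∏ j ∈ Finset.Ioi i, schurEntry (ζ (s i)) (ζ (s j)) := by
  have hvec (K : ℕ) : (consec l K).map (Label.vec ζ (flow ζ b₀ t)) =
      List.ofFn fun (i : Fin K) a => ζ a ^ (l + (i : ℕ)) * flow ζ b₀ t a := by
    rw [consec_eq, List.map_map, ← List.map_coe_finRange_eq_range, List.map_map, List.ofFn_eq_map]
    rfl
  rcases Nat.even_or_odd' K with ⟨k, rfl | rfl⟩
  · rw [pfTau_even, wordPf_entry_eq_wordSum b₀ hζ t k fun x hx => mem_consec hx, hvec,
      wordSum_ofFn]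
    simp only [wordPf_schurEntry_ofFn hζ rfl]
  · rw [pfTau_odd, wordPf_entry_d0_eq_wordSum b₀ hζ t k fun x hx => mem_consec hx, hvec,
      wordSum_ofFn]
    simp only [contract_one_schurEntry_ofFn hζ rfl]

/-- Symmetrization of a sum over words: if the weight is alternating, the monomials
`∏ ζ_{s i}^i` combine to Vandermonde determinants over increasing words. -/
theorem sum_words_eq_sum_orderEmbedding (b : Fin n → ℝ) (hζ : ∀ j, 0 < ζ j) (l : ℤ) (K : ℕ) :
    (∑ s : Fin K → Fin n, (∏ i, ζ (s i) ^ (l + (i : ℕ)) * b (s i)) *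
      ∏ i, ∏ j ∈ Finset.Ioi i, schurEntry (ζ (s i)) (ζ (s j))) =
    ∑ e : Fin K ↪o Fin n, (∏ i, ζ (e i) ^ l * b (e i)) *
      (∏ i, ∏ j ∈ Finset.Ioi i, schurEntry (ζ (e i)) (ζ (e j))) *
      ∏ i, ∏ j ∈ Finset.Ioi i, (ζ (e j) - ζ (e i)) := by
  classical
  have h1 : (∑ p : (Fin K ↪o Fin n) × Equiv.Perm (Fin K),
      (∏ i, ζ (p.1 (p.2 i)) ^ (l + (i : ℕ)) * b (p.1 (p.2 i))) *
      ∏ i, ∏ j ∈ Finset.Ioi i, schurEntry (ζ (p.1 (p.2 i))) (ζ (p.1 (p.2 j)))) =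
      ∑ s : Fin K → Fin n, (∏ i, ζ (s i) ^ (l + (i : ℕ)) * b (s i)) *
      ∏ i, ∏ j ∈ Finset.Ioi i, schurEntry (ζ (s i)) (ζ (s j)) := by
    refine Finset.sum_of_injOn (fun p i => p.1 (p.2 i)) ?_
      (fun _ _ => Finset.mem_coe.mpr (Finset.mem_univ _)) ?_ fun _ _ => rfl
    · rintro ⟨e, σ⟩ - ⟨e', σ'⟩ - h
      have hr : Set.range e = Set.range e' := by
        have h2 : Set.range (e ∘ σ) = Set.range (e' ∘ σ') := congrArg Set.range h
        rwa [EquivLike.range_comp, EquivLike.range_comp] at h2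
      obtain rfl : e = e' := by
        ext i
        rw [(e.strictMono.range_inj e'.strictMono).mp hr]
      congr 1
      ext i
      exact congrArg _ (e.injective (congrFun h i))
    · intro s _ hs
      by_cases hinj : Function.Injective s
      · refine absurd ⟨(OrderEmbedding.ofStrictMono (s ∘ Tuple.sort s)
          ((Tuple.monotone_sort s).strictMono_of_injective
            (hinj.comp (Tuple.sort s).injective)), (Tuple.sort s)⁻¹), by simp, ?_⟩ hs
        funext i
        simp
      · obtain ⟨i, j, hij, hne⟩ : ∃ i j, s i = s j ∧ i < j := by
          simp only [Function.Injective, not_forall] at hinj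
          obtain ⟨i, j, h, hne⟩ := hinj
          rcases lt_or_gt_of_ne hne with h' | h'
          · exact ⟨i, j, h, h'⟩
          · exact ⟨j, i, h.symm, h'⟩
        have hz : schurEntry (ζ (s i)) (ζ (s j)) = 0 := by simp [hij, schurEntry]
        exact mul_eq_zero_of_right _ (Finset.prod_eq_zero (Finset.mem_univ i)
          (Finset.prod_eq_zero (Finset.mem_Ioi.mpr hne) hz))
  rw [← h1, Fintype.sum_prod_type]
  refine Finset.sum_congr rfl fun e _ => ?_
  rw [← Matrix.det_vandermonde, Matrix.det_apply', Finset.mul_sum]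
  refine Finset.sum_congr rfl fun σ _ => ?_
  have h2 := σ.prod_Ioi_comp_eq_sign_mul_prod (R := ℝ)
    (f := fun i j => schurEntry (ζ (e i)) (ζ (e j))) fun i j => schurEntry_antisymm _ _
  rw [h2]
  have h3 : (∏ i, ζ (e (σ i)) ^ (l + (i : ℕ)) * b (e (σ i))) =
      (∏ i, ζ (e i) ^ l * b (e i)) * ∏ i, Matrix.vandermonde (fun i => ζ (e i)) (σ i) i := by
    rw [← Equiv.prod_comp σ fun i => ζ (e i) ^ l * b (e i), ← Finset.prod_mul_distrib]
    refine Finset.prod_congr rfl fun i _ => ?_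
    rw [zpow_add₀ (hζ _).ne', zpow_natCast, Matrix.vandermonde_apply]
    ring
  rw [h3]
  ring

theorem prod_pairs_map {K : ℕ} (e : Fin K ↪o Fin n) (f : Fin n → Fin n → ℝ) :
    (∏ i ∈ Finset.univ.map e.toEmbedding, ∏ j ∈ Finset.univ.map e.toEmbedding with i < j, f i j) =
      ∏ i, ∏ j ∈ Finset.Ioi i, f (e i) (e j) := by
  rw [Finset.prod_map]
  refine Finset.prod_congr rfl fun i _ => ?_
  rw [Finset.filter_map, Finset.prod_map]
  refine Finset.prod_congr ?_ fun _ _ => rfl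
  ext j
  simp

/-- The Pfaffian `τ_k` is the sum over index sets. -/
theorem pfTau_eq_tauSum (hζ : ∀ j, 0 < ζ j) (l : ℤ) (t : ℝ) (k : ℤ) :
    pfTau ζ b₀ l t k = tauSum ζ (flow ζ b₀ t) l k := by
  match k with
  | Int.negSucc m =>
    refine (Finset.sum_eq_zero fun I hI => ?_).symm
    simp only [Finset.mem_filter, Finset.mem_univ, true_and] at hI
    omega
  | Int.ofNat K =>
    rw [Int.ofNat_eq_natCast, pfTau_eq_sum_words b₀ hζ, sum_words_eq_sum_orderEmbedding _ hζ,
      tauSum]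
    refine Finset.sum_bij (fun e _ => Finset.univ.map e.toEmbedding) (fun e _ => by simp) ?_ ?_ ?_
    · intro e _ e' _ h
      have hr : Set.range e = Set.range e' := by
        have := congrArg (fun s : Finset (Fin n) => (s : Set (Fin n))) h
        simpa using this
      ext i
      rw [(e.strictMono.range_inj e'.strictMono).mp hr]
    · intro I hI
      simp only [Finset.mem_filter, Finset.mem_univ, true_and, Nat.cast_inj] at hI
      exact ⟨I.orderEmbOfFin hI, Finset.mem_univ _, Finset.map_orderEmbOfFin_univ I hI⟩
    · intro e _
      rw [Delta, Gam, prod_pairs_map, prod_pairs_map, Finset.prod_map, Finset.prod_map]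
      simp only [schurEntry, Finset.prod_div_distrib, Finset.prod_mul_distrib,
        Finset.prod_zpow]
      simp only [RelEmbedding.coe_toEmbedding]
      ring

end

/-! ### Multipeakon profiles -/

section Profile

open Filter Topology

variable {n : ℕ}

/-- The derivative of the profile away from the peaks. At a peak, where the sign is `0`, it is the
average of the one-sided derivatives. -/
noncomputable def profileSlope (x m : Fin n → ℝ) (y : ℝ) : ℝ :=
  ∑ k, -(m k * (SignType.sign (y - x k) : ℝ) * Real.exp (-|y - x k|))

theorem hasDerivAt_profile (x m : Fin n → ℝ) {y : ℝ} (hy : ∀ k, y ≠ x k) :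
    HasDerivAt (profile x m) (profileSlope x m y) y := by
  refine HasDerivAt.fun_sum fun k _ => ?_
  have h1 : HasDerivAt (fun y => |y - x k|) (SignType.sign (y - x k) : ℝ) y :=
    (hasDerivAt_abs (sub_ne_zero.mpr (hy k))).comp_sub_const y (x k)
  refine (h1.neg.exp.const_mul (m k)).congr_deriv ?_
  simp only [Pi.neg_apply]
  ring

theorem hasDerivAt_profileSlope (x m : Fin n → ℝ) {y : ℝ} (hy : ∀ k, y ≠ x k) :
    HasDerivAt (profileSlope x m) (profile x m y) y := by
  refine HasDerivAt.fun_sum fun k _ => ?_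
  have hyk := sub_ne_zero.mpr (hy k)
  have h1 : HasDerivAt (fun y => |y - x k|) (SignType.sign (y - x k) : ℝ) y :=
    (hasDerivAt_abs hyk).comp_sub_const y (x k)
  have h2 : (fun y => (SignType.sign (y - x k) : ℝ)) =ᶠ[𝓝 y]
      fun _ => (SignType.sign (y - x k) : ℝ) := by
    rcases lt_or_gt_of_ne (hy k) with h | h
    · filter_upwards [Iio_mem_nhds h] with z hz
      rw [sign_neg (sub_neg.mpr h), sign_neg (sub_neg.mpr hz)]
    · filter_upwards [Ioi_mem_nhds h] with z hz
      rw [sign_pos (sub_pos.mpr h), sign_pos (sub_pos.mpr hz)]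
  have h3 := (hasDerivAt_const y (SignType.sign (y - x k) : ℝ)).congr_of_eventuallyEq h2
  refine (((h3.const_mul (m k)).mul h1.neg.exp).neg).congr_deriv ?_
  have h4 : (SignType.sign (y - x k) : ℝ) * (SignType.sign (y - x k) : ℝ) = 1 := by
    rcases lt_or_gt_of_ne hyk with h | h
    · simp [sign_neg h]
    · simp [sign_pos h]
  simp only [Pi.neg_apply]
  linear_combination (m k * Real.exp (-|y - x k|)) * h4

theorem continuous_profile (x m : Fin n → ℝ) : Continuous (profile x m) := by
  unfold profile
  fun_prop

theorem tendsto_profileSlope_right {x : Fin n → ℝ} (hx : Function.Injective x) (m : Fin n → ℝ)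
    (i : Fin n) :
    Tendsto (profileSlope x m) (𝓝[>] (x i)) (𝓝 (profileSlope x m (x i) - m i)) := by
  have h : profileSlope x m (x i) - m i =
      ∑ k, -(m k * (if k = i then 1 else (SignType.sign (x i - x k) : ℝ)) *
        Real.exp (-|x i - x k|)) := by
    rw [profileSlope, ← Finset.sum_ite_eq' Finset.univ i m |>.trans (if_pos (Finset.mem_univ i)),
      ← Finset.sum_sub_distrib]
    refine Finset.sum_congr rfl fun k _ => ?_
    split_ifs with hk
    · simp [hk]
    · simp
  rw [h]
  refine tendsto_finsetSum _ fun k _ => (Tendsto.mul (Tendsto.mul tendsto_const_nhds ?_) ?_).neg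
  · refine tendsto_const_nhds.congr' ?_
    split_ifs with hk
    · subst hk
      filter_upwards [self_mem_nhdsWithin] with y hy
      rw [sign_pos (sub_pos.mpr (Set.mem_Ioi.mp hy)), SignType.coe_one]
    · rcases lt_or_gt_of_ne (hx.ne hk) with h | h
      · filter_upwards [mem_nhdsWithin_of_mem_nhds (Ioi_mem_nhds h)] with y hy
        rw [sign_pos (sub_pos.mpr h), sign_pos (sub_pos.mpr hy)]
      · filter_upwards [mem_nhdsWithin_of_mem_nhds (Iio_mem_nhds h)] with y hy
        rw [sign_neg (sub_neg.mpr h), sign_neg (sub_neg.mpr hy)]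
  · exact (Continuous.tendsto (by fun_prop) _).mono_left nhdsWithin_le_nhds

theorem tendsto_profileSlope_left {x : Fin n → ℝ} (hx : Function.Injective x) (m : Fin n → ℝ)
    (i : Fin n) :
    Tendsto (profileSlope x m) (𝓝[<] (x i)) (𝓝 (profileSlope x m (x i) + m i)) := by
  have h : profileSlope x m (x i) + m i =
      ∑ k, -(m k * (if k = i then -1 else (SignType.sign (x i - x k) : ℝ)) *
        Real.exp (-|x i - x k|)) := by
    rw [profileSlope, ← Finset.sum_ite_eq' Finset.univ i m |>.trans (if_pos (Finset.mem_univ i)),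
      ← Finset.sum_add_distrib]
    refine Finset.sum_congr rfl fun k _ => ?_
    split_ifs with hk
    · simp [hk]
    · simp
  rw [h]
  refine tendsto_finsetSum _ fun k _ => (Tendsto.mul (Tendsto.mul tendsto_const_nhds ?_) ?_).neg
  · refine tendsto_const_nhds.congr' ?_
    split_ifs with hk
    · subst hk
      filter_upwards [self_mem_nhdsWithin] with y hy
      rw [sign_neg (sub_neg.mpr (Set.mem_Iio.mp hy)), SignType.coe_neg_one]
    · rcases lt_or_gt_of_ne (hx.ne hk) with h | h
      · filter_upwards [mem_nhdsWithin_of_mem_nhds (Ioi_mem_nhds h)] with y hy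
        rw [sign_pos (sub_pos.mpr h), sign_pos (sub_pos.mpr hy)]
      · filter_upwards [mem_nhdsWithin_of_mem_nhds (Iio_mem_nhds h)] with y hy
        rw [sign_neg (sub_neg.mpr h), sign_neg (sub_neg.mpr hy)]
  · exact (Continuous.tendsto (by fun_prop) _).mono_left nhdsWithin_le_nhds

theorem eventually_ne_peaks (x : Fin n → ℝ) (a : ℝ) : ∀ᶠ y in 𝓝[≠] a, ∀ k, y ≠ x k := by
  refine eventually_all.mpr fun k => ?_
  rcases eq_or_ne a (x k) with rfl | h
  · exact self_mem_nhdsWithin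
  · exact mem_nhdsWithin_of_mem_nhds (isOpen_ne.mem_nhds h)

theorem isAverageAt_deriv_profile {x : Fin n → ℝ} (hx : Function.Injective x) (m : Fin n → ℝ)
    (i : Fin n) : IsAverageAt (deriv (profile x m)) (x i) (profileSlope x m (x i)) := by
  have h : ∀ᶠ y in 𝓝[≠] (x i), profileSlope x m y = deriv (profile x m) y := by
    filter_upwards [eventually_ne_peaks x (x i)] with y hy
    exact (hasDerivAt_profile x m hy).deriv.symm
  refine ⟨profileSlope x m (x i) + m i, profileSlope x m (x i) - m i, ?_, ?_, by ring⟩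
  · exact (tendsto_profileSlope_left hx m i).congr'
      (h.filter_mono (nhdsWithin_mono _ fun y hy => (Set.mem_Iio.mp hy).ne))
  · exact (tendsto_profileSlope_right hx m i).congr'
      (h.filter_mono (nhdsWithin_mono _ fun y hy => (Set.mem_Ioi.mp hy).ne'))

theorem sum_eq_Iio_add_Ioi (f : Fin n → ℝ) (i : Fin n) :
    ∑ j, f j = ∑ j ∈ Finset.Iio i, f j + f i + ∑ j ∈ Finset.Ioi i, f j := by
  have h1 : (Finset.univ : Finset (Fin n)) = Finset.Iio i ∪ ({i} ∪ Finset.Ioi i) := by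
    ext j
    simp only [Finset.mem_univ, Finset.mem_union, Finset.mem_Iio, Finset.mem_singleton,
      Finset.mem_Ioi, lt_trichotomy j i]
  rw [h1, Finset.sum_union, Finset.sum_union, Finset.sum_singleton, add_assoc]
  · simp
  · rw [Finset.disjoint_left]
    intro j hj hj'
    simp only [Finset.mem_Iio, Finset.mem_union, Finset.mem_singleton, Finset.mem_Ioi] at hj hj'
    rcases hj' with rfl | h
    · exact lt_irrefl _ hj
    · exact lt_asymm hj h

/-- The part of the profile at the `i`-th peak due to the peaks to its left is `exp(-xᵢ)` times
this sum. -/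
noncomputable def leftSum (x m : Fin n → ℝ) (i : Fin n) : ℝ :=
  ∑ j ∈ Finset.Iio i, m j * Real.exp (x j)

/-- The part of the profile at the `i`-th peak due to the peaks to its right is `exp(xᵢ)` times
this sum. -/
noncomputable def rightSum (x m : Fin n → ℝ) (i : Fin n) : ℝ :=
  ∑ j ∈ Finset.Ioi i, m j * Real.exp (-x j)

theorem exp_neg_abs_sub_of_le {a b : ℝ} (h : b ≤ a) :
    Real.exp (-|a - b|) = Real.exp (-a) * Real.exp b := by
  rw [abs_of_nonneg (sub_nonneg.mpr h), ← Real.exp_add]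
  congr 1
  ring

theorem exp_neg_abs_sub_of_ge {a b : ℝ} (h : a ≤ b) :
    Real.exp (-|a - b|) = Real.exp a * Real.exp (-b) := by
  rw [abs_of_nonpos (sub_nonpos.mpr h), ← Real.exp_add]
  congr 1
  ring

theorem profile_peak {x : Fin n → ℝ} (hx : StrictMono x) (m : Fin n → ℝ) (i : Fin n) :
    profile x m (x i) =
      Real.exp (-x i) * leftSum x m i + m i + Real.exp (x i) * rightSum x m i := by
  rw [profile, sum_eq_Iio_add_Ioi _ i, leftSum, rightSum, Finset.mul_sum, Finset.mul_sum]
  congr 1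
  · congr 1
    · refine Finset.sum_congr rfl fun j hj => ?_
      rw [exp_neg_abs_sub_of_le (hx (Finset.mem_Iio.mp hj)).le]
      ring
    · simp
  · refine Finset.sum_congr rfl fun j hj => ?_
    rw [exp_neg_abs_sub_of_ge (hx (Finset.mem_Ioi.mp hj)).le]
    ring

theorem profileSlope_peak {x : Fin n → ℝ} (hx : StrictMono x) (m : Fin n → ℝ) (i : Fin n) :
    profileSlope x m (x i) =
      -(Real.exp (-x i) * leftSum x m i) + Real.exp (x i) * rightSum x m i := by
  rw [profileSlope, sum_eq_Iio_add_Ioi _ i, leftSum, rightSum, Finset.mul_sum, Finset.mul_sum,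
    ← Finset.sum_neg_distrib]
  congr 1
  · rw [sub_self, sign_zero, SignType.coe_zero, mul_zero, zero_mul, neg_zero, add_zero]
    refine Finset.sum_congr rfl fun j hj => ?_
    have h := hx (Finset.mem_Iio.mp hj)
    rw [exp_neg_abs_sub_of_le h.le, sign_pos (sub_pos.mpr h), SignType.coe_one]
    ring
  · refine Finset.sum_congr rfl fun j hj => ?_
    have h := hx (Finset.mem_Ioi.mp hj)
    rw [exp_neg_abs_sub_of_ge h.le, sign_neg (sub_neg.mpr h), SignType.coe_neg_one]
    ring

end Profile

/-! ### Reduction of the peakon equations to the bilinear identities -/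

section Reduction

theorem sum_Iio_telescope {n : ℕ} (a : ℕ → ℝ) (i : Fin n) :
    ∑ j ∈ Finset.Iio i, (a (j + 1) - a j) = a i - a 0 := by
  rw [← Finset.sum_range_sub, ← Nat.Iio_eq_range, ← Fin.map_valEmbedding_Iio, Finset.sum_map]
  rfl

theorem sum_Ioi_telescope {n : ℕ} (a : ℕ → ℝ) (i : Fin n) :
    ∑ j ∈ Finset.Ioi i, (a (j + 1) - a j) = a n - a (i + 1) := by
  have h1 := sum_eq_Iio_add_Ioi (fun j : Fin n => a (j + 1) - a j) i
  rw [sum_Iio_telescope, Fin.sum_univ_eq_sum_range (fun j => a (j + 1) - a j) n,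
    Finset.sum_range_sub] at h1
  linarith

variable {n : ℕ} {T U V : ℤ → ℝ}

theorem wOf_sub_one (U V : ℤ → ℝ) (k : ℤ) :
    wOf U V (k - 1) = V (k - 1) * U (k - 1) - V (k - 2) * U k := by
  rw [wOf, sub_add_cancel, sub_sub]
  norm_num

namespace Admissible

theorem zOf_pos (h : Admissible n T U V) (i : Fin n) : 0 < zOf T U ((n : ℤ) - (i : ℕ)) :=
  h.Z_pos _ (by omega) (by omega)

theorem wOf_pos (h : Admissible n T U V) (i : Fin n) : 0 < wOf U V ((n : ℤ) - (i : ℕ) - 1) :=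
  h.W_pos _ (by omega) (by omega)

theorem U_pos' (h : Admissible n T U V) (i : Fin n) : 0 < U ((n : ℤ) - (i : ℕ)) :=
  h.U_pos _ (by omega) (by omega)

theorem U_sub_one_pos (h : Admissible n T U V) (i : Fin n) : 0 < U ((n : ℤ) - (i : ℕ) - 1) :=
  h.U_pos _ (by omega) (by omega)

theorem momentum_pos (h : Admissible n T U V) (i : Fin n) : 0 < momentum n T U V i :=
  div_pos (Real.sqrt_pos.mpr (mul_pos (h.zOf_pos i) (h.wOf_pos i)))
    (mul_pos (h.U_pos' i) (h.U_sub_one_pos i))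

theorem exp_position (h : Admissible n T U V) (i : Fin n) :
    Real.exp (position n T U V i) =
      √(zOf T U ((n : ℤ) - (i : ℕ)) / wOf U V ((n : ℤ) - (i : ℕ) - 1)) := by
  have hr := div_pos (h.zOf_pos i) (h.wOf_pos i)
  rw [position, one_div_mul_eq_div, Real.sqrt_eq_rpow, Real.rpow_def_of_pos hr]
  congr 1
  ring

theorem exp_position_sq (h : Admissible n T U V) (i : Fin n) :
    Real.exp (position n T U V i) ^ 2 =
      zOf T U ((n : ℤ) - (i : ℕ)) / wOf U V ((n : ℤ) - (i : ℕ) - 1) := by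
  rw [h.exp_position, Real.sq_sqrt (div_pos (h.zOf_pos i) (h.wOf_pos i)).le]

theorem momentum_mul_exp (h : Admissible n T U V) (i : Fin n) :
    momentum n T U V i * Real.exp (position n T U V i) =
      T ((n : ℤ) - (i : ℕ)) / U ((n : ℤ) - (i : ℕ) - 1) -
        T ((n : ℤ) - (i : ℕ) + 1) / U ((n : ℤ) - (i : ℕ)) := by
  have hz := h.zOf_pos i
  have hw := h.wOf_pos i
  have hu := h.U_pos' i
  have hu1 := h.U_sub_one_pos i
  rw [h.exp_position, momentum, div_mul_eq_mul_div, ← Real.sqrt_mul (by positivity),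
    show zOf T U ((n : ℤ) - (i : ℕ)) * wOf U V ((n : ℤ) - (i : ℕ) - 1) *
      (zOf T U ((n : ℤ) - (i : ℕ)) / wOf U V ((n : ℤ) - (i : ℕ) - 1)) =
      zOf T U ((n : ℤ) - (i : ℕ)) ^ 2 by field_simp, Real.sqrt_sq hz.le, zOf]
  field_simp

theorem momentum_mul_exp_neg (h : Admissible n T U V) (i : Fin n) :
    momentum n T U V i * Real.exp (-position n T U V i) =
      V ((n : ℤ) - (i : ℕ) - 1) / U ((n : ℤ) - (i : ℕ)) -
        V ((n : ℤ) - (i : ℕ) - 2) / U ((n : ℤ) - (i : ℕ) - 1) := by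
  have hz := h.zOf_pos i
  have hw := h.wOf_pos i
  have hu := h.U_pos' i
  have hu1 := h.U_sub_one_pos i
  rw [Real.exp_neg, h.exp_position, momentum, ← Real.sqrt_inv, div_mul_eq_mul_div,
    ← Real.sqrt_mul (by positivity),
    show zOf T U ((n : ℤ) - (i : ℕ)) * wOf U V ((n : ℤ) - (i : ℕ) - 1) *
      (zOf T U ((n : ℤ) - (i : ℕ)) / wOf U V ((n : ℤ) - (i : ℕ) - 1))⁻¹ =
      wOf U V ((n : ℤ) - (i : ℕ) - 1) ^ 2 by field_simp, Real.sqrt_sq hw.le, wOf_sub_one]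
  field_simp

theorem leftSum_eq (h : Admissible n T U V) (i : Fin n) :
    leftSum (position n T U V) (momentum n T U V) i =
      T ((n : ℤ) - (i : ℕ) + 1) / U ((n : ℤ) - (i : ℕ)) := by
  have h1 := sum_Iio_telescope (fun j : ℕ => T ((n : ℤ) - j + 1) / U ((n : ℤ) - j)) i
  rw [leftSum]
  simp only [h.momentum_mul_exp]
  simp only [Nat.cast_zero, sub_zero, h.T_end, zero_div, Nat.cast_succ, ← sub_sub,
    sub_add_cancel] at h1
  exact h1

theorem rightSum_eq (h : Admissible n T U V) (i : Fin n) :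
    rightSum (position n T U V) (momentum n T U V) i =
      V ((n : ℤ) - (i : ℕ) - 2) / U ((n : ℤ) - (i : ℕ) - 1) := by
  have h1 := sum_Ioi_telescope (fun j : ℕ => -(V ((n : ℤ) - j - 1) / U ((n : ℤ) - j))) i
  rw [rightSum]
  simp only [h.momentum_mul_exp_neg]
  have e (j : ℕ) : (n : ℤ) - j - 1 - 1 = n - j - 2 := by ring
  simp only [Nat.cast_succ, ← sub_sub, e, sub_self, zero_sub, h.V_end, zero_div, sub_neg_eq_add,
    neg_zero, zero_add, neg_add_eq_sub] at h1
  exact h1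

end Admissible

/-- The average of the one-sided derivatives of the profile at a peak is `profileSlope`. -/
theorem SolvesPeakonODE.of_hasDerivAt {x m : ℝ → Fin n → ℝ}
    (hinj : ∀ t, Function.Injective (x t))
    (h : ∀ t i, HasDerivAt (fun s => x s i) (profile (x t) (m t) (x t i) ^ 2) t ∧
      HasDerivAt (fun s => m s i) (-(m t i) * profile (x t) (m t) (x t i) *
        profileSlope (x t) (m t) (x t i)) t) : SolvesPeakonODE x m := fun t i =>
  ⟨(h t i).1, _, isAverageAt_deriv_profile (hinj t) (m t) i, (h t i).2⟩

/-- The peakon equations at the `i`-th peak. The second and third bilinear identities simplify the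
derivatives of `Z_k` and `W_{k-1}`; the values of `u` and `⟨uₓ⟩` at the peak telescope, and the
first identity matches them with these derivatives. -/
theorem hasDerivAt_position_momentum {A B C A' B' C' : ℝ → ℤ → ℝ}
    (hd : ∀ t k, HasDerivAt (fun s => A s k) (A' t k) t ∧ HasDerivAt (fun s => B s k) (B' t k) t ∧
      HasDerivAt (fun s => C s k) (C' t k) t)
    (hadm : ∀ t, Admissible n (A t) (B t) (C t))
    (hbil : ∀ t, BilinearIdentities n (A t) (B t) (C t) (A' t) (B' t) (C' t))
    (t : ℝ) (i : Fin n) :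
    let x := fun t => position n (A t) (B t) (C t)
    let m := fun t => momentum n (A t) (B t) (C t)
    HasDerivAt (fun s => x s i) (profile (x t) (m t) (x t i) ^ 2) t ∧
      HasDerivAt (fun s => m s i) (-(m t i) * profile (x t) (m t) (x t i) *
        profileSlope (x t) (m t) (x t i)) t := by
  intro x m
  have hz := fun s => (hadm s).zOf_pos i
  have hw := fun s => (hadm s).wOf_pos i
  have hu := fun s => (hadm s).U_pos' i
  have hu1 := fun s => (hadm s).U_sub_one_pos i
  have hprof : profile (x t) (m t) (x t i) = _ := profile_peak (hadm t).ordered (m t) i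
  have hslope : profileSlope (x t) (m t) (x t i) = _ := profileSlope_peak (hadm t).ordered (m t) i
  rw [(hadm t).leftSum_eq, (hadm t).rightSum_eq] at hprof hslope
  have hmq := (hadm t).momentum_mul_exp i
  have hqq := (hadm t).exp_position_sq i
  have hq := Real.exp_pos (position n (A t) (B t) (C t) i)
  rw [Real.exp_neg] at hprof hslope
  have hx : (fun s => x s i) = fun s => 1 / 2 * (Real.log (zOf (A s) (B s) ((n : ℤ) - (i : ℕ))) -
      Real.log (wOf (B s) (C s) ((n : ℤ) - (i : ℕ) - 1))) := by
    funext s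
    rw [← Real.log_div (hz s).ne' (hw s).ne']
    rfl
  have hm : (fun s => m s i) = fun s =>
      √(zOf (A s) (B s) ((n : ℤ) - (i : ℕ)) * wOf (B s) (C s) ((n : ℤ) - (i : ℕ) - 1)) /
        (B s ((n : ℤ) - (i : ℕ)) * B s ((n : ℤ) - (i : ℕ) - 1)) := rfl
  have hmt : m t i = √(zOf (A t) (B t) ((n : ℤ) - (i : ℕ)) *
      wOf (B t) (C t) ((n : ℤ) - (i : ℕ) - 1)) /
        (B t ((n : ℤ) - (i : ℕ)) * B t ((n : ℤ) - (i : ℕ) - 1)) := rfl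
  have hmq' : m t i * Real.exp (position n (A t) (B t) (C t) i) = _ := hmq
  clear hmq
  -- abstract `k = n - i`, `q = exp(xᵢ)`, `u = u(xᵢ)` and `v = ⟨uₓ⟩(xᵢ)`
  change profile (x t) (m t) (x t i) =
    (Real.exp (position n (A t) (B t) (C t) i))⁻¹ * _ + m t i +
      Real.exp (position n (A t) (B t) (C t) i) * _ at hprof
  change profileSlope (x t) (m t) (x t i) =
    -((Real.exp (position n (A t) (B t) (C t) i))⁻¹ * _) +
      Real.exp (position n (A t) (B t) (C t) i) * _ at hslope
  have hk : (0 : ℤ) ≤ (n : ℤ) - (i : ℕ) - 1 := by omega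
  have hk' : (n : ℤ) - (i : ℕ) ≤ n := by omega
  generalize (n : ℤ) - (i : ℕ) = k at *
  generalize Real.exp (position n (A t) (B t) (C t) i) = q at *
  generalize profile (x t) (m t) (x t i) = u at *
  generalize profileSlope (x t) (m t) (x t i) = v at *
  have b1 := (hbil t).first (k - 1) hk (by omega)
  have b2 := (hbil t).second (k - 1) hk (by omega)
  have b3 := (hbil t).third k (by omega) hk'
  simp only [sub_add_cancel, show k - 1 - 1 = k - 2 by ring, show k - 1 + 2 = k + 1 by ring]
    at b1 b2
  have dz : HasDerivAt (fun s => zOf (A s) (B s) k)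
      (2 * (A t k * B' t k - A t (k + 1) * B' t (k - 1))) t := by
    have := ((hd t k).1.mul (hd t k).2.1).sub ((hd t (k + 1)).1.mul (hd t (k - 1)).2.1)
    refine this.congr_deriv ?_
    linear_combination b3
  have dw : HasDerivAt (fun s => wOf (B s) (C s) (k - 1))
      (2 * (B' t (k - 1) * C t (k - 1) - B' t k * C t (k - 2))) t := by
    simp only [wOf_sub_one]
    have := ((hd t (k - 1)).2.2.mul (hd t (k - 1)).2.1).sub
      ((hd t (k - 2)).2.2.mul (hd t k).2.1)
    refine this.congr_deriv ?_
    linear_combination -b2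
  have hz := hz t
  have hw := hw t
  have hu := hu t
  have hu1 := hu1 t
  have hzt : zOf (A t) (B t) k = A t k * B t k - A t (k + 1) * B t (k - 1) := rfl
  have hwt := wOf_sub_one (B t) (C t) k
  have hsq : √(zOf (A t) (B t) k * wOf (B t) (C t) (k - 1)) ^ 2 =
    zOf (A t) (B t) k * wOf (B t) (C t) (k - 1) := Real.sq_sqrt (by positivity)
  have hs := Real.sqrt_pos.mpr (mul_pos hz hw)
  have dlz := dz.log hz.ne'
  have dlw := dw.log hw.ne'
  have ds := (dz.mul dw).sqrt (mul_pos hz hw).ne'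
  have dm := ds.div ((hd t k).2.1.mul (hd t (k - 1)).2.1) (mul_pos hu hu1).ne'
  -- the value of the profile at the peak
  have hqu : q * u * wOf (B t) (C t) (k - 1) =
      A t k * C t (k - 1) - A t (k + 1) * C t (k - 2) := by
    have e1 : q * u = A t (k + 1) / B t k + m t i * q + q ^ 2 * (C t (k - 2) / B t (k - 1)) := by
      rw [hprof]
      field_simp
    rw [e1, hmq', hqq]
    field_simp
    rw [hzt, hwt]
    ring
  have hu2 : u ^ 2 * (zOf (A t) (B t) k * wOf (B t) (C t) (k - 1)) =
      (A t k * C t (k - 1) - A t (k + 1) * C t (k - 2)) ^ 2 := by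
    rw [← hqu, mul_pow, mul_pow, hqq]
    field_simp
  have huv : u * v * (zOf (A t) (B t) k * wOf (B t) (C t) (k - 1)) * (B t k * B t (k - 1)) =
      (A t k * C t (k - 1) - A t (k + 1) * C t (k - 2)) *
      (C t (k - 2) * zOf (A t) (B t) k * B t k -
        A t (k + 1) * wOf (B t) (C t) (k - 1) * B t (k - 1)) := by
    have e1 : q * v = -(A t (k + 1) / B t k) + q ^ 2 * (C t (k - 2) / B t (k - 1)) := by
      rw [hslope]
      field_simp
    have e2 : u * v * (zOf (A t) (B t) k * wOf (B t) (C t) (k - 1)) =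
        (q * u * wOf (B t) (C t) (k - 1)) * (q * v) * wOf (B t) (C t) (k - 1) := by
      rw [show zOf (A t) (B t) k = q ^ 2 * wOf (B t) (C t) (k - 1) by rw [hqq]; field_simp]
      ring
    rw [e2, hqu, e1, hqq]
    field_simp
    ring
  constructor
  · rw [hx]
    refine ((dlz.sub dlw).const_mul (1 / 2)).congr_deriv ?_
    have hne := (mul_pos hz hw).ne'
    have h1 : u ^ 2 = (A t k * C t (k - 1) - A t (k + 1) * C t (k - 2)) ^ 2 /
        (zOf (A t) (B t) k * wOf (B t) (C t) (k - 1)) := by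
      rw [eq_div_iff hne, hu2]
    rw [h1]
    field_simp
    rw [hzt, hwt]
    linear_combination (A t k * C t (k - 1) - A t (k + 1) * C t (k - 2)) * b1
  · rw [hm]
    refine dm.congr_deriv ?_
    have hne := (mul_pos hz hw).ne'
    have h1 : u * v = (A t k * C t (k - 1) - A t (k + 1) * C t (k - 2)) *
      (C t (k - 2) * zOf (A t) (B t) k * B t k -
        A t (k + 1) * wOf (B t) (C t) (k - 1) * B t (k - 1)) /
        (zOf (A t) (B t) k * wOf (B t) (C t) (k - 1) * (B t k * B t (k - 1))) := by
      rw [eq_div_iff (mul_pos (mul_pos hz hw) (mul_pos hu hu1)).ne', ← mul_assoc, huv]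
    have key : ((A t k * B' t k - A t (k + 1) * B' t (k - 1)) * wOf (B t) (C t) (k - 1) +
        zOf (A t) (B t) k * (B' t (k - 1) * C t (k - 1) - B' t k * C t (k - 2))) *
        (B t k * B t (k - 1)) - zOf (A t) (B t) k * wOf (B t) (C t) (k - 1) *
          (B' t k * B t (k - 1) + B t k * B' t (k - 1)) =
        -((A t k * C t (k - 1) - A t (k + 1) * C t (k - 2)) *
          (C t (k - 2) * zOf (A t) (B t) k * B t k -
            A t (k + 1) * wOf (B t) (C t) (k - 1) * B t (k - 1))) := by
      rw [hzt, hwt]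
      linear_combination (A t (k + 1) * (C t (k - 1) * B t (k - 1) - C t (k - 2) * B t k) *
        B t (k - 1) - C t (k - 2) * (A t k * B t k - A t (k + 1) * B t (k - 1)) * B t k) * b1
    rw [neg_mul, neg_mul, mul_assoc (m t i) u v, h1, hmt]
    simp only [Pi.mul_apply]
    generalize √(zOf (A t) (B t) k * wOf (B t) (C t) (k - 1)) = r at *
    field_simp
    rw [hsq]
    linear_combination (zOf (A t) (B t) k * wOf (B t) (C t) (k - 1)) * key

theorem solvesPeakonODE_of_bilinearIdentities {A B C A' B' C' : ℝ → ℤ → ℝ}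
    (hd : ∀ t k, HasDerivAt (fun s => A s k) (A' t k) t ∧ HasDerivAt (fun s => B s k) (B' t k) t ∧
      HasDerivAt (fun s => C s k) (C' t k) t)
    (hadm : ∀ t, Admissible n (A t) (B t) (C t))
    (hbil : ∀ t, BilinearIdentities n (A t) (B t) (C t) (A' t) (B' t) (C' t)) :
    SolvesPeakonODE (fun t => position n (A t) (B t) (C t))
      (fun t => momentum n (A t) (B t) (C t)) :=
  .of_hasDerivAt (fun t => (hadm t).ordered.injective)
    fun t i => hasDerivAt_position_momentum hd hadm hbil t i

end Reduction

/-! ### Asymptotics of the sums over index sets -/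

section Asymptotics

open Filter Topology

variable {n : ℕ} {ζ b₀ : Fin n → ℝ}

/-- The first `K` indices. They belong to the exponentials that grow fastest as `t → ∞`. -/
def leadSet (n K : ℕ) : Finset (Fin n) := Finset.univ.filter fun j => (j : ℕ) < K

theorem mem_leadSet {K : ℕ} {j : Fin n} : j ∈ leadSet n K ↔ (j : ℕ) < K := by simp [leadSet]

theorem card_leadSet {K : ℕ} (hK : K ≤ n) : (leadSet n K).card = K := by
  rw [leadSet, Fin.card_filter_val_lt]
  exact min_eq_right hK

theorem leadSet_succ {K : ℕ} (hK : K < n) :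
    leadSet n (K + 1) = insert ⟨K, hK⟩ (leadSet n K) := by
  ext j
  simp only [mem_leadSet, Finset.mem_insert, Fin.ext_iff]
  omega

theorem prod_leadSet_succ {K : ℕ} (hK : K < n) (f : Fin n → ℝ) :
    ∏ j ∈ leadSet n (K + 1), f j = f ⟨K, hK⟩ * ∏ j ∈ leadSet n K, f j := by
  rw [leadSet_succ hK, Finset.prod_insert (by simp [mem_leadSet])]

/-- The coefficient `Δ_I² / Γ_I`. -/
noncomputable def tauCoeff (ζ : Fin n → ℝ) (I : Finset (Fin n)) : ℝ := Delta ζ I ^ 2 / Gam ζ I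

theorem tauCoeff_pos (hζ : ∀ j, 0 < ζ j) (hmono : StrictMono ζ) (I : Finset (Fin n)) :
    0 < tauCoeff ζ I := by
  refine div_pos (pow_pos ?_ 2) ?_
  · refine Finset.prod_pos fun i _ => Finset.prod_pos fun j hj => ?_
    exact sub_pos.mpr (hmono (Finset.mem_filter.mp hj).2)
  · exact Finset.prod_pos fun i _ => Finset.prod_pos fun j _ => add_pos (hζ j) (hζ i)

theorem flow_pos (hb : ∀ j, 0 < b₀ j) (t : ℝ) (j : Fin n) : 0 < flow ζ b₀ t j :=
  mul_pos (hb j) (Real.exp_pos _)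

theorem tauSum_pos (hζ : ∀ j, 0 < ζ j) (hmono : StrictMono ζ) {b : Fin n → ℝ}
    (hb : ∀ j, 0 < b j) (l : ℤ) {k : ℤ} (h0 : 0 ≤ k) (hk : k ≤ n) : 0 < tauSum ζ b l k := by
  refine Finset.sum_pos (fun I _ => ?_) ⟨leadSet n k.toNat, ?_⟩
  · exact mul_pos (mul_pos (tauCoeff_pos hζ hmono I)
      (zpow_pos (Finset.prod_pos fun j _ => hζ j) _)) (Finset.prod_pos fun j _ => hb j)
  · simp only [Finset.mem_filter, Finset.mem_univ, true_and]
    rw [card_leadSet (by omega)]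
    omega

theorem tauSum_eq_zero (ζ b : Fin n → ℝ) (l : ℤ) {k : ℤ} (hk : k < 0 ∨ n < k) :
    tauSum ζ b l k = 0 := by
  refine Finset.sum_eq_zero fun I hI => ?_
  simp only [Finset.mem_filter, Finset.mem_univ, true_and] at hI
  have := Finset.card_le_univ I
  rw [Fintype.card_fin] at this
  omega

theorem tauSum_zero (ζ b : Fin n → ℝ) (l : ℤ) : tauSum ζ b l 0 = 1 := by
  have h : (Finset.univ.filter fun I : Finset (Fin n) => (I.card : ℤ) = 0) = {∅} := by
    ext I
    simp
  rw [tauSum, h, Finset.sum_singleton]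
  simp [Delta, Gam]

theorem sum_inv_lt_sum_leadSet (hζ : ∀ j, 0 < ζ j) (hmono : StrictMono ζ) {K : ℕ}
    {I : Finset (Fin n)} (hI : I.card = K) (hne : I ≠ leadSet n K) :
    ∑ j ∈ I, (ζ j)⁻¹ < ∑ j ∈ leadSet n K, (ζ j)⁻¹ := by
  classical
  have hK : K ≤ n := by
    have := Finset.card_le_univ I
    rw [Fintype.card_fin] at this
    omega
  have hcard : (I \ leadSet n K).card = (leadSet n K \ I).card :=
    Finset.card_sdiff_comm (by rw [hI, card_leadSet hK])
  have hnon : (leadSet n K \ I).Nonempty := by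
    rw [Finset.sdiff_nonempty]
    intro h
    exact hne (Finset.eq_of_subset_of_card_le h (by rw [hI, card_leadSet hK])).symm
  have hnon' : (I \ leadSet n K).Nonempty := by
    rw [← Finset.card_pos, hcard, Finset.card_pos]
    exact hnon
  obtain ⟨p, hp⟩ := hnon'
  rw [Finset.mem_sdiff, mem_leadSet] at hp
  have hKn : K < n := by omega
  rw [← Finset.sum_sdiff_lt_sum_sdiff]
  calc ∑ j ∈ I \ leadSet n K, (ζ j)⁻¹ ≤ (I \ leadSet n K).card • (ζ ⟨K, hKn⟩)⁻¹ := by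
        refine Finset.sum_le_card_nsmul _ _ _ fun j hj => ?_
        rw [Finset.mem_sdiff, mem_leadSet] at hj
        refine inv_anti₀ (hζ _) (hmono.monotone ?_)
        rw [Fin.le_def]
        simp only
        omega
    _ = ∑ j ∈ leadSet n K \ I, (ζ ⟨K, hKn⟩)⁻¹ := by rw [hcard, Finset.sum_const]
    _ < ∑ j ∈ leadSet n K \ I, (ζ j)⁻¹ := by
        refine Finset.sum_lt_sum_of_nonempty hnon fun j hj => ?_
        rw [Finset.mem_sdiff, mem_leadSet] at hj
        exact inv_strictAnti₀ (hζ _) (hmono hj.1)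

theorem prod_flow (t : ℝ) (I : Finset (Fin n)) :
    ∏ j ∈ I, flow ζ b₀ t j = (∏ j ∈ I, b₀ j) * Real.exp ((∑ j ∈ I, (ζ j)⁻¹) * t) := by
  simp only [flow, Finset.prod_mul_distrib, ← Real.exp_sum, Finset.sum_mul, div_eq_inv_mul]

/-- The dominant product of `K` exponentials. -/
noncomputable def leadProd (ζ b₀ : Fin n → ℝ) (K : ℕ) (t : ℝ) : ℝ :=
  ∏ j ∈ leadSet n K, flow ζ b₀ t j

theorem leadProd_pos (hb : ∀ j, 0 < b₀ j) (K : ℕ) (t : ℝ) : 0 < leadProd ζ b₀ K t :=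
  Finset.prod_pos fun j _ => flow_pos hb t j

theorem tendsto_exp_neg_mul {c : ℝ} (hc : c < 0) :
    Tendsto (fun t => Real.exp (c * t)) atTop (𝓝 0) :=
  Real.tendsto_exp_atBot.comp (tendsto_id.const_mul_atTop_of_neg hc)

theorem tendsto_flow_div (hζ : ∀ j, 0 < ζ j) (hmono : StrictMono ζ)
    {i j : Fin n} (hij : i < j) :
    Tendsto (fun t => flow ζ b₀ t j / flow ζ b₀ t i) atTop (𝓝 0) := by
  have h := (tendsto_exp_neg_mul (sub_neg.mpr (inv_strictAnti₀ (hζ i) (hmono hij)))).const_mul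
    (b₀ j / b₀ i)
  rw [mul_zero] at h
  refine h.congr fun t => ?_
  rw [flow, flow, sub_mul, Real.exp_sub, div_eq_inv_mul t, div_eq_inv_mul t, mul_div_mul_comm]

/-- The leading asymptotics of `T_K`, `U_K`, `V_K` as `t → ∞`. -/
theorem tendsto_tauSum_div (hζ : ∀ j, 0 < ζ j) (hmono : StrictMono ζ) (hb : ∀ j, 0 < b₀ j)
    (l : ℤ) {K : ℕ} (hK : K ≤ n) :
    Tendsto (fun t => tauSum ζ (flow ζ b₀ t) l K / leadProd ζ b₀ K t) atTop
      (𝓝 (tauCoeff ζ (leadSet n K) * (∏ j ∈ leadSet n K, ζ j) ^ l)) := by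
  have hmem : leadSet n K ∈ Finset.univ.filter fun I : Finset (Fin n) => (I.card : ℤ) = K := by
    simp [card_leadSet hK]
  have hlim : tauCoeff ζ (leadSet n K) * (∏ j ∈ leadSet n K, ζ j) ^ l =
      ∑ I : Finset (Fin n) with (I.card : ℤ) = K,
        if I = leadSet n K then tauCoeff ζ I * (∏ j ∈ I, ζ j) ^ l else 0 := by
    rw [Finset.sum_ite_eq' _ _ _, if_pos hmem]
  rw [hlim]
  simp only [tauSum, Finset.sum_div]
  refine tendsto_finsetSum _ fun I hI => ?_
  simp only [Finset.mem_filter, Finset.mem_univ, true_and, Nat.cast_inj] at hI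
  split_ifs with h
  · subst h
    refine tendsto_const_nhds.congr fun t => ?_
    exact (mul_div_cancel_right₀ _ (leadProd_pos hb K t).ne').symm
  · have h1 := (tendsto_exp_neg_mul (sub_neg.mpr (sum_inv_lt_sum_leadSet hζ hmono hI h))).const_mul
      (tauCoeff ζ I * (∏ j ∈ I, ζ j) ^ l * ((∏ j ∈ I, b₀ j) / ∏ j ∈ leadSet n K, b₀ j))
    rw [mul_zero] at h1
    refine h1.congr fun t => ?_
    rw [leadProd, prod_flow, prod_flow, sub_mul, Real.exp_sub, tauCoeff]
    ring

/-- Products of `τ_{K+1}` and `τ_{K-1}` are negligible compared with products of two `τ_K`. -/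
theorem tendsto_leadProd_ratio (hζ : ∀ j, 0 < ζ j) (hmono : StrictMono ζ) (hb : ∀ j, 0 < b₀ j)
    {K : ℕ} (hK : K + 1 < n) :
    Tendsto (fun t => leadProd ζ b₀ (K + 2) t * leadProd ζ b₀ K t / leadProd ζ b₀ (K + 1) t ^ 2)
      atTop (𝓝 0) := by
  refine (tendsto_flow_div (b₀ := b₀) hζ hmono (i := ⟨K, by omega⟩) (j := ⟨K + 1, hK⟩)
    (Fin.mk_lt_mk.mpr (Nat.lt_succ_self K))).congr fun t => ?_
  have h0 := leadProd_pos (ζ := ζ) hb K t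
  have h1 : leadProd ζ b₀ (K + 1) t = flow ζ b₀ t ⟨K, by omega⟩ * leadProd ζ b₀ K t :=
    prod_leadSet_succ _ _
  have h2 : leadProd ζ b₀ (K + 2) t = flow ζ b₀ t ⟨K + 1, hK⟩ * leadProd ζ b₀ (K + 1) t :=
    prod_leadSet_succ _ _
  have h3 := flow_pos (ζ := ζ) hb t ⟨K, by omega⟩
  rw [h2, h1]
  field_simp

theorem tendsto_tauSum_minor (hζ : ∀ j, 0 < ζ j) (hmono : StrictMono ζ) (hb : ∀ j, 0 < b₀ j)
    (l l' : ℤ) {K : ℕ} (hK : K ≤ n) :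
    Tendsto (fun t => (tauSum ζ (flow ζ b₀ t) l K * tauSum ζ (flow ζ b₀ t) l' K -
      tauSum ζ (flow ζ b₀ t) l (K + 1) * tauSum ζ (flow ζ b₀ t) l' (K - 1)) /
        leadProd ζ b₀ K t ^ 2) atTop
      (𝓝 ((tauCoeff ζ (leadSet n K) * (∏ j ∈ leadSet n K, ζ j) ^ l) *
        (tauCoeff ζ (leadSet n K) * (∏ j ∈ leadSet n K, ζ j) ^ l'))) := by
  have h1 := (tendsto_tauSum_div hζ hmono hb l hK).mul (tendsto_tauSum_div hζ hmono hb l' hK)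
  have h2 : Tendsto (fun t => tauSum ζ (flow ζ b₀ t) l (K + 1) *
      tauSum ζ (flow ζ b₀ t) l' (K - 1) / leadProd ζ b₀ K t ^ 2) atTop (𝓝 0) := by
    rcases K with _ | K
    · refine tendsto_const_nhds.congr fun t => ?_
      rw [tauSum_eq_zero ζ _ l' (k := ((0 : ℕ) : ℤ) - 1) (by left; simp), mul_zero, zero_div]
    · rcases hK.lt_or_eq with h | h
      · have h3 := ((tendsto_tauSum_div hζ hmono hb l (K := K + 2) (by omega)).mul
          (tendsto_tauSum_div hζ hmono hb l' (K := K) (by omega))).mul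
          (tendsto_leadProd_ratio hζ hmono hb h)
        rw [mul_zero] at h3
        refine h3.congr fun t => ?_
        have p0 := leadProd_pos (ζ := ζ) hb K t
        have p1 := leadProd_pos (ζ := ζ) hb (K + 1) t
        have p2 := leadProd_pos (ζ := ζ) hb (K + 2) t
        rw [show ((K + 1 : ℕ) : ℤ) + 1 = ((K + 2 : ℕ) : ℤ) by push_cast; ring,
          show ((K + 1 : ℕ) : ℤ) - 1 = (K : ℤ) by push_cast; ring]
        field_simp
      · refine tendsto_const_nhds.congr fun t => ?_
        rw [tauSum_eq_zero ζ _ l (k := ((K + 1 : ℕ) : ℤ) + 1) (by right; omega), zero_mul,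
          zero_div]
  have h3 := h1.sub h2
  rw [sub_zero] at h3
  refine h3.congr fun t => ?_
  have p0 := leadProd_pos (ζ := ζ) hb K t
  field_simp

theorem tendsto_zOf (hζ : ∀ j, 0 < ζ j) (hmono : StrictMono ζ) (hb : ∀ j, 0 < b₀ j)
    {K : ℕ} (hK : K ≤ n) :
    Tendsto (fun t => zOf (tauSum ζ (flow ζ b₀ t) (-1)) (tauSum ζ (flow ζ b₀ t) 0) K /
        leadProd ζ b₀ K t ^ 2) atTop
      (𝓝 (tauCoeff ζ (leadSet n K) ^ 2 / ∏ j ∈ leadSet n K, ζ j)) := by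
  have h := tendsto_tauSum_minor hζ hmono hb (-1) 0 hK
  rw [zpow_neg_one, zpow_zero, mul_one] at h
  convert h using 2
  · rfl
  · ring

theorem tendsto_wOf (hζ : ∀ j, 0 < ζ j) (hmono : StrictMono ζ) (hb : ∀ j, 0 < b₀ j)
    {K : ℕ} (hK : K ≤ n) :
    Tendsto (fun t => wOf (tauSum ζ (flow ζ b₀ t) 0) (tauSum ζ (flow ζ b₀ t) 1) K /
        leadProd ζ b₀ K t ^ 2) atTop
      (𝓝 (tauCoeff ζ (leadSet n K) ^ 2 * ∏ j ∈ leadSet n K, ζ j)) := by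
  have h := tendsto_tauSum_minor hζ hmono hb 0 1 hK
  rw [zpow_one, zpow_zero, mul_one] at h
  convert h using 2
  · rw [wOf]
    ring
  · ring

theorem tendsto_tauU (hζ : ∀ j, 0 < ζ j) (hmono : StrictMono ζ) (hb : ∀ j, 0 < b₀ j)
    {K : ℕ} (hK : K ≤ n) :
    Tendsto (fun t => tauSum ζ (flow ζ b₀ t) 0 K / leadProd ζ b₀ K t) atTop
      (𝓝 (tauCoeff ζ (leadSet n K))) := by
  simpa using tendsto_tauSum_div hζ hmono hb 0 hK

end Asymptotics

/-! ### Positivity and ordering -/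

section Positivity

open Filter Topology

/-- The bilinear identities imply that `(Z_k W_k - Z_{k+1} W_{k-1}) / U_k⁴` is a constant of
motion. -/
theorem hasDerivAt_zw_div {N : ℕ} {A B C A' B' C' : ℝ → ℤ → ℝ} {t : ℝ} {k : ℤ}
    (hd : ∀ k, HasDerivAt (fun s => A s k) (A' t k) t ∧ HasDerivAt (fun s => B s k) (B' t k) t ∧
      HasDerivAt (fun s => C s k) (C' t k) t)
    (hbil : BilinearIdentities N (A t) (B t) (C t) (A' t) (B' t) (C' t))
    (h1k : 1 ≤ k) (hkN : k + 1 ≤ N) (hB : B t k ≠ 0) :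
    HasDerivAt (fun s => (zOf (A s) (B s) k * wOf (B s) (C s) k -
      zOf (A s) (B s) (k + 1) * wOf (B s) (C s) (k - 1)) / B s k ^ 4) 0 t := by
  have b1 := hbil.first (k - 1) (by omega) (by omega)
  have b1' := hbil.first k (by omega) (by omega)
  have b2 := hbil.second (k - 1) (by omega) (by omega)
  have b2' := hbil.second k (by omega) (by omega)
  have b3 := hbil.third k (by omega) (by omega)
  have b3' := hbil.third (k + 1) (by omega) hkN
  simp only [sub_add_cancel, show k - 1 - 1 = k - 2 by ring, show k - 1 + 2 = k + 1 by ring,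
    add_sub_cancel_right, show k + 1 + 1 = k + 2 by ring] at b1 b2 b3'
  have dz : HasDerivAt (fun s => zOf (A s) (B s) k)
      (2 * (A t k * B' t k - A t (k + 1) * B' t (k - 1))) t := by
    have := ((hd k).1.mul (hd k).2.1).sub ((hd (k + 1)).1.mul (hd (k - 1)).2.1)
    refine this.congr_deriv ?_
    linear_combination b3
  have dz' : HasDerivAt (fun s => zOf (A s) (B s) (k + 1))
      (2 * (A t (k + 1) * B' t (k + 1) - A t (k + 2) * B' t k)) t := by
    have e : (fun s => zOf (A s) (B s) (k + 1)) =
        fun s => A s (k + 1) * B s (k + 1) - A s (k + 2) * B s k := by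
      funext s
      rw [zOf, add_sub_cancel_right, add_assoc]
      rfl
    rw [e]
    have := ((hd (k + 1)).1.mul (hd (k + 1)).2.1).sub ((hd (k + 2)).1.mul (hd k).2.1)
    refine this.congr_deriv ?_
    linear_combination b3'
  have dw : HasDerivAt (fun s => wOf (B s) (C s) (k - 1))
      (2 * (B' t (k - 1) * C t (k - 1) - B' t k * C t (k - 2))) t := by
    simp only [wOf_sub_one]
    have := ((hd (k - 1)).2.2.mul (hd (k - 1)).2.1).sub ((hd (k - 2)).2.2.mul (hd k).2.1)
    refine this.congr_deriv ?_
    linear_combination -b2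
  have dw' : HasDerivAt (fun s => wOf (B s) (C s) k)
      (2 * (B' t k * C t k - B' t (k + 1) * C t (k - 1))) t := by
    have := ((hd k).2.2.mul (hd k).2.1).sub ((hd (k - 1)).2.2.mul (hd (k + 1)).2.1)
    refine this.congr_deriv ?_
    linear_combination -b2'
  have h := ((dz.mul dw').sub (dz'.mul dw)).div ((hd k).2.1.pow 4) (pow_ne_zero 4 hB)
  refine h.congr_deriv ?_
  have ez' : zOf (A t) (B t) (k + 1) = A t (k + 1) * B t (k + 1) - A t (k + 2) * B t k := by
    rw [zOf, add_sub_cancel_right, add_assoc]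
    rfl
  have key : (2 * (A t k * B' t k - A t (k + 1) * B' t (k - 1)) * wOf (B t) (C t) k +
      zOf (A t) (B t) k * (2 * (B' t k * C t k - B' t (k + 1) * C t (k - 1))) -
      (2 * (A t (k + 1) * B' t (k + 1) - A t (k + 2) * B' t k) * wOf (B t) (C t) (k - 1) +
        zOf (A t) (B t) (k + 1) * (2 * (B' t (k - 1) * C t (k - 1) - B' t k * C t (k - 2))))) *
      B t k = 4 * (zOf (A t) (B t) k * wOf (B t) (C t) k -
        zOf (A t) (B t) (k + 1) * wOf (B t) (C t) (k - 1)) * B' t k := by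
    rw [ez', wOf_sub_one, zOf, wOf]
    linear_combination (2 * B t k * (A t (k + 1) * C t k - A t (k + 2) * C t (k - 1))) * b1 -
      (2 * B t k * (A t k * C t (k - 1) - A t (k + 1) * C t (k - 2))) * b1'
  simp only [Pi.mul_apply, Pi.sub_apply, Pi.pow_apply]
  rw [div_eq_zero_iff]
  left
  norm_num
  linear_combination B t k ^ 3 * key

variable {n : ℕ} {ζ b₀ : Fin n → ℝ}

theorem hasDerivAt_tauSum (hζ : ∀ j, 0 < ζ j) (l : ℤ) (t : ℝ) (k : ℤ) :
    HasDerivAt (fun s => tauSum ζ (flow ζ b₀ s) l k) (pfTauWronski ζ b₀ l t k) t := by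
  simp only [← pfTau_eq_tauSum b₀ hζ]
  exact hasDerivAt_pfTau_wronski b₀ hζ k

theorem bilinearIdentities_tauSum (hζ : ∀ j, 0 < ζ j) (t : ℝ) (N : ℕ) :
    BilinearIdentities N (tauSum ζ (flow ζ b₀ t) (-1)) (tauSum ζ (flow ζ b₀ t) 0)
      (tauSum ζ (flow ζ b₀ t) 1) (pfTauWronski ζ b₀ (-1) t) (pfTauWronski ζ b₀ 0 t)
      (pfTauWronski ζ b₀ 1 t) := by
  have h := bilinearIdentities_pfTau b₀ hζ t N
  have e (l : ℤ) : pfTau ζ b₀ l t = tauSum ζ (flow ζ b₀ t) l :=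
    funext fun k => pfTau_eq_tauSum b₀ hζ l t k
  rwa [e, e, e] at h

/-- `Z_k W_k - Z_{k+1} W_{k-1} = U_k⁴`: the quotient of both sides is a constant of motion and
tends to `1` as `t → ∞`. -/
theorem zOf_mul_wOf_sub (hζ : ∀ j, 0 < ζ j) (hmono : StrictMono ζ) (hb : ∀ j, 0 < b₀ j)
    {K : ℕ} (hK : K + 1 ≤ n) (t : ℝ) :
    let T := tauSum ζ (flow ζ b₀ t) (-1)
    let U := tauSum ζ (flow ζ b₀ t) 0
    let V := tauSum ζ (flow ζ b₀ t) 1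
    zOf T U (K + 1 : ℕ) * wOf U V (K + 1 : ℕ) - zOf T U (K + 2 : ℕ) * wOf U V K =
      U (K + 1 : ℕ) ^ 4 := by
  intro T U V
  set R : ℝ → ℝ := fun s =>
    (zOf (tauSum ζ (flow ζ b₀ s) (-1)) (tauSum ζ (flow ζ b₀ s) 0) (K + 1 : ℕ) *
      wOf (tauSum ζ (flow ζ b₀ s) 0) (tauSum ζ (flow ζ b₀ s) 1) (K + 1 : ℕ) -
    zOf (tauSum ζ (flow ζ b₀ s) (-1)) (tauSum ζ (flow ζ b₀ s) 0) (K + 2 : ℕ) *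
      wOf (tauSum ζ (flow ζ b₀ s) 0) (tauSum ζ (flow ζ b₀ s) 1) K) /
    tauSum ζ (flow ζ b₀ s) 0 (K + 1 : ℕ) ^ 4 with hR
  have hU (s : ℝ) : 0 < tauSum ζ (flow ζ b₀ s) 0 (K + 1 : ℕ) :=
    tauSum_pos hζ hmono (flow_pos hb s) 0 (by omega) (by omega)
  have hder (s : ℝ) : HasDerivAt R 0 s := by
    have h := hasDerivAt_zw_div (N := n + 1) (A := fun s => tauSum ζ (flow ζ b₀ s) (-1))
      (B := fun s => tauSum ζ (flow ζ b₀ s) 0) (C := fun s => tauSum ζ (flow ζ b₀ s) 1)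
      (A' := fun s => pfTauWronski ζ b₀ (-1) s) (B' := fun s => pfTauWronski ζ b₀ 0 s)
      (C' := fun s => pfTauWronski ζ b₀ 1 s) (t := s) (k := (K + 1 : ℕ))
      (fun k => ⟨hasDerivAt_tauSum hζ _ s k, hasDerivAt_tauSum hζ _ s k,
        hasDerivAt_tauSum hζ _ s k⟩) (bilinearIdentities_tauSum hζ s (n + 1)) (by omega)
        (by push_cast; omega) (hU s).ne'
    rwa [show ((K + 1 : ℕ) : ℤ) + 1 = ((K + 2 : ℕ) : ℤ) by push_cast; ring,
      show ((K + 1 : ℕ) : ℤ) - 1 = (K : ℤ) by push_cast; ring] at h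
  have hconst (s : ℝ) : R s = R t :=
    is_const_of_deriv_eq_zero (fun s => (hder s).differentiableAt) (fun s => (hder s).deriv) s t
  have hc := tauCoeff_pos hζ hmono (leadSet n (K + 1))
  have hp : 0 < ∏ j ∈ leadSet n (K + 1), ζ j := Finset.prod_pos fun j _ => hζ j
  have h1 : Tendsto (fun s =>
      zOf (tauSum ζ (flow ζ b₀ s) (-1)) (tauSum ζ (flow ζ b₀ s) 0) (K + 2 : ℕ) *
      wOf (tauSum ζ (flow ζ b₀ s) 0) (tauSum ζ (flow ζ b₀ s) 1) K /
      leadProd ζ b₀ (K + 1) s ^ 4) atTop (𝓝 0) := by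
    rcases hK.lt_or_eq with h | h
    · have h2 := ((tendsto_zOf hζ hmono hb (K := K + 2) (by omega)).mul
        (tendsto_wOf hζ hmono hb (K := K) (by omega))).mul
        ((tendsto_leadProd_ratio hζ hmono hb h).pow 2)
      rw [zero_pow two_ne_zero, mul_zero] at h2
      refine h2.congr fun s => ?_
      have p0 := leadProd_pos (ζ := ζ) hb K s
      have p1 := leadProd_pos (ζ := ζ) hb (K + 1) s
      have p2 := leadProd_pos (ζ := ζ) hb (K + 2) s
      field_simp
    · refine tendsto_const_nhds.congr fun s => ?_
      rw [zOf, tauSum_eq_zero ζ _ (-1) (k := ((K + 2 : ℕ) : ℤ)) (by right; omega),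
        tauSum_eq_zero ζ _ (-1) (k := ((K + 2 : ℕ) : ℤ) + 1) (by right; omega)]
      simp
  have h2 : Tendsto R atTop (𝓝 1) := by
    have h3 := (((tendsto_zOf hζ hmono hb hK).mul (tendsto_wOf hζ hmono hb hK)).sub h1).div
      ((tendsto_tauU hζ hmono hb hK).pow 4) (pow_pos hc 4).ne'
    have e : (tauCoeff ζ (leadSet n (K + 1)) ^ 2 / (∏ j ∈ leadSet n (K + 1), ζ j) *
        (tauCoeff ζ (leadSet n (K + 1)) ^ 2 * ∏ j ∈ leadSet n (K + 1), ζ j) - 0) /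
        tauCoeff ζ (leadSet n (K + 1)) ^ 4 = 1 := by
      field_simp
      ring
    rw [e] at h3
    refine h3.congr fun s => ?_
    have p1 := leadProd_pos (ζ := ζ) hb (K + 1) s
    have p2 := hU s
    simp only [hR, Pi.div_apply]
    field_simp
  have h3 : R t = 1 :=
    tendsto_nhds_unique (tendsto_const_nhds.congr fun s => (hconst s).symm) h2
  exact (div_eq_one_iff_eq (pow_pos (hU t) 4).ne').mp h3

/-- Positivity of `Z_k` and `W_k`. The set of times at which all of them are positive contains all
large times, it is open, and it is closed because `Z_k W_k ≥ U_k⁴ > 0` as long as they are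
nonnegative. -/
theorem zOf_pos_and_wOf_pos (hζ : ∀ j, 0 < ζ j) (hmono : StrictMono ζ) (hb : ∀ j, 0 < b₀ j)
    (t : ℝ) {K : ℕ} (hK : K ≤ n) :
    0 < zOf (tauSum ζ (flow ζ b₀ t) (-1)) (tauSum ζ (flow ζ b₀ t) 0) K ∧
      0 < wOf (tauSum ζ (flow ζ b₀ t) 0) (tauSum ζ (flow ζ b₀ t) 1) K := by
  set Z : ℕ → ℝ → ℝ := fun K t =>
    zOf (tauSum ζ (flow ζ b₀ t) (-1)) (tauSum ζ (flow ζ b₀ t) 0) K with hZ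
  set W : ℕ → ℝ → ℝ := fun K t =>
    wOf (tauSum ζ (flow ζ b₀ t) 0) (tauSum ζ (flow ζ b₀ t) 1) K with hW
  have hcont (l k : ℤ) : Continuous fun t => tauSum ζ (flow ζ b₀ t) l k :=
    continuous_iff_continuousAt.mpr fun t => (hasDerivAt_tauSum hζ l t k).continuousAt
  have hZc (K : ℕ) : Continuous (Z K) :=
    ((hcont _ _).mul (hcont _ _)).sub ((hcont _ _).mul (hcont _ _))
  have hWc (K : ℕ) : Continuous (W K) :=
    ((hcont _ _).mul (hcont _ _)).sub ((hcont _ _).mul (hcont _ _))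
  have hZ0 (t : ℝ) : Z 0 t = 1 := by
    simp [hZ, zOf, tauSum_zero, tauSum_eq_zero ζ _ 0 (k := -1) (by left; norm_num)]
  have hW0 (t : ℝ) : W 0 t = 1 := by
    simp [hW, wOf, tauSum_zero, tauSum_eq_zero ζ _ 1 (k := -1) (by left; norm_num)]
  have hZn (t : ℝ) : Z (n + 1) t = 0 := by
    simp only [hZ, zOf]
    rw [tauSum_eq_zero ζ _ (-1) (k := ((n + 1 : ℕ) : ℤ)) (by right; omega),
      tauSum_eq_zero ζ _ (-1) (k := ((n + 1 : ℕ) : ℤ) + 1) (by right; omega)]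
    simp
  set S : Set ℝ := ⋂ K ∈ Finset.range (n + 1), {t | 0 < Z K t ∧ 0 < W K t} with hS
  have hS' : S = ⋂ K ∈ Finset.range (n + 1), {t | 0 ≤ Z K t ∧ 0 ≤ W K t} := by
    ext t
    simp only [hS, Set.mem_iInter, Finset.mem_range, Set.mem_ofPred_eq]
    refine ⟨fun h K hK => ⟨(h K hK).1.le, (h K hK).2.le⟩, fun h K hK => ?_⟩
    rcases K with _ | K
    · simp [hZ0, hW0]
    · have hU : 0 < tauSum ζ (flow ζ b₀ t) 0 (K + 1 : ℕ) :=
        tauSum_pos hζ hmono (flow_pos hb t) 0 (by omega) (by omega)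
      have e : Z (K + 1) t * W (K + 1) t - Z (K + 2) t * W K t = _ :=
        zOf_mul_wOf_sub hζ hmono hb (K := K) (by omega) t
      have hz : 0 ≤ Z (K + 2) t := by
        rcases (Nat.lt_succ_iff.mp hK).lt_or_eq with h' | h'
        · exact (h (K + 2) (by omega)).1
        · rw [show K + 2 = n + 1 by omega, hZn]
      have hp : 0 < Z (K + 1) t * W (K + 1) t := by
        have h1 := mul_nonneg hz (h K (by omega)).2
        have h2 := pow_pos hU 4
        linarith
      exact ⟨pos_of_mul_pos_left hp (h _ hK).2, pos_of_mul_pos_right hp (h _ hK).1⟩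
  have hopen : IsOpen S := isOpen_biInter_finset fun K _ =>
    (isOpen_lt continuous_const (hZc K)).inter (isOpen_lt continuous_const (hWc K))
  have hclosed : IsClosed S := by
    rw [hS']
    exact isClosed_biInter fun K _ =>
      (isClosed_le continuous_const (hZc K)).inter (isClosed_le continuous_const (hWc K))
  have hnon : S.Nonempty := by
    have h : ∀ᶠ t in atTop, ∀ K ∈ Finset.range (n + 1), 0 < Z K t ∧ 0 < W K t := by
      rw [eventually_all_finset]
      intro K hK
      have hK : K ≤ n := Nat.lt_succ_iff.mp (Finset.mem_range.mp hK)
      have hc := tauCoeff_pos hζ hmono (leadSet n K)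
      have hp : 0 < ∏ j ∈ leadSet n K, ζ j := Finset.prod_pos fun j _ => hζ j
      filter_upwards [(tendsto_zOf hζ hmono hb hK).eventually_const_lt (by positivity),
        (tendsto_wOf hζ hmono hb hK).eventually_const_lt (by positivity)] with t h1 h2
      have p := pow_pos (leadProd_pos (ζ := ζ) hb K t) 2
      exact ⟨(div_pos_iff_of_pos_right p).mp h1, (div_pos_iff_of_pos_right p).mp h2⟩
    obtain ⟨t, ht⟩ := h.exists
    exact ⟨t, by simpa [hS] using ht⟩
  have huniv : S = Set.univ := IsClopen.eq_univ ⟨hclosed, hopen⟩ hnon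
  have ht : t ∈ S := huniv ▸ Set.mem_univ t
  simp only [hS, Set.mem_iInter, Finset.mem_range, Set.mem_ofPred_eq] at ht
  exact ht K (Nat.lt_succ_of_le hK)

theorem admissible_tauSum (hζ : ∀ j, 0 < ζ j) (hmono : StrictMono ζ) (hb : ∀ j, 0 < b₀ j)
    (t : ℝ) : Admissible n (tauSum ζ (flow ζ b₀ t) (-1)) (tauSum ζ (flow ζ b₀ t) 0)
      (tauSum ζ (flow ζ b₀ t) 1) where
  T_end := tauSum_eq_zero ζ _ _ (by right; omega)
  V_end := tauSum_eq_zero ζ _ _ (by left; norm_num)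
  U_pos _ h0 hk := tauSum_pos hζ hmono (flow_pos hb t) 0 h0 hk
  Z_pos k h0 hk := by
    obtain ⟨K, rfl⟩ := Int.eq_ofNat_of_zero_le (by omega : 0 ≤ k)
    exact (zOf_pos_and_wOf_pos hζ hmono hb t (by omega)).1
  W_pos k h0 hk := by
    obtain ⟨K, rfl⟩ := Int.eq_ofNat_of_zero_le h0
    exact (zOf_pos_and_wOf_pos hζ hmono hb t (by omega)).2
  ordered := by
    rcases n with _ | n
    · exact fun i => i.elim0
    rw [Fin.strictMono_iff_lt_succ]
    intro i
    obtain ⟨K, hK⟩ : ∃ K : ℕ, K + 1 + (i : ℕ) = n := ⟨n - 1 - i, by omega⟩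
    have e1 : ((n + 1 : ℕ) : ℤ) - (i.castSucc : ℕ) = ((K + 2 : ℕ) : ℤ) := by
      rw [Fin.val_castSucc]
      omega
    have e2 : ((n + 1 : ℕ) : ℤ) - (i.succ : ℕ) = ((K + 1 : ℕ) : ℤ) := by
      rw [Fin.val_succ]
      omega
    rw [position, position, e1, e2, show ((K + 2 : ℕ) : ℤ) - 1 = ((K + 1 : ℕ) : ℤ) by omega,
      show ((K + 1 : ℕ) : ℤ) - 1 = (K : ℤ) by omega]
    have h0 := zOf_pos_and_wOf_pos hζ hmono hb t (K := K) (by omega)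
    have h1 := zOf_pos_and_wOf_pos hζ hmono hb t (K := K + 1) (by omega)
    have h2 := zOf_pos_and_wOf_pos hζ hmono hb t (K := K + 2) (by omega)
    have hU : 0 < tauSum ζ (flow ζ b₀ t) 0 (K + 1 : ℕ) :=
      tauSum_pos hζ hmono (flow_pos hb t) 0 (by omega) (by omega)
    have h3 := zOf_mul_wOf_sub hζ hmono hb (K := K) (by omega) t
    refine mul_lt_mul_of_pos_left (Real.log_lt_log (div_pos h2.1 h1.2) ?_) (by norm_num)
    rw [div_lt_div_iff₀ h1.2 h0.2]
    have h4 := pow_pos hU 4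
    simp only at h3
    linarith

end Positivity

/-! ### Weak solutions of the Novikov equation -/

section Weak

open Filter Topology MeasureTheory Set

/-- The fundamental theorem of calculus for a function with finitely many jumps `J s`. -/
theorem intervalIntegral_eq_sub_sum_jumps {F f J : ℝ → ℝ} (S : Finset ℝ) {a b Fa Fb : ℝ}
    (hab : a < b) (hS : ∀ s ∈ S, s ∈ Ioo a b)
    (hd : ∀ y ∈ Ioo a b, y ∉ S → HasDerivAt F (f y) y) (hint : Integrable f)
    (hJ : ∀ s ∈ S, ∃ l r, Tendsto F (𝓝[<] s) (𝓝 l) ∧ Tendsto F (𝓝[>] s) (𝓝 r) ∧ r - l = J s)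
    (ha : Tendsto F (𝓝[>] a) (𝓝 Fa)) (hb : Tendsto F (𝓝[<] b) (𝓝 Fb)) :
    ∫ y in a..b, f y = Fb - Fa - ∑ s ∈ S, J s := by
  induction S using Finset.induction_on_max generalizing b Fb with
  | empty =>
    rw [intervalIntegral.integral_eq_sub_of_hasDerivAt_of_tendsto hab
      (fun y hy => hd y hy (by simp)) hint.intervalIntegrable ha hb]
    simp
  | insert s S hs ih =>
    obtain ⟨l, r, hl, hr, hlr⟩ := hJ s (Finset.mem_insert_self s S)
    have hsab := hS s (Finset.mem_insert_self s S)
    have h1 := ih (b := s) (Fb := l) hsab.1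
      (fun x hx => ⟨(hS x (Finset.mem_insert_of_mem hx)).1, hs x hx⟩)
      (fun y hy hyS => hd y ⟨hy.1, hy.2.trans hsab.2⟩ (by simp [hyS, hy.2.ne]))
      (fun x hx => hJ x (Finset.mem_insert_of_mem hx)) hl
    have h2 : ∫ y in s..b, f y = Fb - r := by
      refine intervalIntegral.integral_eq_sub_of_hasDerivAt_of_tendsto hsab.2 (fun y hy => ?_)
        hint.intervalIntegrable hr hb
      refine hd y ⟨hsab.1.trans hy.1, hy.2⟩ fun h => ?_
      rcases Finset.mem_insert.mp h with h | h
      · exact hy.1.ne' h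
      · exact (hs y h).asymm hy.1
    rw [← intervalIntegral.integral_add_adjacent_intervals hint.intervalIntegrable
      hint.intervalIntegrable (b := s), h1, h2, Finset.sum_insert fun h => (hs s h).false, ← hlr]
    ring

/-- The integral of the derivative of a compactly supported function with finitely many jumps. -/
theorem integral_eq_neg_sum_jumps {n : ℕ} {x : Fin n → ℝ} (hx : Function.Injective x)
    {F f : ℝ → ℝ} {J : Fin n → ℝ} (hF : HasCompactSupport F) (hf : HasCompactSupport f)
    (hd : ∀ y, (∀ i, y ≠ x i) → HasDerivAt F (f y) y) (hint : Integrable f)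
    (hJ : ∀ i, ∃ l r, Tendsto F (𝓝[<] (x i)) (𝓝 l) ∧ Tendsto F (𝓝[>] (x i)) (𝓝 r) ∧
      r - l = J i) :
    ∫ y, f y = -∑ i, J i := by
  classical
  have hbdd : Bornology.IsBounded (tsupport F ∪ tsupport f ∪ range x) :=
    (hF.isBounded.union hf.isBounded).union (finite_range x).isBounded
  obtain ⟨R, hR⟩ := hbdd.subset_ball 0
  have hR' (y : ℝ) (hy : y ∈ tsupport F ∪ tsupport f ∪ range x) : -R < y ∧ y < R := by
    have := hR hy
    rwa [Metric.mem_ball, dist_zero_right, Real.norm_eq_abs, abs_lt] at this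
  have hzero (y : ℝ) (hy : R ≤ |y|) : Tendsto F (𝓝 y) (𝓝 0) := by
    have hyF : y ∉ tsupport F := fun h => by
      have := hR' y (Or.inl (Or.inl h))
      exact absurd (abs_lt.mpr this) (not_lt.mpr hy)
    refine tendsto_const_nhds.congr' ?_
    filter_upwards [(isClosed_tsupport F).isOpen_compl.mem_nhds hyF] with z hz
    exact (image_eq_zero_of_notMem_tsupport hz).symm
  set r := max R 1 with hr
  have hr0 : 0 < r := lt_of_lt_of_le one_pos (le_max_right _ _)
  have hRr : R ≤ r := le_max_left _ _
  have hsupp : Function.support f ⊆ Ioc (-r) r := fun y hy => by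
    have := hR' y (Or.inl (Or.inr (subset_tsupport f hy)))
    exact ⟨by linarith, by linarith⟩
  rw [← intervalIntegral.integral_eq_integral_of_support_subset hsupp,
    intervalIntegral_eq_sub_sum_jumps (Finset.univ.image x) (J := Function.extend x J 0)
      (by linarith : -r < r) ?_ ?_ hint ?_
      ((hzero (-r) (by rwa [abs_neg, abs_of_pos hr0])).mono_left nhdsWithin_le_nhds)
      ((hzero r (by rwa [abs_of_pos hr0])).mono_left nhdsWithin_le_nhds),
    Finset.sum_image hx.injOn]
  · simp [hx.extend_apply]
  · intro s hs
    obtain ⟨i, -, rfl⟩ := Finset.mem_image.mp hs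
    have := hR' (x i) (Or.inr ⟨i, rfl⟩)
    exact ⟨by linarith, by linarith⟩
  · exact fun y _ hy => hd y fun i hi => hy (by simp [hi])
  · intro s hs
    obtain ⟨i, -, rfl⟩ := Finset.mem_image.mp hs
    rw [hx.extend_apply]
    exact hJ i

variable {n : ℕ}

theorem locallyLipschitz_profile (x m : Fin n → ℝ) : LocallyLipschitz (profile x m) := by
  have h1 (k : Fin n) : LocallyLipschitz fun y => m k * Real.exp (-|y - x k|) := by
    have h2 : LocallyLipschitz fun z : ℝ => m k * Real.exp (-z) :=
      ContDiff.locallyLipschitz (𝕂 := ℝ) (by fun_prop)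
    have h3 : LipschitzWith 1 fun y : ℝ => |y - x k| :=
      LipschitzWith.of_dist_le_mul fun y z => by
        rw [NNReal.coe_one, one_mul, Real.dist_eq, Real.dist_eq]
        refine (abs_abs_sub_abs_le_abs_sub _ _).trans (le_of_eq ?_)
        congr 1
        ring
    exact h2.comp h3.locallyLipschitz
  have h4 (s : Finset (Fin n)) :
      LocallyLipschitz fun y => ∑ k ∈ s, m k * Real.exp (-|y - x k|) := by
    classical
    induction s using Finset.induction_on with
    | empty => simpa using LocallyLipschitz.const (0 : ℝ)
    | insert i s hi ih =>
      simp only [Finset.sum_insert hi]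
      have h5 : LocallyLipschitz fun p : ℝ × ℝ => p.1 + p.2 :=
        ContDiff.locallyLipschitz (𝕂 := ℝ) (by fun_prop)
      exact h5.comp ((h1 i).prodMk ih)
  exact h4 Finset.univ

theorem abs_profileSlope_le (x m : Fin n → ℝ) (y : ℝ) : |profileSlope x m y| ≤ ∑ k, |m k| := by
  refine (Finset.abs_sum_le_sum_abs _ _).trans (Finset.sum_le_sum fun k _ => ?_)
  rw [abs_neg, abs_mul, abs_mul, abs_of_pos (Real.exp_pos _)]
  have h1 : |(SignType.sign (y - x k) : ℝ)| ≤ 1 := by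
    rcases lt_trichotomy (y - x k) 0 with h | h | h
    · simp [sign_neg h]
    · simp [h]
    · simp [sign_pos h]
  have h2 : Real.exp (-|y - x k|) ≤ 1 := Real.exp_le_one_iff.mpr (by simp)
  calc |m k| * |(SignType.sign (y - x k) : ℝ)| * Real.exp (-|y - x k|)
      ≤ |m k| * 1 * 1 := by gcongr
    _ = |m k| := by ring

theorem ae_ne_peaks (x : Fin n → ℝ) : ∀ᵐ y, ∀ k, y ≠ x k := by
  have h := (finite_range x).countable.ae_notMem volume
  filter_upwards [h] with y hy k hk
  exact hy ⟨k, hk.symm⟩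

/-- The product of an integrable function and a power of the derivative of a profile is
integrable. -/
theorem integrable_mul_deriv_profile_pow (x m : Fin n → ℝ) {g : ℝ → ℝ} (hg : Integrable g)
    (p : ℕ) : Integrable fun y => deriv (profile x m) y ^ p * g y := by
  refine hg.bdd_mul (c := (∑ k, |m k|) ^ p)
    ((measurable_deriv (profile x m)).pow_const p).aestronglyMeasurable ?_
  filter_upwards [ae_ne_peaks x] with y hy
  rw [(hasDerivAt_profile x m hy).deriv, Real.norm_eq_abs, abs_pow]
  exact pow_le_pow_left₀ (abs_nonneg _) (abs_profileSlope_le x m y) p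

theorem hasDerivAt_iteratedDeriv {ψ : ℝ → ℝ} (hψ : ContDiff ℝ ∞ ψ) (k : ℕ) (y : ℝ) :
    HasDerivAt (iteratedDeriv k ψ) (iteratedDeriv (k + 1) ψ y) y := by
  rw [iteratedDeriv_succ]
  exact (hψ.differentiable_iteratedDeriv k (by exact_mod_cast ENat.natCast_lt_top k) y).hasDerivAt

theorem continuous_iteratedDeriv' {ψ : ℝ → ℝ} (hψ : ContDiff ℝ ∞ ψ) (k : ℕ) :
    Continuous (iteratedDeriv k ψ) :=
  continuous_iff_continuousAt.mpr fun y => (hasDerivAt_iteratedDeriv hψ k y).continuousAt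

theorem hasCompactSupport_iteratedDeriv {ψ : ℝ → ℝ} (hc : HasCompactSupport ψ) (k : ℕ) :
    HasCompactSupport (iteratedDeriv k ψ) := by
  induction k with
  | zero => simpa using hc
  | succ k ih =>
    rw [iteratedDeriv_succ]
    exact ih.deriv

/-- `u - u_xx = 2 ∑ mₖ δ(· - xₖ)` as distributions. -/
theorem integral_profile_mul {x : Fin n → ℝ} (hx : Function.Injective x) (m : Fin n → ℝ)
    {ψ : ℝ → ℝ} (hψ : ContDiff ℝ ∞ ψ) (hc : HasCompactSupport ψ) :
    ∫ y, profile x m y * (ψ y - iteratedDeriv 2 ψ y) = ∑ i, 2 * m i * ψ (x i) := by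
  have d0 (y : ℝ) : HasDerivAt ψ (iteratedDeriv 1 ψ y) y := by
    simpa using hasDerivAt_iteratedDeriv hψ 0 y
  have d1 := hasDerivAt_iteratedDeriv hψ 1
  have c1 := hasCompactSupport_iteratedDeriv hc 1
  have c2 := hasCompactSupport_iteratedDeriv hc 2
  have hu := continuous_profile x m
  have k1 := continuous_iteratedDeriv' hψ 1
  have k2 := continuous_iteratedDeriv' hψ 2
  have hfc : HasCompactSupport fun y => profile x m y * (ψ y - iteratedDeriv 2 ψ y) :=
    (hc.sub c2).mul_left
  rw [integral_eq_neg_sum_jumps hx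
    (F := fun y => profileSlope x m y * ψ y - profile x m y * iteratedDeriv 1 ψ y)
    (J := fun i => -(2 * m i * ψ (x i))) (hc.mul_left.sub c1.mul_left) hfc ?_
    ((hu.mul (hψ.continuous.sub k2)).integrable_of_hasCompactSupport hfc) ?_]
  · simp
  · intro y hy
    have := ((hasDerivAt_profileSlope x m hy).mul (d0 y)).sub
      ((hasDerivAt_profile x m hy).mul (d1 y))
    refine this.congr_deriv ?_
    ring
  · intro i
    have t0 (s : Set ℝ) := (hψ.continuous.tendsto (x i)).mono_left (nhdsWithin_le_nhds (s := s))
    have t1 (s : Set ℝ) := ((hu.mul k1).tendsto (x i)).mono_left (nhdsWithin_le_nhds (s := s))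
    refine ⟨_, _, ((tendsto_profileSlope_left hx m i).mul (t0 _)).sub (t1 _),
      ((tendsto_profileSlope_right hx m i).mul (t0 _)).sub (t1 _), ?_⟩
    ring

/-- Between the peaks, where `u' = w` and `w' = u`, the integrand of the weak form has an explicit
antiderivative. -/
theorem hasDerivAt_novikov_antideriv {u w p₀ p₁ p₂ : ℝ → ℝ} {p₃ y : ℝ}
    (hu : HasDerivAt u (w y) y) (hw : HasDerivAt w (u y) y) (h₀ : HasDerivAt p₀ (p₁ y) y)
    (h₁ : HasDerivAt p₁ (p₂ y) y) (h₂ : HasDerivAt p₂ p₃ y) :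
    HasDerivAt (fun y => -(u y ^ 3 / 3) * p₂ y + u y ^ 2 * w y * p₁ y +
        (u y ^ 3 / 3 - 1 / 2 * u y * w y ^ 2) * p₀ y)
      (u y ^ 3 / 3 * (4 * p₁ y - p₃) + 3 / 2 * u y * w y ^ 2 * p₁ y -
        1 / 2 * w y ^ 3 * p₀ y) y := by
  have h := ((((hu.pow 3).div_const 3).neg.mul h₂).add (((hu.pow 2).mul hw).mul h₁)).add
    ((((hu.pow 3).div_const 3).sub ((hu.const_mul (1 / 2)).mul (hw.pow 2))).mul h₀)
  refine h.congr_deriv ?_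
  simp only [Pi.neg_apply, Pi.pow_apply, Pi.mul_apply, Pi.sub_apply]
  push_cast
  ring

theorem integrable_novikov_terms (x m : Fin n → ℝ) {p₀ p₁ p₃ : ℝ → ℝ} (k₀ : Continuous p₀)
    (k₁ : Continuous p₁) (k₃ : Continuous p₃) (c₀ : HasCompactSupport p₀)
    (c₁ : HasCompactSupport p₁) (c₃ : HasCompactSupport p₃) :
    Integrable fun y => profile x m y ^ 3 / 3 * (4 * p₁ y - p₃ y)
        + 3 / 2 * profile x m y * deriv (profile x m) y ^ 2 * p₁ y
        - 1 / 2 * deriv (profile x m) y ^ 3 * p₀ y := by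
  have hu := continuous_profile x m
  have hc1 : HasCompactSupport fun y => profile x m y ^ 3 / 3 * (4 * p₁ y - p₃ y) :=
    HasCompactSupport.mul_left (HasCompactSupport.sub (HasCompactSupport.mul_left c₁) c₃)
  have hc2 : HasCompactSupport fun y => 3 / 2 * profile x m y * p₁ y :=
    HasCompactSupport.mul_left c₁
  have hc3 : HasCompactSupport fun y => 1 / 2 * p₀ y := HasCompactSupport.mul_left c₀
  have i1 := Continuous.integrable_of_hasCompactSupport (μ := volume) (by fun_prop) hc1
  have i2 := integrable_mul_deriv_profile_pow x m
    (Continuous.integrable_of_hasCompactSupport (by fun_prop) hc2) 2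
  have i3 := integrable_mul_deriv_profile_pow x m
    (Continuous.integrable_of_hasCompactSupport (by fun_prop) hc3) 3
  refine ((i1.add i2).sub i3).congr (Eventually.of_forall fun y => ?_)
  simp only [Pi.add_apply, Pi.sub_apply]
  ring

theorem tendsto_novikov_antideriv {u w p₀ p₁ p₂ : ℝ → ℝ} {ℓ : Filter ℝ} {a b c₀ c₁ c₂ : ℝ}
    (hu : Tendsto u ℓ (𝓝 a)) (hw : Tendsto w ℓ (𝓝 b)) (h₀ : Tendsto p₀ ℓ (𝓝 c₀))
    (h₁ : Tendsto p₁ ℓ (𝓝 c₁)) (h₂ : Tendsto p₂ ℓ (𝓝 c₂)) :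
    Tendsto (fun y => -(u y ^ 3 / 3) * p₂ y + u y ^ 2 * w y * p₁ y +
        (u y ^ 3 / 3 - 1 / 2 * u y * w y ^ 2) * p₀ y) ℓ
      (𝓝 (-(a ^ 3 / 3) * c₂ + a ^ 2 * b * c₁ + (a ^ 3 / 3 - 1 / 2 * a * b ^ 2) * c₀)) :=
  ((((hu.pow 3).div_const 3).neg.mul h₂).add (((hu.pow 2).mul hw).mul h₁)).add
    ((((hu.pow 3).div_const 3).sub ((hu.const_mul (1 / 2)).mul (hw.pow 2))).mul h₀)

/-- The remaining terms of the Novikov equation, tested against `ψ`: only the jumps of the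
antiderivative at the peaks contribute. -/
theorem integral_novikov_terms {x : Fin n → ℝ} (hx : Function.Injective x) (m : Fin n → ℝ)
    {ψ : ℝ → ℝ} (hψ : ContDiff ℝ ∞ ψ) (hc : HasCompactSupport ψ) :
    ∫ y, (profile x m y ^ 3 / 3 * (4 * deriv ψ y - iteratedDeriv 3 ψ y)
        + 3 / 2 * profile x m y * deriv (profile x m) y ^ 2 * deriv ψ y
        - 1 / 2 * deriv (profile x m) y ^ 3 * ψ y) =
      ∑ i, (2 * m i * profile x m (x i) ^ 2 * deriv ψ (x i) -
        2 * m i * profile x m (x i) * profileSlope x m (x i) * ψ (x i)) := by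
  rw [← iteratedDeriv_one]
  have d0 (y : ℝ) : HasDerivAt ψ (iteratedDeriv 1 ψ y) y := by
    simpa using hasDerivAt_iteratedDeriv hψ 0 y
  have d1 := hasDerivAt_iteratedDeriv hψ 1
  have d2 := hasDerivAt_iteratedDeriv hψ 2
  have c1 := hasCompactSupport_iteratedDeriv hc 1
  have c2 := hasCompactSupport_iteratedDeriv hc 2
  have c3 := hasCompactSupport_iteratedDeriv hc 3
  have k0 := hψ.continuous
  have k1 := continuous_iteratedDeriv' hψ 1
  have k2 := continuous_iteratedDeriv' hψ 2
  have k3 := continuous_iteratedDeriv' hψ 3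
  generalize iteratedDeriv 1 ψ = p₁ at *
  generalize iteratedDeriv 2 ψ = p₂ at *
  generalize iteratedDeriv 3 ψ = p₃ at *
  have hfc : HasCompactSupport fun y => profile x m y ^ 3 / 3 * (4 * p₁ y - p₃ y)
        + 3 / 2 * profile x m y * deriv (profile x m) y ^ 2 * p₁ y
        - 1 / 2 * deriv (profile x m) y ^ 3 * ψ y :=
    HasCompactSupport.sub (HasCompactSupport.add (HasCompactSupport.mul_left
      (HasCompactSupport.sub (HasCompactSupport.mul_left c1) c3)) (HasCompactSupport.mul_left c1))
      (HasCompactSupport.mul_left hc)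
  have hFc : HasCompactSupport fun y => -(profile x m y ^ 3 / 3) * p₂ y +
      profile x m y ^ 2 * profileSlope x m y * p₁ y +
      (profile x m y ^ 3 / 3 - 1 / 2 * profile x m y * profileSlope x m y ^ 2) * ψ y :=
    HasCompactSupport.add (HasCompactSupport.add (HasCompactSupport.mul_left c2)
      (HasCompactSupport.mul_left c1)) (HasCompactSupport.mul_left hc)
  rw [integral_eq_neg_sum_jumps hx
    (J := fun i => -(2 * m i * profile x m (x i) ^ 2 * p₁ (x i) -
        2 * m i * profile x m (x i) * profileSlope x m (x i) * ψ (x i))) hFc hfc ?_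
    (integrable_novikov_terms x m k0 k1 k3 hc c1 c3) ?_]
  · simp
  · intro y hy
    rw [(hasDerivAt_profile x m hy).deriv]
    exact hasDerivAt_novikov_antideriv (hasDerivAt_profile x m hy) (hasDerivAt_profileSlope x m hy)
      (d0 y) (d1 y) (d2 y)
  · intro i
    have lim {g : ℝ → ℝ} (hg : Continuous g) (s : Set ℝ) : Tendsto g (𝓝[s] (x i)) (𝓝 (g (x i))) :=
      (hg.tendsto (x i)).mono_left nhdsWithin_le_nhds
    have hu := continuous_profile x m
    refine ⟨_, _, tendsto_novikov_antideriv (lim hu _) (tendsto_profileSlope_left hx m i)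
      (lim k0 _) (lim k1 _) (lim k2 _), tendsto_novikov_antideriv (lim hu _)
      (tendsto_profileSlope_right hx m i) (lim k0 _) (lim k1 _) (lim k2 _), ?_⟩
    ring

theorem isWeakNovikovSolution_profile {x m : ℝ → Fin n → ℝ}
    (hinj : ∀ t, Function.Injective (x t))
    (h : ∀ t i, HasDerivAt (fun s => x s i) (profile (x t) (m t) (x t i) ^ 2) t ∧
      HasDerivAt (fun s => m s i) (-(m t i) * profile (x t) (m t) (x t i) *
        profileSlope (x t) (m t) (x t i)) t) :
    IsWeakNovikovSolution fun t => profile (x t) (m t) := by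
  refine ⟨fun t => locallyLipschitz_profile _ _, fun ψ hψ hc t => ?_⟩
  rw [integral_novikov_terms (hinj t) (m t) hψ hc]
  simp only [integral_profile_mul (hinj _) (m _) hψ hc]
  refine HasDerivAt.fun_sum fun i _ => ?_
  have d0 : HasDerivAt ψ (deriv ψ (x t i)) (x t i) :=
    (hψ.differentiable (by simp) _).hasDerivAt
  have := ((h t i).2.const_mul 2).mul (d0.comp t (h t i).1)
  refine this.congr_deriv ?_
  simp only [Function.comp_apply]
  ring

end Weak

/-! ### Isospectrality -/

section Isospectral

open Filter Topology Matrix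

section Jacobi

variable {ι : Type*} [Fintype ι]

theorem hasDerivAt_mul_apply {A B : ℝ → Matrix ι ι ℝ} {A' B' : Matrix ι ι ℝ} {t : ℝ}
    (hA : ∀ i j, HasDerivAt (fun s => A s i j) (A' i j) t)
    (hB : ∀ i j, HasDerivAt (fun s => B s i j) (B' i j) t) (i j : ι) :
    HasDerivAt (fun s => (A s * B s) i j) ((A' * B t + A t * B') i j) t := by
  rw [Matrix.add_apply]
  simp only [mul_apply, ← Finset.sum_add_distrib]
  exact HasDerivAt.fun_sum fun k _ => (hA i k).mul (hB k j)

variable [DecidableEq ι]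

/-- Jacobi's formula for the derivative of a determinant. -/
theorem hasDerivAt_det {A : ℝ → Matrix ι ι ℝ} {A' : Matrix ι ι ℝ} {t : ℝ}
    (h : ∀ i j, HasDerivAt (fun s => A s i j) (A' i j) t) :
    HasDerivAt (fun s => (A s).det) ((A t).adjugate * A').trace t := by
  have h1 : ((A t).adjugate * A').trace = ∑ i, ((A t).updateCol i fun k => A' k i).det := by
    rw [Matrix.trace]
    refine Finset.sum_congr rfl fun i _ => ?_
    rw [← cramer_apply, cramer_eq_adjugate_mulVec]
    rfl
  simp only [h1, det_apply']
  rw [Finset.sum_comm]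
  refine HasDerivAt.fun_sum fun σ _ => ?_
  rw [← Finset.mul_sum]
  refine HasDerivAt.const_mul _ ?_
  refine (HasDerivAt.fun_finsetProd fun i _ => h (σ i) i).congr_deriv ?_
  refine Finset.sum_congr rfl fun i _ => ?_
  rw [← Finset.mul_prod_erase _ _ (Finset.mem_univ i), updateCol_self, smul_eq_mul, mul_comm]
  congr 1
  refine Finset.prod_congr rfl fun j hj => ?_
  rw [updateCol_ne (Finset.ne_of_mem_erase hj)]

/-- The flow of a Lax equation `Ȧ = BA - AB` preserves the characteristic polynomial. -/
theorem eval_charpoly_eq_of_lax {A B : ℝ → Matrix ι ι ℝ}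
    (h : ∀ t i j, HasDerivAt (fun s => A s i j) ((B t * A t - A t * B t) i j) t) (z s t : ℝ) :
    (A s).charpoly.eval z = (A t).charpoly.eval z := by
  simp only [Matrix.eval_charpoly]
  refine is_const_of_deriv_eq_zero (f := fun t => (scalar ι z - A t).det)
    (fun r => (hasDerivAt_det fun i j => ((h r i j).const_sub _)).differentiableAt)
    (fun r => ?_) s t
  have h1 : Matrix.of (fun i j => -(B r * A r - A r * B r) i j) =
      B r * (scalar ι z - A r) - (scalar ι z - A r) * B r := by
    have : scalar ι z * B r = B r * scalar ι z := (scalar_commute z (fun _ => mul_comm _ _) _).eq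
    rw [mul_sub, sub_mul, this]
    ext i j
    simp only [of_apply, Matrix.sub_apply]
    ring
  refine ((hasDerivAt_det (A := fun t => scalar ι z - A t)
    (A' := Matrix.of (fun i j => -(B r * A r - A r * B r) i j))
    fun i j => ((h r i j).const_sub _)).deriv).trans ?_
  rw [h1, mul_sub, trace_sub, ← mul_assoc, ← mul_assoc, trace_mul_comm, ← mul_assoc, mul_adjugate,
    adjugate_mul, sub_self]

end Jacobi

variable {n : ℕ}

/-- The matrix `E = (exp(-|xᵢ - xⱼ|))`. -/
noncomputable def expMatrix (x : Fin n → ℝ) : Matrix (Fin n) (Fin n) ℝ :=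
  Matrix.of fun i j => Real.exp (-|x i - x j|)

/-- The matrix `S`, lower triangular with `1` on and `2` below the diagonal. -/
def stepMatrix (n : ℕ) : Matrix (Fin n) (Fin n) ℝ :=
  Matrix.of fun i j => if j < i then (2 : ℝ) else if i = j then 1 else 0

theorem spectralMatrix_eq (x m : Fin n → ℝ) :
    spectralMatrix x m = expMatrix x * diagonal m * stepMatrix n * diagonal m := rfl

theorem exp_neg_abs_mul {a b c : ℝ} (h : a ≤ b ∧ b ≤ c ∨ c ≤ b ∧ b ≤ a) :
    Real.exp (-|a - b|) * Real.exp (-|b - c|) = Real.exp (-|a - c|) := by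
  rw [← Real.exp_add]
  congr 1
  rcases h with ⟨h1, h2⟩ | ⟨h1, h2⟩
  · rw [abs_of_nonpos (by linarith), abs_of_nonpos (by linarith), abs_of_nonpos (by linarith)]
    ring
  · rw [abs_of_nonneg (by linarith), abs_of_nonneg (by linarith), abs_of_nonneg (by linarith)]
    ring

theorem stepMatrix_apply_eq {x : Fin n → ℝ} (hx : StrictMono x) (i j : Fin n) :
    stepMatrix n i j = 1 + (SignType.sign (x i - x j) : ℝ) := by
  rw [stepMatrix, of_apply]
  rcases lt_trichotomy i j with h | rfl | h
  · rw [if_neg h.not_gt, if_neg h.ne, sign_neg (sub_neg.mpr (hx h))]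
    simp
  · simp
  · rw [if_pos h, sign_pos (sub_pos.mpr (hx h))]
    norm_num

theorem profile_eq_sum_expMatrix (x m : Fin n → ℝ) (i : Fin n) :
    profile x m (x i) = ∑ k, m k * expMatrix x i k := rfl

theorem profileSlope_eq_sum_expMatrix (x m : Fin n → ℝ) (i : Fin n) :
    profileSlope x m (x i) =
      ∑ k, -(m k * (SignType.sign (x i - x k) : ℝ) * expMatrix x i k) := rfl

theorem expMatrix_symm (x : Fin n → ℝ) (i j : Fin n) : expMatrix x i j = expMatrix x j i := by
  rw [expMatrix, of_apply, of_apply, abs_sub_comm]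

theorem expMatrix_mul {x : Fin n → ℝ} (hx : StrictMono x) {i j k : Fin n}
    (h : i ≤ j ∧ j ≤ k ∨ k ≤ j ∧ j ≤ i) :
    expMatrix x i j * expMatrix x j k = expMatrix x i k := by
  refine exp_neg_abs_mul (h.imp ?_ ?_) <;> exact fun h => ⟨hx.monotone h.1, hx.monotone h.2⟩

theorem step_mul_exp_apply (x m : Fin n → ℝ) (i j : Fin n) :
    (stepMatrix n * diagonal m * expMatrix x) i j =
      ∑ k, stepMatrix n i k * m k * expMatrix x k j := by
  rw [mul_apply]
  exact Finset.sum_congr rfl fun k _ => by rw [mul_diagonal]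

theorem exp_mul_step_apply (x m : Fin n → ℝ) (i j : Fin n) :
    (expMatrix x * diagonal m * stepMatrix n) i j =
      ∑ k, expMatrix x i k * m k * stepMatrix n k j := by
  rw [mul_apply]
  exact Finset.sum_congr rfl fun k _ => by rw [mul_diagonal]

theorem sign_sub_comm (a b : ℝ) : (SignType.sign (a - b) : ℝ) = -(SignType.sign (b - a) : ℝ) := by
  rw [← neg_sub b a, Left.sign_neg]
  simp

/-- The entries of `S P E` and `E P S` can be expressed by `u` and `⟨uₓ⟩` at the peaks, because
`exp(-|xᵢ - xⱼ|)` is multiplicative along monotone triples. -/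
theorem step_mul_exp_of_le {x : Fin n → ℝ} (hx : StrictMono x) (m : Fin n → ℝ) {i j : Fin n}
    (h : i ≤ j) : (stepMatrix n * diagonal m * expMatrix x) i j =
      expMatrix x i j * (profile x m (x i) - profileSlope x m (x i)) := by
  rw [step_mul_exp_apply, profile_eq_sum_expMatrix, profileSlope_eq_sum_expMatrix,
    ← Finset.sum_sub_distrib, Finset.mul_sum]
  refine Finset.sum_congr rfl fun k _ => ?_
  rw [stepMatrix_apply_eq hx]
  rcases le_or_gt k i with hk | hk
  · rw [← expMatrix_mul hx (Or.inl ⟨hk, h⟩), expMatrix_symm x k i]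
    ring
  · rw [sign_neg (sub_neg.mpr (hx hk))]
    simp

theorem step_mul_exp_of_lt {x : Fin n → ℝ} (hx : StrictMono x) (m : Fin n → ℝ) {i j : Fin n}
    (h : j < i) : (stepMatrix n * diagonal m * expMatrix x) i j =
      2 * profile x m (x j) - expMatrix x i j * (profile x m (x i) + profileSlope x m (x i)) := by
  rw [step_mul_exp_apply, profile_eq_sum_expMatrix, profile_eq_sum_expMatrix,
    profileSlope_eq_sum_expMatrix, ← Finset.sum_add_distrib, Finset.mul_sum, Finset.mul_sum,
    ← Finset.sum_sub_distrib]
  refine Finset.sum_congr rfl fun k _ => ?_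
  rw [stepMatrix_apply_eq hx, expMatrix_symm x j k]
  rcases lt_or_ge k i with hk | hk
  · rw [sign_pos (sub_pos.mpr (hx hk)), SignType.coe_one]
    ring
  · rw [← expMatrix_mul hx (Or.inr ⟨h.le, hk⟩), expMatrix_symm x k i]
    ring

theorem exp_mul_step_of_le {x : Fin n → ℝ} (hx : StrictMono x) (m : Fin n → ℝ) {i j : Fin n}
    (h : i ≤ j) : (expMatrix x * diagonal m * stepMatrix n) i j =
      expMatrix x i j * (profile x m (x j) + profileSlope x m (x j)) := by
  rw [exp_mul_step_apply, profile_eq_sum_expMatrix, profileSlope_eq_sum_expMatrix,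
    ← Finset.sum_add_distrib, Finset.mul_sum]
  refine Finset.sum_congr rfl fun k _ => ?_
  rw [stepMatrix_apply_eq hx, sign_sub_comm]
  rcases le_or_gt j k with hk | hk
  · rw [← expMatrix_mul hx (Or.inl ⟨h, hk⟩)]
    ring
  · rw [sign_pos (sub_pos.mpr (hx hk))]
    simp

theorem exp_mul_step_of_lt {x : Fin n → ℝ} (hx : StrictMono x) (m : Fin n → ℝ) {i j : Fin n}
    (h : j < i) : (expMatrix x * diagonal m * stepMatrix n) i j =
      2 * profile x m (x i) - expMatrix x i j * (profile x m (x j) - profileSlope x m (x j)) := by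
  rw [exp_mul_step_apply, profile_eq_sum_expMatrix, profile_eq_sum_expMatrix,
    profileSlope_eq_sum_expMatrix, ← Finset.sum_sub_distrib, Finset.mul_sum, Finset.mul_sum,
    ← Finset.sum_sub_distrib]
  refine Finset.sum_congr rfl fun k _ => ?_
  rw [stepMatrix_apply_eq hx, sign_sub_comm]
  rcases lt_or_ge j k with hk | hk
  · rw [sign_neg (sub_neg.mpr (hx hk))]
    rw [SignType.coe_neg_one]
    ring
  · rw [← expMatrix_mul hx (Or.inr ⟨hk, h.le⟩)]
    ring

/-- The time derivative of `(exp(-|xᵢ - xⱼ|))` along the peakon flow, as a matrix expression. -/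
theorem exp_deriv_apply {x : Fin n → ℝ} (hx : StrictMono x) (m : Fin n → ℝ) (i j : Fin n) :
    let u := fun i => profile x m (x i)
    let D := (diagonal fun i => profile x m (x i) * profileSlope x m (x i) : Matrix _ _ ℝ);
    -((SignType.sign (x i - x j) : ℝ) * (u i ^ 2 - u j ^ 2)) * expMatrix x i j =
      (expMatrix x * D + D * expMatrix x + diagonal u * (stepMatrix n * diagonal m * expMatrix x) -
        expMatrix x * diagonal m * stepMatrix n * diagonal u) i j := by
  intro u D
  simp only [Matrix.sub_apply, Matrix.add_apply, D, mul_diagonal, diagonal_mul]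
  rcases lt_trichotomy i j with h | rfl | h
  · rw [step_mul_exp_of_le hx m h.le, exp_mul_step_of_le hx m h.le, sign_neg (sub_neg.mpr (hx h))]
    simp only [u, SignType.coe_neg_one]
    ring
  · rw [step_mul_exp_of_le hx m le_rfl, exp_mul_step_of_le hx m le_rfl]
    simp only [u, sub_self]
    ring
  · rw [step_mul_exp_of_lt hx m h, exp_mul_step_of_lt hx m h, sign_pos (sub_pos.mpr (hx h))]
    simp only [u, SignType.coe_one]
    ring

/-- The algebra behind the Lax equation: the left side is the derivative of `E P S P`, by the
product rule, if `Ṗ = -P D` and `Ė = E D + D E + U S P E - E P S U`. -/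
theorem lax_ring_identity {R : Type*} [Ring R] (E S : R) {P D U : R} (hD : P * D = D * P)
    (hU : P * U = U * P) :
    ((E * D + D * E + U * (S * P * E) - E * P * S * U) * P + E * -(P * D)) * S * P +
        E * P * S * -(P * D) =
      (D + U * S * P) * (E * P * S * P) - E * P * S * P * (D + U * S * P) := by
  have hU' (a : R) : P * (U * a) = U * (P * a) := by rw [← mul_assoc, hU, mul_assoc]
  simp only [mul_add, add_mul, sub_mul, mul_neg, neg_mul, mul_assoc, hD, hU']
  abel

/-- The Lax equation `Ṁ = BM - MB` for `M = E P S P`, with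
`B = diag(u uₓ) + diag(u) S P`. -/
theorem hasDerivAt_spectralMatrix {x m : ℝ → Fin n → ℝ} (hmono : ∀ t, StrictMono (x t))
    (h : ∀ t i, HasDerivAt (fun s => x s i) (profile (x t) (m t) (x t i) ^ 2) t ∧
      HasDerivAt (fun s => m s i) (-(m t i) * profile (x t) (m t) (x t i) *
        profileSlope (x t) (m t) (x t i)) t) (t : ℝ) (i j : Fin n) :
    let B := (diagonal fun i => profile (x t) (m t) (x t i) * profileSlope (x t) (m t) (x t i)) +
      diagonal (fun i => profile (x t) (m t) (x t i)) * stepMatrix n * diagonal (m t)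
    HasDerivAt (fun s => spectralMatrix (x s) (m s) i j)
      ((B * spectralMatrix (x t) (m t) - spectralMatrix (x t) (m t) * B) i j) t := by
  intro B
  set u := fun i => profile (x t) (m t) (x t i) with hu
  set D := diagonal fun i => profile (x t) (m t) (x t i) * profileSlope (x t) (m t) (x t i) with hD
  have hE (i j : Fin n) : HasDerivAt (fun s => expMatrix (x s) i j)
      ((expMatrix (x t) * D + D * expMatrix (x t) +
        diagonal u * (stepMatrix n * diagonal (m t) * expMatrix (x t)) -
        expMatrix (x t) * diagonal (m t) * stepMatrix n * diagonal u) i j) t := by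
    rw [← exp_deriv_apply (hmono t)]
    simp only [expMatrix, of_apply]
    rcases eq_or_ne i j with rfl | hij
    · simpa using hasDerivAt_const t (1 : ℝ)
    · have hne : x t i - x t j ≠ 0 := sub_ne_zero.mpr ((hmono t).injective.ne hij)
      have h1 := ((hasDerivAt_abs hne).comp t ((h t i).1.sub (h t j).1)).neg.exp
      refine h1.congr_deriv ?_
      change Real.exp (-|x t i - x t j|) * _ = _
      ring
  have hP (i j : Fin n) : HasDerivAt (fun s => diagonal (m s) i j)
      ((-(diagonal (m t) * D)) i j) t := by
    rcases eq_or_ne i j with rfl | hij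
    · simp only [diagonal_apply_eq]
      refine (h t i).2.congr_deriv ?_
      rw [Matrix.neg_apply, hD, diagonal_mul_diagonal, diagonal_apply_eq]
      ring
    · simp only [diagonal_apply_ne _ hij]
      refine (hasDerivAt_const t (0 : ℝ)).congr_deriv ?_
      rw [Matrix.neg_apply, hD, diagonal_mul_diagonal, diagonal_apply_ne _ hij, neg_zero]
  have hS (i j : Fin n) : HasDerivAt (fun _ => stepMatrix n i j) ((0 : Matrix _ _ ℝ) i j) t :=
    hasDerivAt_const t _
  simp only [spectralMatrix_eq]
  refine (hasDerivAt_mul_apply (hasDerivAt_mul_apply (hasDerivAt_mul_apply hE hP) hS) hP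
    i j).congr_deriv ?_
  rw [mul_zero, add_zero]
  have hd (f g : Fin n → ℝ) : diagonal f * diagonal g = diagonal g * diagonal f := by
    simp only [diagonal_mul_diagonal, mul_comm]
  exact congrFun (congrFun (lax_ring_identity (expMatrix (x t)) (stepMatrix n) (hd _ _)
    (hd _ _)) i) j

section Limit

variable {ζ b₀ : Fin n → ℝ}

theorem sub_val_eq_rev (i : Fin n) : (n : ℤ) - (i : ℕ) = ((i.rev : ℕ) + 1 : ℕ) := by
  rw [Fin.val_rev]
  omega

theorem sub_val_sub_one_eq_rev (i : Fin n) : (n : ℤ) - (i : ℕ) - 1 = ((i.rev : ℕ) : ℕ) := by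
  rw [Fin.val_rev]
  omega

/-- For large `t`, `exp(xᵢ)` is asymptotically proportional to one of the exponentials `b_j(t)`; the
last peakon belongs to the one that grows fastest. -/
theorem tendsto_exp_position (hζ : ∀ j, 0 < ζ j) (hmono : StrictMono ζ) (hb : ∀ j, 0 < b₀ j)
    (i : Fin n) : ∃ c : ℝ, 0 < c ∧
    Tendsto (fun t => Real.exp (position n (tauSum ζ (flow ζ b₀ t) (-1))
      (tauSum ζ (flow ζ b₀ t) 0) (tauSum ζ (flow ζ b₀ t) 1) i) / flow ζ b₀ t i.rev)
      atTop (𝓝 c) := by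
  have hz := tendsto_zOf hζ hmono hb (K := i.rev + 1) i.rev.isLt
  have hw := tendsto_wOf hζ hmono hb (K := i.rev) i.rev.isLt.le
  have pz : 0 < tauCoeff ζ (leadSet n (i.rev + 1)) ^ 2 / ∏ j ∈ leadSet n (i.rev + 1), ζ j :=
    div_pos (pow_pos (tauCoeff_pos hζ hmono _) 2) (Finset.prod_pos fun j _ => hζ j)
  have pw : 0 < tauCoeff ζ (leadSet n i.rev) ^ 2 * ∏ j ∈ leadSet n i.rev, ζ j :=
    mul_pos (pow_pos (tauCoeff_pos hζ hmono _) 2) (Finset.prod_pos fun j _ => hζ j)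
  refine ⟨_, Real.sqrt_pos.mpr (div_pos pz pw), ((hz.div hw pw.ne').sqrt).congr fun t => ?_⟩
  have hf := flow_pos (ζ := ζ) hb t i.rev
  have hl := leadProd_pos (ζ := ζ) hb i.rev t
  have hs : leadProd ζ b₀ (i.rev + 1) t = flow ζ b₀ t i.rev * leadProd ζ b₀ i.rev t :=
    prod_leadSet_succ i.rev.isLt _
  have hexp := (admissible_tauSum hζ hmono hb t).exp_position_sq i
  have hw' := (admissible_tauSum hζ hmono hb t).wOf_pos i
  rw [sub_val_sub_one_eq_rev] at hw' hexp
  rw [sub_val_eq_rev] at hexp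
  rw [← Real.sqrt_sq (div_pos (Real.exp_pos _) hf).le, div_pow, hexp, Pi.div_apply, hs]
  congr 1
  field_simp

theorem tendsto_momentum (hζ : ∀ j, 0 < ζ j) (hmono : StrictMono ζ) (hb : ∀ j, 0 < b₀ j)
    (i : Fin n) :
    Tendsto (fun t => momentum n (tauSum ζ (flow ζ b₀ t) (-1))
      (tauSum ζ (flow ζ b₀ t) 0) (tauSum ζ (flow ζ b₀ t) 1) i) atTop (𝓝 √(ζ i.rev)⁻¹) := by
  have hz := tendsto_zOf hζ hmono hb (K := i.rev + 1) i.rev.isLt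
  have hw := tendsto_wOf hζ hmono hb (K := i.rev) i.rev.isLt.le
  have hu := tendsto_tauU hζ hmono hb (K := i.rev + 1) i.rev.isLt
  have hu' := tendsto_tauU hζ hmono hb (K := i.rev) i.rev.isLt.le
  have p := tauCoeff_pos hζ hmono (leadSet n (i.rev + 1))
  have p' := tauCoeff_pos hζ hmono (leadSet n i.rev)
  have pζ : 0 < ∏ j ∈ leadSet n i.rev, ζ j := Finset.prod_pos fun j _ => hζ j
  have hlim : (ζ i.rev)⁻¹ =
      (tauCoeff ζ (leadSet n (i.rev + 1)) ^ 2 / ∏ j ∈ leadSet n (i.rev + 1), ζ j) *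
        (tauCoeff ζ (leadSet n i.rev) ^ 2 * ∏ j ∈ leadSet n i.rev, ζ j) /
        (tauCoeff ζ (leadSet n (i.rev + 1)) * tauCoeff ζ (leadSet n i.rev)) ^ 2 := by
    have := hζ i.rev
    rw [prod_leadSet_succ i.rev.isLt]
    field_simp
  rw [hlim]
  refine (((hz.mul hw).div ((hu.mul hu').pow 2)
    (pow_pos (mul_pos p p') 2).ne').sqrt).congr fun t => ?_
  have hl := leadProd_pos (ζ := ζ) hb i.rev t
  have hl' := leadProd_pos (ζ := ζ) hb (i.rev + 1) t
  have hadm := admissible_tauSum hζ hmono hb t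
  have hU := hadm.U_pos' i
  have hU' := hadm.U_sub_one_pos i
  rw [momentum]
  rw [sub_val_sub_one_eq_rev] at hU' ⊢
  rw [sub_val_eq_rev] at hU ⊢
  rw [← Real.sqrt_sq (mul_pos hU hU').le, ← Real.sqrt_div' _ (sq_nonneg _)]
  congr 1
  simp only [Pi.div_apply]
  field_simp

theorem tendsto_expMatrix (hζ : ∀ j, 0 < ζ j) (hmono : StrictMono ζ) (hb : ∀ j, 0 < b₀ j) :
    Tendsto (fun t => expMatrix (position n (tauSum ζ (flow ζ b₀ t) (-1))
      (tauSum ζ (flow ζ b₀ t) 0) (tauSum ζ (flow ζ b₀ t) 1))) atTop (𝓝 1) := by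
  have key {i j : Fin n} (hij : i < j) :
      Tendsto (fun t => expMatrix (position n (tauSum ζ (flow ζ b₀ t) (-1))
        (tauSum ζ (flow ζ b₀ t) 0) (tauSum ζ (flow ζ b₀ t) 1)) i j) atTop (𝓝 0) := by
    obtain ⟨c, _, hci⟩ := tendsto_exp_position hζ hmono hb i
    obtain ⟨d, hd, hdj⟩ := tendsto_exp_position hζ hmono hb j
    have h := (hci.div hdj hd.ne').mul
      (tendsto_flow_div (b₀ := b₀) hζ hmono (Fin.rev_lt_rev.mpr hij))
    rw [mul_zero] at h
    refine h.congr fun t => ?_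
    have hfi := flow_pos (ζ := ζ) hb t i.rev
    have hfj := flow_pos (ζ := ζ) hb t j.rev
    rw [expMatrix, of_apply, exp_neg_abs_sub_of_ge
      ((admissible_tauSum hζ hmono hb t).ordered hij).le, Real.exp_neg]
    simp only [Pi.div_apply]
    field_simp
  refine tendsto_pi_nhds.mpr fun i => tendsto_pi_nhds.mpr fun j => ?_
  rcases lt_trichotomy i j with h | rfl | h
  · rw [one_apply_ne h.ne]
    exact key h
  · simp [expMatrix]
  · rw [one_apply_ne h.ne']
    simp only [expMatrix_symm _ i j]
    exact key h

/-- The spectrum is conserved, and is read off in the limit `t → ∞`, where the peakons are far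
apart and `E P S P` becomes triangular. -/
theorem charpoly_spectralMatrix (hζ : ∀ j, 0 < ζ j) (hmono : StrictMono ζ) (hb : ∀ j, 0 < b₀ j)
    (t : ℝ) :
    (spectralMatrix (position n (tauSum ζ (flow ζ b₀ t) (-1)) (tauSum ζ (flow ζ b₀ t) 0)
      (tauSum ζ (flow ζ b₀ t) 1)) (momentum n (tauSum ζ (flow ζ b₀ t) (-1))
      (tauSum ζ (flow ζ b₀ t) 0) (tauSum ζ (flow ζ b₀ t) 1))).charpoly =
      ∏ j, (Polynomial.X - Polynomial.C (ζ j)⁻¹) := by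
  set x := fun t => position n (tauSum ζ (flow ζ b₀ t) (-1)) (tauSum ζ (flow ζ b₀ t) 0)
    (tauSum ζ (flow ζ b₀ t) 1) with hx
  set m := fun t => momentum n (tauSum ζ (flow ζ b₀ t) (-1)) (tauSum ζ (flow ζ b₀ t) 0)
    (tauSum ζ (flow ζ b₀ t) 1) with hm
  set P : Matrix (Fin n) (Fin n) ℝ := diagonal fun i => √(ζ i.rev)⁻¹ with hP
  have hlax := hasDerivAt_spectralMatrix (x := x) (m := m)
    (fun t => (admissible_tauSum hζ hmono hb t).ordered)
    (fun t i => hasDerivAt_position_momentum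
      (fun t k => ⟨hasDerivAt_tauSum hζ (-1) t k, hasDerivAt_tauSum hζ 0 t k,
        hasDerivAt_tauSum hζ 1 t k⟩) (fun t => admissible_tauSum hζ hmono hb t)
      (fun t => bilinearIdentities_tauSum hζ t n) t i)
  have hmlim : Tendsto (fun t => diagonal (m t)) atTop (𝓝 P) :=
    (continuous_id.matrix_diagonal.tendsto _).comp
      (tendsto_pi_nhds.mpr fun i => tendsto_momentum hζ hmono hb i)
  have hlim : Tendsto (fun t => spectralMatrix (x t) (m t)) atTop (𝓝 (1 * P * stepMatrix n * P)) :=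
    (((tendsto_expMatrix hζ hmono hb).mul hmlim).mul tendsto_const_nhds).mul hmlim
  have htri : (1 * P * stepMatrix n * P)ᵀ.IsUpperTriangular := by
    intro i j hij
    rw [transpose_apply, one_mul, hP, mul_diagonal, diagonal_mul, stepMatrix, of_apply,
      if_neg (by exact lt_asymm hij), if_neg (by exact ne_of_lt hij)]
    simp
  have hchar : (1 * P * stepMatrix n * P).charpoly =
      ∏ j, (Polynomial.X - Polynomial.C (ζ j)⁻¹) := by
    rw [← charpoly_transpose, charpoly_of_isUpperTriangular _ htri, ← Equiv.prod_comp Fin.revPerm]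
    refine Finset.prod_congr rfl fun i _ => ?_
    rw [transpose_apply, one_mul, hP, mul_diagonal, diagonal_mul, stepMatrix, of_apply,
      if_neg (lt_irrefl _), if_pos rfl, mul_one, Real.mul_self_sqrt (inv_pos.mpr (hζ _)).le]
    simp
  rw [← hchar]
  refine Polynomial.funext fun z => ?_
  refine tendsto_nhds_unique (f := fun s => (spectralMatrix (x s) (m s)).charpoly.eval z)
    (l := atTop) ?_ ?_
  · exact tendsto_const_nhds.congr fun s => eval_charpoly_eq_of_lax hlax z t s
  · simp only [Matrix.eval_charpoly]
    exact ((continuous_const.sub continuous_id).matrix_det.tendsto _).comp hlim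

end Limit

end Isospectral

end NovikovPeakon

theorem mainTheorem1 (n : ℕ) (ζ b₀ : Fin n → ℝ) (hζ : ∀ j, 0 < ζ j) (hmono : StrictMono ζ)
    (hb : ∀ j, 0 < b₀ j)
    (T U V : ℝ → ℤ → ℝ)
    (hT : T = fun t => tauT ζ (flow ζ b₀ t))
    (hU : U = fun t => tauU ζ (flow ζ b₀ t))
    (hV : V = fun t => tauV ζ (flow ζ b₀ t))
    (x m : ℝ → Fin n → ℝ)
    (hx : x = fun t => position n (T t) (U t) (V t))
    (hm : m = fun t => momentum n (T t) (U t) (V t)) :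
    -- the formulas make sense, the peaks are ordered, the momenta are positive
    (∀ t, Admissible n (T t) (U t) (V t)) ∧
    (∀ t k, 0 < m t k) ∧
    -- the peakon equations and the Novikov equation
    SolvesPeakonODE x m ∧
    IsWeakNovikovSolution (fun t => profile (x t) (m t)) ∧
    -- isospectrality
    (∀ t, (spectralMatrix (x t) (m t)).charpoly =
      ∏ j, (Polynomial.X - Polynomial.C (ζ j)⁻¹)) ∧
    -- the Pfaffian entries converge, and `T`, `U`, `V` are Pfaffians
    (∀ t i j, MeasureTheory.IntegrableOn (entryIntegrand ζ b₀ i j) (entryDomain t)) ∧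
    (∀ t k, T t k = pfTau ζ b₀ (-1) t k ∧ U t k = pfTau ζ b₀ 0 t k ∧
      V t k = pfTau ζ b₀ 1 t k) ∧
    -- derivative formulas, of Wronski type and of Gram type
    (∀ l t k, HasDerivAt (fun s => pfTau ζ b₀ l s k) (pfTauWronski ζ b₀ l t k) t ∧
      pfTauWronski ζ b₀ l t k = pfTauGram ζ b₀ l t k) ∧
    -- bilinear identities among the Pfaffians
    (∀ t, BilinearIdentities n
      (pfTau ζ b₀ (-1) t) (pfTau ζ b₀ 0 t) (pfTau ζ b₀ 1 t)
      (pfTauWronski ζ b₀ (-1) t) (pfTauWronski ζ b₀ 0 t) (pfTauWronski ζ b₀ 1 t)) ∧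
    -- reduction: the peakon equations follow from derivative formulas and bilinear identities
    (∀ A B C A' B' C' : ℝ → ℤ → ℝ,
      (∀ t k, HasDerivAt (fun s => A s k) (A' t k) t ∧ HasDerivAt (fun s => B s k) (B' t k) t ∧
        HasDerivAt (fun s => C s k) (C' t k) t) →
      (∀ t, Admissible n (A t) (B t) (C t)) →
      (∀ t, BilinearIdentities n (A t) (B t) (C t) (A' t) (B' t) (C' t)) →
      SolvesPeakonODE (fun t => position n (A t) (B t) (C t))
        (fun t => momentum n (A t) (B t) (C t))) := by
  obtain rfl : T = fun t => tauSum ζ (flow ζ b₀ t) (-1) :=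
    hT.trans (funext fun t => funext fun k => tauT_eq_tauSum _ _ _)
  obtain rfl : U = fun t => tauSum ζ (flow ζ b₀ t) 0 :=
    hU.trans (funext fun t => funext fun k => tauU_eq_tauSum _ _ _)
  obtain rfl : V = fun t => tauSum ζ (flow ζ b₀ t) 1 :=
    hV.trans (funext fun t => funext fun k => tauV_eq_tauSum _ _ _)
  subst hx hm
  have hadm := admissible_tauSum hζ hmono hb
  have hd := fun t k => And.intro (hasDerivAt_tauSum (b₀ := b₀) hζ (-1) t k)
    (And.intro (hasDerivAt_tauSum (b₀ := b₀) hζ 0 t k) (hasDerivAt_tauSum (b₀ := b₀) hζ 1 t k))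
  have hbil := fun t => bilinearIdentities_tauSum (b₀ := b₀) hζ t n
  exact ⟨hadm, fun t k => (hadm t).momentum_pos k,
    solvesPeakonODE_of_bilinearIdentities hd hadm hbil,
    isWeakNovikovSolution_profile (fun t => (hadm t).ordered.injective)
      (hasDerivAt_position_momentum hd hadm hbil),
    charpoly_spectralMatrix hζ hmono hb,
    integrableOn_entryIntegrand b₀ hζ,
    fun t k => ⟨(pfTau_eq_tauSum b₀ hζ (-1) t k).symm, (pfTau_eq_tauSum b₀ hζ 0 t k).symm,
      (pfTau_eq_tauSum b₀ hζ 1 t k).symm⟩,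
    fun _ _ k => ⟨hasDerivAt_pfTau_wronski b₀ hζ k, pfTauWronski_eq_pfTauGram b₀ hζ k⟩,
    fun t => bilinearIdentities_pfTau b₀ hζ t n,
    fun _ _ _ _ _ _ => solvesPeakonODE_of_bilinearIdentities⟩
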